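/- Let $(M,J,g)$ be a Hermitian manifold of complex dimension $n$ (not necessarily compact), that is, a complex manifold with a smooth Riemannian metric $g$ such that $g(JX,JY)=g(X,Y)$. Let $\omega(X,Y)=g(JX,Y)$ be its fundamental form, $\mathcal A=\bigoplus_k\mathcal A^k$ its real de Rham algebra, with exterior differential $d$, and $\mathcal A_{\mathbb C}=\mathcal A\otimes_{\mathbb R}\mathbb C$, with $d=\partial+\bar\partial$, where $\partial$ has bidegree $(1,0)$ and $\bar\partial$ has bidegree $(0,1)$. Extend $J$ to forms by $(J\alpha)(X_1,\dots,X_k)=\alpha(JX_1,\dots,JX_k)$. Let $\star$ be the Hodge star operator, $L\eta=\omega\wedge\eta$, and let $\Lambda=L^*$, where $^*$ denotes the adjoint with respect to the pointwise (Hermitian) inner product of forms; for the differential operators $d_c$ and $\partial$ it denotes instead the formal adjoint, given by $\star$ below. Put \[ d_c=J^{-1}dJ,\qquad d_c^*=-\star d_c\star,\qquad \partial^*=-\star\bar\partial\star , \] \[ T=[\Lambda,d\omega\wedge-],\qquad T_c=J^{-1}TJ,\qquad d\omega_c=J^{-1}(d\omega\wedge-)J,\qquad \lambda=[\partial,L]=\partial\omega\wedge-,\qquad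 \tau=[\Lambda,\lambda], \] where brackets are graded commutators. A commutative $\mathrm{BV}_\infty$-algebra is a tuple $(A,\wedge,d=\Delta_0,\Delta_1,\Delta_2,\dots)$ such that $(A,\wedge,d)$ is a unital graded commutative dg-algebra, $\Delta_k$ is a linear operator of degree $1-2k$, $\sum_{i=0}^n\Delta_i\Delta_{n-i}=0$ for all $n\ge 0$, and $\Delta_k$ has algebraic order $\le k+1$. Here an operator has order $\le 0$ if it is $A$-linear in the graded sense, and order $\le r$ if its graded commutators with all left multiplications have order $\le r-1$. Then the pointwise adjoints $\Lambda$, $T_c^*$, $(d\omega_c)^*$, $\tau^*$ and $\lambda^*$ exist, and the following hold. 1. The tuple $\bigl(\mathcal A,\wedge,\ \Delta_0=d,\ \Delta_1=-(d_c^*+T_c^*),\ \Delta_2=(d\omega_c)^*,\ \Delta_k=0\ (k\ge 3)\bigr)$ is a commutative $\mathrm{BV}_\infty$-algebra over $\mathbb R$. 2. The total differential satisfies, in $\mathrm{End}(\mathcal A)[[\xi]]$, \[ d-(d_c^*+T_c^*)\,\xi+(d\omega_c)^*\,\xi^2=e^{\Lambda\xi}\,d\,e^{-\Lambda\xi}.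 \] 3. The structure is the sum of the Dolbeault operators $\bar\partial,\ -i(\partial^*+\tau^*),\ i\lambda^*$ and of their complex conjugates: on $\mathcal A_{\mathbb C}$, writing $\overline P(u)=\overline{P(\bar u)}$, \[ d=\bar\partial+\overline{\bar\partial},\qquad -(d_c^*+T_c^*)=-i(\partial^*+\tau^*)+\overline{-i(\partial^*+\tau^*)},\qquad (d\omega_c)^*=i\lambda^*+\overline{i\lambda^*}. \] -/

import Mathlib

open scoped Manifold ContDiff TensorProduct DirectSum

set_option linter.unusedSectionVars false

namespace HermitianBV
noncomputable section
section Algebra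
variable {K A : Type*} [Field K] [AddCommGroup A] [Module K A]

/-- `f` is homogeneous of degree `k`. -/
def HasDegree (𝒜 : ℤ → Submodule K A) (k : ℤ) (f : Module.End K A) : Prop :=
  ∀ (j : ℤ), ∀ a ∈ 𝒜 j, f a ∈ 𝒜 (j + k)

/-- The graded commutator `f₁ f₂ - (-1)^{ij} f₂ f₁` of operators of degrees `i` and `j`. -/
def gradedComm (i j : ℤ) (f₁ f₂ : Module.End K A) : Module.End K A :=
  f₁ * f₂ - (i * j).negOnePow • (f₂ * f₁)

/-- `f` is an operator of degree `k` and algebraic order `≤ r` (Grothendieck): those of order `≤ 0`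
are the `A`-linear ones, and `f` has order `≤ r + 1` if its graded commutators with all the left
multiplications by homogeneous elements have order `≤ r`. -/
def HasOrderLE (𝒜 : ℤ → Submodule K A) (mul : A →ₗ[K] A →ₗ[K] A) :
    ℕ → ℤ → Module.End K A → Prop
  | 0, k, f => HasDegree 𝒜 k f ∧ ∀ (j : ℤ), ∀ a ∈ 𝒜 j, gradedComm j k (mul a) f = 0
  | r + 1, k, f => HasDegree 𝒜 k f ∧
      ∀ (j : ℤ), ∀ a ∈ 𝒜 j, HasOrderLE 𝒜 mul r (j + k) (gradedComm j k (mul a) f)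

/-- `(A, mul, Δ 0, Δ 1, …)` is a commutative `BV_∞`-algebra over `K`: `(A, mul, d = Δ 0)` is a unital
graded commutative dg-algebra, `(A, Δ 0, Δ 1, …)` is a multicomplex (`Δ k` has degree `1 - 2k` and
`∑_{i ≤ n} Δ i Δ (n - i) = 0`, so that in particular `d² = 0`), and `Δ n` has order `≤ n + 1`. -/
structure IsCommBVInfinity (𝒜 : ℤ → Submodule K A) (mul : A →ₗ[K] A →ₗ[K] A) (one : A)
    (Δ : ℕ → Module.End K A) : Prop where
  isInternal : DirectSum.IsInternal 𝒜
  one_mem : one ∈ 𝒜 0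
  mul_mem : ∀ (i j : ℤ), ∀ a ∈ 𝒜 i, ∀ b ∈ 𝒜 j, mul a b ∈ 𝒜 (i + j)
  one_mul : ∀ a, mul one a = a
  mul_one : ∀ a, mul a one = a
  mul_assoc : ∀ a b c, mul (mul a b) c = mul a (mul b c)
  mul_comm : ∀ (i j : ℤ), ∀ a ∈ 𝒜 i, ∀ b ∈ 𝒜 j, mul a b = (i * j).negOnePow • mul b a
  leibniz : ∀ (i : ℤ), ∀ a ∈ 𝒜 i, ∀ b,
    Δ 0 (mul a b) = mul (Δ 0 a) b + i.negOnePow • mul a (Δ 0 b)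
  degree : ∀ k : ℕ, HasDegree 𝒜 (1 - 2 * (k : ℤ)) (Δ k)
  multicomplex : ∀ n : ℕ, ∑ i ∈ Finset.range (n + 1), Δ i * Δ (n - i) = 0
  order : ∀ n : ℕ, 1 ≤ n → HasOrderLE 𝒜 mul (n + 1) (1 - 2 * (n : ℤ)) (Δ n)

/-- The sequence `d, Δ₁, Δ₂, 0, 0, …`. -/
def opSeq (d Δ₁ Δ₂ : Module.End K A) : ℕ → Module.End K A
  | 0 => d
  | 1 => Δ₁
  | 2 => Δ₂
  | _ + 3 => 0

/-- The formal exponential `e^{f ξ} = ∑ₙ fⁿ/n! ξⁿ` in `End(A)[[ξ]]`. -/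
def expSeries (f : Module.End K A) : PowerSeries (Module.End K A) :=
  PowerSeries.mk fun n => ((n.factorial : K)⁻¹) • f ^ n

end Algebra

section Fibre
variable {E : Type*} [NormedAddCommGroup E] [NormedSpace ℂ E]

/-- The product `u ↦ β(u₁,…,uₖ) γ(uₖ₊₁,…,uₖ₊ₗ)` of two alternating forms, as a multilinear map. -/
def prodForm {k l : ℕ} (β : E [⋀^Fin k]→L[ℝ] ℝ) (γ : E [⋀^Fin l]→L[ℝ] ℝ) :
    ContinuousMultilinearMap ℝ (fun _ : Fin (k + l) => E) ℝ where
  toMultilinearMap := (LinearMap.mul' ℝ ℝ).compMultilinearMap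
    ((MultilinearMap.domCoprod β.toMultilinearMap γ.toMultilinearMap).domDomCongr finSumFinEquiv)
  cont := by
    show Continuous fun u : Fin (k + l) → E =>
      β (fun i => u (Fin.castAdd l i)) * γ (fun j => u (Fin.natAdd k j))
    have h1 := β.cont
    have h2 := γ.cont
    exact (h1.comp (by fun_prop : Continuous fun (u : Fin (k+l) → E) (i : Fin k) => u (Fin.castAdd l i))).mul (h2.comp (by fun_prop : Continuous fun (u : Fin (k+l) → E) (i : Fin l) => u (Fin.natAdd k i)))

theorem prodForm_apply {k l : ℕ} (β : E [⋀^Fin k]→L[ℝ] ℝ) (γ : E [⋀^Fin l]→L[ℝ] ℝ)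
    (u : Fin (k + l) → E) : prodForm β γ u =
      β (fun i => u (Fin.castAdd l i)) * γ (fun j => u (Fin.natAdd k j)) := rfl

/-- Wedge product of alternating forms, with the normalization
`(β ∧ γ)(u) = 1/(k! l!) ∑ σ, sgn σ · β(u_{σ 1},…,u_{σ k}) γ(u_{σ (k+1)},…,u_{σ (k+l)})`. -/
def wedgeAt {k l : ℕ} (β : E [⋀^Fin k]→L[ℝ] ℝ) (γ : E [⋀^Fin l]→L[ℝ] ℝ) :
    E [⋀^Fin (k + l)]→L[ℝ] ℝ :=
  ((k.factorial : ℝ) * (l.factorial : ℝ))⁻¹ • (prodForm β γ).alternatization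

variable (E) in
/-- The real dimension of `E`. -/
abbrev realDim : ℕ := Module.finrank ℂ E * 2

variable (E) in
/-- The real basis `e₁, i e₁, e₂, i e₂, …` attached to a complex basis of `E`; it is positively
oriented for the complex orientation. -/
def realBasis [FiniteDimensional ℂ E] : Module.Basis (Fin (realDim E)) ℝ E :=
  (Complex.basisOneI.smulTower (Module.finBasis ℂ E)).reindex
    ((Equiv.prodComm _ _).trans finProdFinEquiv)

/-- The `l`-form `u₁♭ ∧ ⋯ ∧ u_l♭`, where `u♭ = g(u, ·)`. -/
def flatWedge (g : E →L[ℝ] E →L[ℝ] ℝ) {l : ℕ} (u : Fin l → E) :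
    E [⋀^Fin l]→L[ℝ] ℝ where
  toAlternatingMap := Matrix.detRowAlternating.compLinearMap
    (LinearMap.pi fun i => (g (u i)).toLinearMap)
  cont := by
    show Continuous fun v : Fin l → E => Matrix.det (Matrix.of fun j i => g (u i) (v j))
    refine Continuous.matrix_det (continuous_matrix fun i j => ?_)
    simp only [Matrix.of_apply]
    fun_prop

theorem flatWedge_apply (g : E →L[ℝ] E →L[ℝ] ℝ) {l : ℕ} (u v : Fin l → E) :
    flatWedge g u v = Matrix.det (Matrix.of fun j i => g (u i) (v j)) := rfl

/-- Gram matrix of `g` in the basis `realBasis E`. -/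
def gram [FiniteDimensional ℂ E] (g : E →L[ℝ] E →L[ℝ] ℝ) :
    Matrix (Fin (realDim E)) (Fin (realDim E)) ℝ :=
  Matrix.of fun i j => g (realBasis E i) (realBasis E j)

/-- The `g`-dual basis: `g(dualBasisAt g i, realBasis E j) = δ_{ij}` for an inner product `g`. -/
def dualBasisAt [FiniteDimensional ℂ E] (g : E →L[ℝ] E →L[ℝ] ℝ) (i : Fin (realDim E)) : E :=
  ∑ j, (gram g)⁻¹ i j • realBasis E j

/-- The inner product induced by `g` on `k`-forms:
`⟨α, β⟩ = 1/k! ∑ α_{i₁…iₖ} β_{j₁…jₖ} g^{i₁j₁} ⋯ g^{iₖjₖ}`. -/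
def pairAt [FiniteDimensional ℂ E] (g : E →L[ℝ] E →L[ℝ] ℝ) {k : ℕ}
   (α β : E [⋀^Fin k]→L[ℝ] ℝ) : ℝ :=
  (k.factorial : ℝ)⁻¹ * ∑ I : Fin k → Fin (realDim E),
    α (fun a => realBasis E (I a)) * β (fun a => dualBasisAt g (I a))

/-- Hodge star of an inner product `g` on `E` with the complex orientation. With `b` the basis
`realBasis E` and `m = dim_ℝ E = k + l`,
`⋆β = 1/(k! l! √det g(b_i, b_j)) ∑ σ ∈ S_m, sgn σ · β(b_{σ 1},…,b_{σ k}) b_{σ (k+1)}♭ ∧ ⋯ ∧ b_{σ m}♭`,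
which is the usual formula for `α ∧ ⋆β = ⟨α, β⟩ vol`. -/
def hodgeAt [FiniteDimensional ℂ E] (g : E →L[ℝ] E →L[ℝ] ℝ) {k l : ℕ}
    (h : k + l = realDim E) (β : E [⋀^Fin k]→L[ℝ] ℝ) : E [⋀^Fin l]→L[ℝ] ℝ :=
  ((k.factorial : ℝ) * (l.factorial : ℝ) * √(gram g).det)⁻¹ •
    ∑ σ : Equiv.Perm (Fin (k + l)), ((Equiv.Perm.sign σ : ℤ) : ℝ) •
      β (fun i => realBasis E (Fin.cast h (σ (Fin.castAdd l i)))) •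
      flatWedge g (fun j => realBasis E (Fin.cast h (σ (Fin.natAdd k j))))

end Fibre

section FibreLemmas
variable {E : Type*} [NormedAddCommGroup E] [NormedSpace ℂ E]

theorem wedgeAt_apply {k l : ℕ} (β : E [⋀^Fin k]→L[ℝ] ℝ) (γ : E [⋀^Fin l]→L[ℝ] ℝ)
    (u : Fin (k + l) → E) : wedgeAt β γ u = ((k.factorial : ℝ) * (l.factorial : ℝ))⁻¹ *
      ∑ σ : Equiv.Perm (Fin (k + l)), ((Equiv.Perm.sign σ : ℤ) : ℝ) *
        (β (fun i => u (σ (Fin.castAdd l i))) * γ (fun j => u (σ (Fin.natAdd k j)))) := by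
  simp only [wedgeAt, ContinuousAlternatingMap.smul_apply, smul_eq_mul,
    ContinuousMultilinearMap.alternatization_apply_apply, prodForm_apply, Function.comp,
    Units.smul_def, zsmul_eq_mul]

variable [FiniteDimensional ℂ E]

theorem hodgeAt_apply (g : E →L[ℝ] E →L[ℝ] ℝ) {k l : ℕ}
    (h : k + l = realDim E) (β : E [⋀^Fin k]→L[ℝ] ℝ) (w : Fin l → E) : hodgeAt g h β w =
      ((k.factorial : ℝ) * (l.factorial : ℝ) * √(gram g).det)⁻¹ *
    ∑ σ : Equiv.Perm (Fin (k + l)), ((Equiv.Perm.sign σ : ℤ) : ℝ) *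
      (β (fun i => realBasis E (Fin.cast h (σ (Fin.castAdd l i)))) *
      Matrix.det (Matrix.of fun i j => g (realBasis E (Fin.cast h (σ (Fin.natAdd k j)))) (w i))) := by
  simp only [hodgeAt, ContinuousAlternatingMap.smul_apply, ContinuousAlternatingMap.sum_apply,
    smul_eq_mul, flatWedge_apply]

theorem gram_det_pos {g : E →L[ℝ] E →L[ℝ] ℝ} (hs : ∀ v w, g v w = g w v)
    (hp : ∀ v, v ≠ 0 → 0 < g v v) : 0 < (gram g).det := by
  refine Matrix.PosDef.det_pos ⟨?_, ?_⟩
  · ext i j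
    simp [gram, hs]
  · intro x hx
    have h0 : x.sum (fun i xi => xi • realBasis E i) ≠ 0 := by
      intro h
      apply hx
      have := (realBasis E).linearIndependent
      rw [linearIndependent_iff] at this
      exact this x (by simpa [Finsupp.linearCombination_apply] using h)
    have := hp _ h0
    have e : g (x.sum fun i xi => xi • realBasis E i) (x.sum fun i xi => xi • realBasis E i) =
        x.sum fun i xi => x.sum fun j xj => star xi * gram g i j * xj := by
      simp only [Finsupp.sum, map_sum, sum_apply, map_smul, smul_apply, smul_eq_mul,
        Finset.mul_sum, star_trivial, gram, Matrix.of_apply]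
      rw [Finset.sum_comm]
      refine Finset.sum_congr rfl fun i _ => Finset.sum_congr rfl fun j _ => ?_
      ring
    rwa [e] at this

theorem top_map (f : E [⋀^Fin (realDim E)]→L[ℝ] ℝ) (A : E →L[ℝ] E) (u : Fin (realDim E) → E) :
    f (fun i => A (u i)) = LinearMap.det A.toLinearMap * f u := by
  have h := AlternatingMap.eq_smul_basis_det (realBasis E) f.toAlternatingMap
  have h' : ∀ v, f v = f (realBasis E) * (realBasis E).det v := fun v => by
    simpa using congrArg (fun q => q v) h
  rw [h' (fun i => A (u i)), h' u]
  have := (realBasis E).det_comp A.toLinearMap u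
  simp only [Function.comp_def, ContinuousLinearMap.coe_coe] at this
  rw [this]; ring

theorem top_map' {m : ℕ} (h : m = realDim E) (f : E [⋀^Fin m]→L[ℝ] ℝ) (A : E →L[ℝ] E) (u : Fin m → E) :
    f (fun i => A (u i)) = LinearMap.det A.toLinearMap * f u := by
  subst h; exact top_map f A u

theorem hodgeAt_eq_wedgeAt (g : E →L[ℝ] E →L[ℝ] ℝ) (hs : ∀ v w, g v w = g w v) {k l : ℕ}
    (h : k + l = realDim E) (β : E [⋀^Fin k]→L[ℝ] ℝ) (w : Fin l → E) : hodgeAt g h β w =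
      (√(gram g).det)⁻¹ * wedgeAt β (flatWedge g w) (fun i => realBasis E (Fin.cast h i)) := by
  rw [hodgeAt_apply, wedgeAt_apply, mul_inv, mul_comm _ (√(gram g).det)⁻¹, mul_assoc]
  congr 2
  refine Finset.sum_congr rfl fun σ _ => ?_
  congr 2
  rw [flatWedge_apply, ← Matrix.det_transpose]
  congr 1
  ext i j
  simp [hs]

/-- Pullback of a bilinear form. -/
def pullMetric (g : E →L[ℝ] E →L[ℝ] ℝ) (A : E →L[ℝ] E) : E →L[ℝ] E →L[ℝ] ℝ := g.bilinearComp A A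

theorem pullMetric_apply (g : E →L[ℝ] E →L[ℝ] ℝ) (A : E →L[ℝ] E) (v w : E) :
    pullMetric g A v w = g (A v) (A w) := rfl

theorem gram_pull (g : E →L[ℝ] E →L[ℝ] ℝ) (A : E →L[ℝ] E) :
    (gram (pullMetric g A)).det = (LinearMap.det A.toLinearMap)^2 * (gram g).det := by
  set B := LinearMap.toMatrix (realBasis E) (realBasis E) A.toLinearMap with hB
  have key : gram (pullMetric g A) = B.transpose * gram g * B := by
    ext i j
    have hA : ∀ i, A (realBasis E i) = ∑ a, B a i • realBasis E a := fun i => by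
      have := (realBasis E).sum_repr (A (realBasis E i))
      simp [hB, LinearMap.toMatrix_apply, this]
    simp only [gram, Matrix.of_apply, pullMetric_apply, hA, map_sum, Matrix.mul_apply,
      Matrix.transpose_apply, map_smul, sum_apply, smul_apply,
      smul_eq_mul, Finset.mul_sum, Finset.sum_mul]
    refine Finset.sum_congr rfl fun a _ => Finset.sum_congr rfl fun b _ => ?_
    ring
  rw [key, Matrix.det_mul, Matrix.det_mul, Matrix.det_transpose, hB, LinearMap.det_toMatrix]
  ring

theorem hodgeAt_natural (g : E →L[ℝ] E →L[ℝ] ℝ) (hs : ∀ v w, g v w = g w v) (A : E →L[ℝ] E)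
    (hA : 0 < LinearMap.det A.toLinearMap) {k l : ℕ}
    (h : k + l = realDim E) (β : E [⋀^Fin k]→L[ℝ] ℝ) :
    (hodgeAt g h β).compContinuousLinearMap A =
      hodgeAt (pullMetric g A) h (β.compContinuousLinearMap A) := by
  ext w
  rw [ContinuousAlternatingMap.compContinuousLinearMap_apply, hodgeAt_eq_wedgeAt g hs,
    hodgeAt_eq_wedgeAt (pullMetric g A) (fun v w => hs _ _), gram_pull, Real.sqrt_mul (sq_nonneg _),
    Real.sqrt_sq hA.le]
  have : wedgeAt (β.compContinuousLinearMap A) (flatWedge (pullMetric g A) w)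
      (fun i => realBasis E (Fin.cast h i)) =
      wedgeAt β (flatWedge g (A ∘ w)) (fun i => A (realBasis E (Fin.cast h i))) := by
    simp only [wedgeAt_apply]; rfl
  rw [this, top_map' h]
  field_simp

end FibreLemmas

section
variable {E : Type*} [NormedAddCommGroup E] [NormedSpace ℂ E] {M : Type*} [TopologicalSpace M] [ChartedSpace E M] 

instance realManifold [IsManifold 𝓘(ℂ, E) ω M] : IsManifold 𝓘(ℝ, E) ∞ M := by
  apply isManifold_of_contDiffOn
  intro e e' he he'
  have := HasGroupoid.compatible (G := contDiffGroupoid ω 𝓘(ℂ, E)) he he'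
  rw [contDiffGroupoid, mem_groupoid_of_pregroupoid] at this
  have := this.1
  simp only [contDiffPregroupoid, modelWithCornersSelf_coe, modelWithCornersSelf_coe_symm, Function.id_comp, Function.comp_id, Set.range_id, Set.inter_univ, Set.preimage_id] at this ⊢
  exact (this.restrict_scalars ℝ).of_le le_top

/-- A Hermitian metric on a complex manifold `M` modelled on `E`: a smooth Riemannian metric on the
underlying real manifold for which the complex structure `J = (multiplication by i)` of each tangent
space is an isometry. -/
structure HermitianMetric (E : Type*) [NormedAddCommGroup E] [NormedSpace ℂ E] (M : Type*) [TopologicalSpace M] [ChartedSpace E M] [IsManifold 𝓘(ℂ, E) ω M] extends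
    Bundle.ContMDiffRiemannianMetric 𝓘(ℝ, E) ∞ E (fun x : M => TangentSpace 𝓘(ℝ, E) x) where
  hermitian : ∀ (x : M) (v w : E), inner x (Complex.I • v : E) (Complex.I • w : E) = inner x v w

variable [IsManifold 𝓘(ℂ, E) ω M]

/-- The metric at `x`; by definition `TangentSpace 𝓘(ℝ, E) x` is `E`. -/
def HermitianMetric.toBilin (g : HermitianMetric E M) (x : M) : E →L[ℝ] E →L[ℝ] ℝ := g.inner x

variable (E) in
/-- The derivative at the image of `x` of the inverse of the chart at `x₀`, from `E` to `T_x M` (the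
latter being `E`, through the preferred chart at `x`). -/
def frameMap (x₀ x : M) : E →L[ℝ] E := tangentCoordChange 𝓘(ℝ, E) x₀ x x

/-- The expression, in the chart at `x₀`, of a not necessarily smooth form `α`. -/
def chartRep {k : ℕ} (α : M → E [⋀^Fin k]→L[ℝ] ℝ) (x₀ : M) (y : E) : E [⋀^Fin k]→L[ℝ] ℝ :=
  (α ((extChartAt 𝓘(ℝ, E) x₀).symm y)).compContinuousLinearMap
    (frameMap E x₀ ((extChartAt 𝓘(ℝ, E) x₀).symm y))

/-- A form is smooth if it is `C^∞` in all the charts. -/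
def IsSmoothForm {k : ℕ} (α : M → E [⋀^Fin k]→L[ℝ] ℝ) : Prop :=
  ∀ x₀ : M, ContDiffOn ℝ ∞ (chartRep α x₀) (extChartAt 𝓘(ℝ, E) x₀).target

theorem frameMap_smul (x₀ x : M) (hx : x ∈ (extChartAt 𝓘(ℝ, E) x₀).source) (z : ℂ) (v : E) :
    frameMap E x₀ x (z • v) = z • frameMap E x₀ x v := by
  have h1 := hasFDerivWithinAt_tangentCoordChange (I := 𝓘(ℝ, E)) (x := x₀) (y := x) (z := x)
    ⟨hx, mem_extChartAt_source x⟩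
  have h2 := hasFDerivWithinAt_tangentCoordChange (I := 𝓘(ℂ, E)) (x := x₀) (y := x) (z := x)
    ⟨by simpa using hx, mem_extChartAt_source x⟩
  have h3 := h2.restrictScalars ℝ
  simp only [modelWithCornersSelf_coe, Set.range_id] at h1 h3
  have := hasFDerivWithinAt_univ.1 h1 |>.unique (hasFDerivWithinAt_univ.1 h3)
  simp only [frameMap, this, ContinuousLinearMap.coe_restrictScalars', map_smul]

theorem frameMap_inv (x₀ x : M) (hx : x ∈ (extChartAt 𝓘(ℝ, E) x₀).source) (v : E) :
    tangentCoordChange 𝓘(ℝ, E) x x₀ x (frameMap E x₀ x v) = v := by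
  rw [frameMap, tangentCoordChange_comp ⟨⟨hx, mem_extChartAt_source x⟩, hx⟩,
    tangentCoordChange_self hx]

theorem frameMap_det_pos [FiniteDimensional ℂ E] (x₀ x : M) (hx : x ∈ (extChartAt 𝓘(ℝ, E) x₀).source) :
    0 < LinearMap.det (frameMap E x₀ x).toLinearMap := by
  let B : E →ₗ[ℂ] E :=
    { toFun := frameMap E x₀ x, map_add' := map_add _, map_smul' := frameMap_smul x₀ x hx }
  have hB : (frameMap E x₀ x).toLinearMap = B.restrictScalars ℝ := rfl
  have hne : LinearMap.det B ≠ 0 := by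
    have hinj : Function.Injective B := fun v w hvw => by
      rw [← frameMap_inv x₀ x hx v, ← frameMap_inv x₀ x hx w]
      exact congrArg _ hvw
    have := LinearEquiv.isUnit_det' (LinearEquiv.ofInjectiveEndo B hinj)
    exact this.ne_zero
  rw [hB, LinearMap.det_restrictScalars, Algebra.norm_complex_apply]
  exact Complex.normSq_pos.2 hne

section Eval
variable [FiniteDimensional ℂ E]

theorem contDiffOn_eval {k : ℕ} {f : E → E [⋀^Fin k]→L[ℝ] ℝ} {s : Set E}
    (h : ContDiffOn ℝ ∞ f s) (w : Fin k → E) : ContDiffOn ℝ ∞ (fun y => f y w) s :=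
  (ContinuousAlternatingMap.apply ℝ E ℝ w).contDiff.comp_contDiffOn h

theorem contDiffOn_of_eval {k : ℕ} {f : E → E [⋀^Fin k]→L[ℝ] ℝ} {s : Set E}
    (h : ∀ w : Fin k → E, ContDiffOn ℝ ∞ (fun y => f y w) s) : ContDiffOn ℝ ∞ f s := by
  let T : (E [⋀^Fin k]→L[ℝ] ℝ) →ₗ[ℝ] ((Fin k → Fin (realDim E)) → ℝ) :=
    { toFun := fun β I => β (fun a => realBasis E (I a))
      map_add' := fun _ _ => rfl
      map_smul' := fun _ _ => rfl }
  have hT : LinearMap.ker T = ⊥ := by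
    rw [LinearMap.ker_eq_bot]
    intro β γ hβγ
    apply ContinuousAlternatingMap.toAlternatingMap_injective
    exact Module.Basis.ext_alternating (realBasis E) fun I _ => congrFun hβγ I
  obtain ⟨S, hS⟩ := T.exists_leftInverse_of_injective hT
  have hf : f = fun y => LinearMap.toContinuousLinearMap S (T (f y)) := by
    funext y
    exact (LinearMap.congr_fun hS (f y)).symm
  rw [hf]
  refine (LinearMap.toContinuousLinearMap S).contDiff.comp_contDiffOn ?_
  exact contDiffOn_pi.2 fun I => h _

theorem isSmoothForm_iff {k : ℕ} {α : M → E [⋀^Fin k]→L[ℝ] ℝ} : IsSmoothForm α ↔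
    ∀ (x₀ : M) (w : Fin k → E), ContDiffOn ℝ ∞ (fun y => chartRep α x₀ y w)
      (extChartAt 𝓘(ℝ, E) x₀).target :=
  ⟨fun h x₀ w => contDiffOn_eval (h x₀) w, fun h x₀ => contDiffOn_of_eval (h x₀)⟩

theorem metric_smooth (g : HermitianMetric E M) (x₀ : M) (v w : E) :
    ContDiffOn ℝ ∞ (fun y => pullMetric (g.toBilin ((extChartAt 𝓘(ℝ, E) x₀).symm y))
      (frameMap E x₀ ((extChartAt 𝓘(ℝ, E) x₀).symm y)) v w) (extChartAt 𝓘(ℝ, E) x₀).target := by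
  have hsec : ∀ v : E, ContMDiffOn 𝓘(ℝ, E) (𝓘(ℝ, E).prod 𝓘(ℝ, E)) ∞
      (fun x : M => Bundle.TotalSpace.mk' E (E := fun x : M => TangentSpace 𝓘(ℝ, E) x) x
        (show TangentSpace 𝓘(ℝ, E) x from frameMap E x₀ x v)) (chartAt E x₀).source := by
    intro v
    have := (Bundle.Trivialization.contMDiffOn_section_baseSet_iff (n := ∞) (IB := 𝓘(ℝ, E))
      (E := fun x : M => TangentSpace 𝓘(ℝ, E) x)
      (s := fun x : M => (show TangentSpace 𝓘(ℝ, E) x from frameMap E x₀ x v))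
      (trivializationAt E (fun x : M => TangentSpace 𝓘(ℝ, E) x) x₀)).2 ?_
    · simpa using this
    · refine (contMDiffOn_const (c := v)).congr fun x hx => ?_
      have hx' : x ∈ (extChartAt 𝓘(ℝ, E) x₀).source := by simpa using hx
      exact frameMap_inv x₀ x hx' v
  have := ContMDiffOn.clm_bundle_apply₂ (g.contMDiff.contMDiffOn (s := (chartAt E x₀).source))
    (hsec v) (hsec w)
  have h2 : ContMDiffOn 𝓘(ℝ, E) 𝓘(ℝ, ℝ) ∞
      (fun x : M => pullMetric (g.toBilin x) (frameMap E x₀ x) v w) (chartAt E x₀).source := by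
    intro x hx
    have := this x hx
    rw [Bundle.contMDiffWithinAt_section] at this
    exact this
  have h3 := h2.comp (contMDiffOn_extChartAt_symm (I := 𝓘(ℝ, E)) (n := ∞) x₀) ?_
  · exact contMDiffOn_iff_contDiffOn.1 h3
  · intro y hy
    simpa using (extChartAt 𝓘(ℝ, E) x₀).map_target hy

theorem smooth_hodge (g : HermitianMetric E M) {k l : ℕ} (h : k + l = realDim E)
    {α : M → E [⋀^Fin k]→L[ℝ] ℝ} (hα : IsSmoothForm α) :
    IsSmoothForm fun x => hodgeAt (g.toBilin x) h (α x) := by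
  refine isSmoothForm_iff.2 fun x₀ w => ?_
  set φ := extChartAt 𝓘(ℝ, E) x₀ with hφ
  let G : E → E →L[ℝ] E →L[ℝ] ℝ := fun y => pullMetric (g.toBilin (φ.symm y)) (frameMap E x₀ (φ.symm y))
  have hG : ∀ v w, ContDiffOn ℝ ∞ (fun y => G y v w) φ.target := metric_smooth g x₀
  have hdet : ContDiffOn ℝ ∞ (fun y => (gram (G y)).det) φ.target := by
    simp only [Matrix.det_apply', gram, Matrix.of_apply]
    exact ContDiffOn.sum fun σ _ => contDiffOn_const.mul (contDiffOn_prod fun i _ => hG _ _)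
  have hpos : ∀ y ∈ φ.target, 0 < (gram (G y)).det := by
    intro y hy
    have hx := φ.map_target hy
    have hd := frameMap_det_pos (E := E) x₀ (φ.symm y) hx
    have hgp : ∀ v : E, v ≠ 0 → 0 < g.toBilin (φ.symm y) v v := fun v hv => g.pos (φ.symm y) v hv
    have hgs : ∀ v w : E, g.toBilin (φ.symm y) v w = g.toBilin (φ.symm y) w v := fun v w => g.symm _ v w
    show 0 < (gram (pullMetric _ _)).det
    rw [gram_pull]
    have := gram_det_pos hgs hgp
    positivity
  have key : ∀ y ∈ φ.target, chartRep (fun x => hodgeAt (g.toBilin x) h (α x)) x₀ y w =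
      ((k.factorial : ℝ) * (l.factorial : ℝ) * √(gram (G y)).det)⁻¹ *
    ∑ σ : Equiv.Perm (Fin (k + l)), ((Equiv.Perm.sign σ : ℤ) : ℝ) *
      (chartRep α x₀ y (fun i => realBasis E (Fin.cast h (σ (Fin.castAdd l i)))) *
      Matrix.det (Matrix.of fun i j => G y (realBasis E (Fin.cast h (σ (Fin.natAdd k j)))) (w i))) := by
    intro y hy
    have hx := φ.map_target hy
    have hgs : ∀ v w : E, g.toBilin (φ.symm y) v w = g.toBilin (φ.symm y) w v := fun v w => g.symm _ v w
    rw [chartRep, hodgeAt_natural _ hgs _ (frameMap_det_pos x₀ _ hx), hodgeAt_apply]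
    rfl
  refine ContDiffOn.congr ?_ key
  refine ContDiffOn.mul (ContDiffOn.inv (contDiffOn_const.mul (hdet.sqrt fun y hy => (hpos y hy).ne'))
    fun y hy => ?_) (ContDiffOn.sum fun σ _ => contDiffOn_const.mul
      ((contDiffOn_eval (hα x₀) _).mul ?_))
  · have := Real.sqrt_pos.2 (hpos y hy)
    positivity
  · simp only [Matrix.det_apply', Matrix.of_apply]
    exact ContDiffOn.sum fun σ _ => contDiffOn_const.mul (contDiffOn_prod fun i _ => hG _ _)

theorem smooth_wedge {k l : ℕ} {α : M → E [⋀^Fin k]→L[ℝ] ℝ} {β : M → E [⋀^Fin l]→L[ℝ] ℝ}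
    (hα : IsSmoothForm α) (hβ : IsSmoothForm β) : IsSmoothForm fun x => wedgeAt (α x) (β x) := by
  refine isSmoothForm_iff.2 fun x₀ w => ?_
  simp only [chartRep, ContinuousAlternatingMap.compContinuousLinearMap_apply, wedgeAt_apply]
  exact contDiffOn_const.mul (ContDiffOn.sum fun σ _ => contDiffOn_const.mul
    ((contDiffOn_eval (hα x₀) _).mul (contDiffOn_eval (hβ x₀) _)))

/-- Multiplication by the complex number `z`, as a real linear map. -/
def mulMap (z : ℂ) : E →L[ℝ] E := z • ContinuousLinearMap.id ℝ E

theorem smooth_pull (z : ℂ) {k : ℕ} {α : M → E [⋀^Fin k]→L[ℝ] ℝ} (hα : IsSmoothForm α) :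
    IsSmoothForm fun x => (α x).compContinuousLinearMap (mulMap z) := by
  refine isSmoothForm_iff.2 fun x₀ w => ?_
  refine (contDiffOn_eval (hα x₀) (fun i => z • w i)).congr fun y hy => ?_
  simp only [chartRep, ContinuousAlternatingMap.compContinuousLinearMap_apply]
  congr 1
  funext i
  exact (frameMap_smul x₀ _ ((extChartAt 𝓘(ℝ, E) x₀).map_target hy) z (w i)).symm

/-- The fundamental form `ω(X, Y) = g(JX, Y)` at `x`. -/
def fundAt (g : HermitianMetric E M) (x : M) : E [⋀^Fin 2]→L[ℝ] ℝ where
  toFun v := g.toBilin x (Complex.I • v 0) (v 1)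
  map_update_add' := by
    intro _ v i a b
    fin_cases i <;> simp [Function.update]
  map_update_smul' := by
    intro _ v i c a
    fin_cases i <;> simp [Function.update, smul_comm Complex.I c]
  map_eq_zero_of_eq' := by
    intro v i j hij hne
    have h01 : v 0 = v 1 := by
      fin_cases i <;> fin_cases j <;> simp_all
    have h1 : g.toBilin x (Complex.I • v 1) (v 1) =
        g.toBilin x (Complex.I • Complex.I • v 1) (Complex.I • v 1) := (g.hermitian x _ _).symm
    have h2 : g.toBilin x (v 1) (Complex.I • v 1) = g.toBilin x (Complex.I • v 1) (v 1) :=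
      g.symm x _ _
    rw [smul_smul, Complex.I_mul_I, neg_one_smul, map_neg, neg_apply, h2] at h1
    show g.toBilin x (Complex.I • v 0) (v 1) = 0
    rw [h01]
    linarith
  cont := by
    show Continuous fun v : Fin 2 → E => g.toBilin x (Complex.I • v 0) (v 1)
    fun_prop

theorem fundAt_apply (g : HermitianMetric E M) (x : M) (v : Fin 2 → E) :
    fundAt g x v = g.toBilin x (Complex.I • v 0) (v 1) := rfl

theorem smooth_fund (g : HermitianMetric E M) : IsSmoothForm (fundAt g) := by
  refine isSmoothForm_iff.2 fun x₀ w => ?_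
  refine (metric_smooth g x₀ (Complex.I • w 0) (w 1)).congr fun y hy => ?_
  simp only [chartRep, ContinuousAlternatingMap.compContinuousLinearMap_apply, fundAt_apply,
    pullMetric_apply, Function.comp_apply]
  rw [frameMap_smul x₀ _ ((extChartAt 𝓘(ℝ, E) x₀).map_target hy)]

/-- The exterior derivative at `x`, computed in the preferred chart at `x`. -/
def dRaw {k : ℕ} (α : M → E [⋀^Fin k]→L[ℝ] ℝ) (x : M) : E [⋀^Fin (k + 1)]→L[ℝ] ℝ :=
  extDeriv (chartRep α x) (extChartAt 𝓘(ℝ, E) x x)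

theorem chartRep_dRaw {k : ℕ} {α : M → E [⋀^Fin k]→L[ℝ] ℝ} (hα : IsSmoothForm α) (x₀ : M)
    {y : E} (hy : y ∈ (extChartAt 𝓘(ℝ, E) x₀).target) :
    chartRep (dRaw α) x₀ y = extDeriv (chartRep α x₀) y := by
  set φ := extChartAt 𝓘(ℝ, E) x₀ with hφ
  set x := φ.symm y with hx
  set ψ := extChartAt 𝓘(ℝ, E) x with hψ
  have hxs : x ∈ φ.source := φ.map_target hy
  have hφx : φ x = y := φ.right_inv hy
  have hF : HasFDerivAt (ψ ∘ φ.symm) (frameMap E x₀ x) y := by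
    have h1 := hasFDerivWithinAt_tangentCoordChange (I := 𝓘(ℝ, E)) (x := x₀) (y := x) (z := x)
      ⟨hxs, mem_extChartAt_source x⟩
    simp only [modelWithCornersSelf_coe, Set.range_id] at h1
    rw [← hφ, ← hψ, hφx] at h1
    exact hasFDerivWithinAt_univ.1 h1
  have hev : ∀ᶠ z in nhds y, z ∈ φ.target ∧ φ.symm z ∈ ψ.source := by
    have h1 : φ.target ∈ nhds y := (isOpen_extChartAt_target x₀).mem_nhds hy
    have h2 : φ.symm ⁻¹' ψ.source ∈ nhds y :=
      (continuousAt_extChartAt_symm'' hy).preimage_mem_nhds (extChartAt_source_mem_nhds x)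
    exact Filter.inter_mem h1 h2
  have hC : ContDiffAt ℝ ∞ (ψ ∘ φ.symm) y := by
    have := contDiffWithinAt_ext_coord_change (I := 𝓘(ℝ, E)) (n := ∞) x x₀ (y := y) (by
      rw [PartialEquiv.trans_source]; exact ⟨hy, mem_extChartAt_source x⟩)
    simpa only [modelWithCornersSelf_coe, Set.range_id, contDiffWithinAt_univ] using this
  have heq : chartRep α x₀ =ᶠ[nhds y] fun z =>
      (chartRep α x ((ψ ∘ φ.symm) z)).compContinuousLinearMap (fderiv ℝ (ψ ∘ φ.symm) z) := by
    filter_upwards [hev] with z hz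
    have hzs : φ.symm z ∈ φ.source := φ.map_target hz.1
    have hφz : φ (φ.symm z) = z := φ.right_inv hz.1
    have h1 := hasFDerivWithinAt_tangentCoordChange (I := 𝓘(ℝ, E)) (x := x₀) (y := x) (z := φ.symm z)
      ⟨hzs, hz.2⟩
    simp only [modelWithCornersSelf_coe, Set.range_id] at h1
    rw [← hφ, ← hψ, hφz] at h1
    have hfd := (hasFDerivWithinAt_univ.1 h1).fderiv
    have hinv : ψ.symm (ψ (φ.symm z)) = φ.symm z := ψ.left_inv hz.2
    ext w
    simp only [chartRep, ContinuousAlternatingMap.compContinuousLinearMap_apply, Function.comp_apply,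
      ← hψ, ← hφ]
    rw [hinv]
    congr 1
    funext i
    simp only [Function.comp_apply, hfd, frameMap]
    exact (tangentCoordChange_comp ⟨⟨hzs, hz.2⟩, mem_extChartAt_source _⟩).symm
  have hd : DifferentiableAt ℝ (chartRep α x) ((ψ ∘ φ.symm) y) :=
    ((hα x).contDiffAt ((isOpen_extChartAt_target x).mem_nhds (mem_extChartAt_target x))).differentiableAt
      (by simp)
  rw [heq.extDeriv_eq, extDeriv_pullback hd hC (by simpa using (ENat.LEInfty.out : (2 : WithTop ℕ∞) ≤ ∞)), hF.fderiv]
  rfl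

theorem smooth_d {k : ℕ} {α : M → E [⋀^Fin k]→L[ℝ] ℝ} (hα : IsSmoothForm α) :
    IsSmoothForm (dRaw α) := by
  intro x₀
  refine ContDiffOn.congr ?_ fun y hy => chartRep_dRaw hα x₀ hy
  have := (hα x₀).fderiv_of_isOpen (m := ∞) (isOpen_extChartAt_target x₀) (by simp)
  exact (ContinuousAlternatingMap.alternatizeUncurryFinCLM ℝ E ℝ).contDiff.comp_contDiffOn this

variable (E M) in
/-- The smooth `k`-forms on `M`, as a space of sections of the bundle of alternating forms. -/
def smoothForms (k : ℕ) : Submodule ℝ (M → E [⋀^Fin k]→L[ℝ] ℝ) where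
  carrier := {α | IsSmoothForm α}
  zero_mem' := fun _ => contDiffOn_const (c := 0)
  add_mem' := fun ha hb x₀ => (ha x₀).add (hb x₀)
  smul_mem' := fun c _ ha x₀ => (ha x₀).const_smul c

variable (E M) in
/-- The space `𝒜ᵏ` of smooth real `k`-forms on `M`. -/
def Form (k : ℕ) : Type _ := smoothForms E M k

instance (k : ℕ) : AddCommGroup (Form E M k) := inferInstanceAs (AddCommGroup (smoothForms E M k))

instance (k : ℕ) : Module ℝ (Form E M k) := inferInstanceAs (Module ℝ (smoothForms E M k))

theorem Form.add_val {k : ℕ} (α β : Form E M k) : (α + β).1 = α.1 + β.1 := rfl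

theorem Form.smul_val {k : ℕ} (c : ℝ) (α : Form E M k) : (c • α).1 = c • α.1 := rfl

/-- Exterior derivative of smooth `k`-forms. -/
def dForm (k : ℕ) : Form E M k →ₗ[ℝ] Form E M (k + 1) where
  toFun α := ⟨dRaw α.1, smooth_d α.2⟩
  map_add' α β := by
    have hd : ∀ (γ : Form E M k) (x : M), DifferentiableAt ℝ (chartRep γ.1 x)
        (extChartAt 𝓘(ℝ, E) x x) := fun γ x =>
      ((γ.2 x).contDiffAt ((isOpen_extChartAt_target x).mem_nhds
        (mem_extChartAt_target x))).differentiableAt (by simp)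
    refine Subtype.ext (funext fun x => ?_)
    exact extDeriv_add (hd α x) (hd β x)
  map_smul' c α := by
    refine Subtype.ext (funext fun x => ?_)
    exact extDeriv_smul c (chartRep α.1 x)

/-- Wedge product of smooth forms. -/
def wedgeForm (k l : ℕ) : Form E M k →ₗ[ℝ] Form E M l →ₗ[ℝ] Form E M (k + l) :=
  LinearMap.mk₂ ℝ (fun α β => ⟨fun x => wedgeAt (α.1 x) (β.1 x), smooth_wedge α.2 β.2⟩)
    (fun α α' β => Subtype.ext <| funext fun x => by
      show wedgeAt (α.1 x + α'.1 x) (β.1 x) = wedgeAt (α.1 x) (β.1 x) + wedgeAt (α'.1 x) (β.1 x)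
      ext u; simp [wedgeAt_apply, add_mul, mul_add, Finset.sum_add_distrib])
    (fun c α β => Subtype.ext <| funext fun x => by
      show wedgeAt (c • α.1 x) (β.1 x) = c • wedgeAt (α.1 x) (β.1 x)
      ext u; simp [wedgeAt_apply, Finset.mul_sum, mul_assoc, mul_left_comm])
    (fun α β β' => Subtype.ext <| funext fun x => by
      show wedgeAt (α.1 x) (β.1 x + β'.1 x) = wedgeAt (α.1 x) (β.1 x) + wedgeAt (α.1 x) (β'.1 x)
      ext u; simp [wedgeAt_apply, mul_add, Finset.sum_add_distrib])
    (fun c α β => Subtype.ext <| funext fun x => by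
      show wedgeAt (α.1 x) (c • β.1 x) = c • wedgeAt (α.1 x) (β.1 x)
      ext u; simp [wedgeAt_apply, Finset.mul_sum, mul_left_comm])

/-- The action `(z · α)(X₁,…,Xₖ) = α(z X₁,…,z Xₖ)` of a complex number on smooth forms. -/
def pullForm (z : ℂ) (k : ℕ) : Form E M k →ₗ[ℝ] Form E M k where
  toFun α := ⟨fun x => (α.1 x).compContinuousLinearMap (mulMap z), smooth_pull z α.2⟩
  map_add' _ _ := rfl
  map_smul' _ _ := rfl

/-- Hodge star of smooth forms. -/
def hodgeForm (g : HermitianMetric E M) {k l : ℕ} (h : k + l = realDim E) :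
    Form E M k →ₗ[ℝ] Form E M l where
  toFun α := ⟨fun x => hodgeAt (g.toBilin x) h (α.1 x), smooth_hodge g h α.2⟩
  map_add' α β := Subtype.ext <| funext fun x => by
    show hodgeAt (g.toBilin x) h (α.1 x + β.1 x) =
      hodgeAt (g.toBilin x) h (α.1 x) + hodgeAt (g.toBilin x) h (β.1 x)
    ext u; simp [hodgeAt_apply, add_mul, mul_add, Finset.sum_add_distrib]
  map_smul' c α := Subtype.ext <| funext fun x => by
    show hodgeAt (g.toBilin x) h (c • α.1 x) = c • hodgeAt (g.toBilin x) h (α.1 x)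
    ext u; simp [hodgeAt_apply, Finset.mul_sum, mul_assoc, mul_left_comm]

/-- The pointwise inner product of smooth `k`-forms at `x`. -/
def pairForm (g : HermitianMetric E M) (x : M) (k : ℕ) :
    Form E M k →ₗ[ℝ] Form E M k →ₗ[ℝ] ℝ :=
  LinearMap.mk₂ ℝ (fun α β => pairAt (g.toBilin x) (α.1 x) (β.1 x))
    (fun α α' β => by simp [Form.add_val, pairAt, add_mul, mul_add, Finset.sum_add_distrib])
    (fun c α β => by simp [Form.smul_val, pairAt, Finset.mul_sum, mul_assoc, mul_left_comm])
    (fun α β β' => by simp [Form.add_val, pairAt, mul_add, Finset.sum_add_distrib])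
    (fun c α β => by simp [Form.smul_val, pairAt, Finset.mul_sum, mul_left_comm])

variable (E M) in
/-- The real de Rham algebra `𝒜 = ⨁ₖ 𝒜ᵏ`. -/
abbrev DeRham : Type _ := ⨁ k : ℕ, Form E M k

variable (E M) in
/-- Inclusion of `𝒜ᵏ` in `𝒜`. -/
abbrev inc (k : ℕ) : Form E M k →ₗ[ℝ] DeRham E M :=
  DirectSum.lof ℝ ℕ (fun k => Form E M k) k

variable (E M) in
/-- The `ℤ`-grading of `𝒜`, zero in negative degrees. -/
def degreePart : ℤ → Submodule ℝ (DeRham E M)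
  | Int.ofNat k => LinearMap.range (inc E M k)
  | Int.negSucc _ => ⊥

variable (E M) in
/-- The exterior differential `d`. -/
def dR : Module.End ℝ (DeRham E M) :=
  DirectSum.toModule ℝ ℕ _ fun k => inc E M (k + 1) ∘ₗ dForm k

variable (E M) in
/-- The wedge product of `𝒜`. -/
def wedge : DeRham E M →ₗ[ℝ] DeRham E M →ₗ[ℝ] DeRham E M :=
  DirectSum.toModule ℝ ℕ _ fun k => LinearMap.flip <|
    DirectSum.toModule ℝ ℕ _ fun l => LinearMap.flip ((wedgeForm k l).compr₂ (inc E M (k + l)))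

variable (E M) in
/-- The unit of `𝒜`: the constant function `1`. -/
def oneForm : DeRham E M :=
  inc E M 0 ⟨fun _ => ContinuousAlternatingMap.constOfIsEmpty ℝ E (Fin 0) (1 : ℝ),
    fun _ => contDiffOn_const (c := ContinuousAlternatingMap.constOfIsEmpty ℝ E (Fin 0) (1 : ℝ))⟩

variable (E M) in
/-- The action of `z : ℂ` on `𝒜`, `(z · α)(X₁,…,Xₖ) = α(z X₁,…,z Xₖ)`. For `z = i` it is the
extension of `J` to forms as an algebra automorphism, which is `i^(p-q)` on `(p,q)`-forms. -/
def pull (z : ℂ) : Module.End ℝ (DeRham E M) :=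
  DirectSum.toModule ℝ ℕ _ fun k => inc E M k ∘ₗ pullForm z k

/-- The Hodge star operator of `𝒜`. -/
def hodge (g : HermitianMetric E M) : Module.End ℝ (DeRham E M) :=
  DirectSum.toModule ℝ ℕ _ fun k =>
    if h : k ≤ realDim E then
      inc E M (realDim E - k) ∘ₗ hodgeForm g (Nat.add_sub_cancel' h)
    else 0

/-- The pointwise inner product on `𝒜` at `x`; different degrees are orthogonal. -/
def pairing (g : HermitianMetric E M) (x : M) : LinearMap.BilinForm ℝ (DeRham E M) :=
  DirectSum.toModule ℝ ℕ _ fun k =>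
    (pairForm g x k).compl₂ (DirectSum.component ℝ ℕ (fun k => Form E M k) k)

/-- The fundamental form `ω`. -/
def fundamentalForm (g : HermitianMetric E M) : DeRham E M := inc E M 2 ⟨fundAt g, smooth_fund g⟩

/-- `Q` is the metric adjoint of `P`: `⟨P α, β⟩ = ⟨α, Q β⟩` at every point. As the pointwise pairing
is positive definite, `P` has at most one adjoint. -/
def IsMetricAdjoint (g : HermitianMetric E M) (P Q : Module.End ℝ (DeRham E M)) : Prop :=
  ∀ (x : M) (α β : DeRham E M), pairing g x (P α) β = pairing g x α (Q β)

/-- The Lefschetz operator `L η = ω ∧ η`. -/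
def lefschetz (g : HermitianMetric E M) : Module.End ℝ (DeRham E M) :=
  wedge E M (fundamentalForm g)

/-- Conjugation by `J`: `P_c = J⁻¹ P J`. -/
def twist (P : Module.End ℝ (DeRham E M)) : Module.End ℝ (DeRham E M) :=
  pull E M Complex.I⁻¹ * P * pull E M Complex.I

/-- The operator `dω ∧ -`. -/
def wedgeDOmega (g : HermitianMetric E M) : Module.End ℝ (DeRham E M) :=
  wedge E M (dR E M (fundamentalForm g))

/-- The torsion operator `T = [Λ, dω ∧ -]`. -/
def torsion (g : HermitianMetric E M) (Λ : Module.End ℝ (DeRham E M)) :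
    Module.End ℝ (DeRham E M) :=
  gradedComm (-2) 3 Λ (wedgeDOmega g)

/-- The formal adjoint `d_c^* = -⋆ d_c ⋆` of `d_c = J⁻¹ d J`. -/
def dcStar (g : HermitianMetric E M) : Module.End ℝ (DeRham E M) :=
  -(hodge g * twist (dR E M) * hodge g)

variable (E M) in
/-- The complex de Rham algebra `𝒜_ℂ = ℂ ⊗ 𝒜`. -/
abbrev DeRhamC : Type _ := ℂ ⊗[ℝ] DeRham E M

variable (E M) in
/-- Complex conjugation of complex forms. -/
def conjC : DeRhamC E M →ₗ[ℝ] DeRhamC E M :=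
  LinearMap.rTensor (DeRham E M) Complex.conjAe.toLinearMap

variable (E M) in
/-- The forms of type `(p,q)`: those with `u(z X₁,…,z Xₖ) = z^p z̄^q u(X₁,…,Xₖ)` for all `z : ℂ`. -/
def bidegreePart (p q : ℕ) : Submodule ℂ (DeRhamC E M) where
  carrier := {u | ∀ z : ℂ, (pull E M z).baseChange ℂ u = (z ^ p * (starRingEnd ℂ z) ^ q) • u}
  zero_mem' := fun z => by simp
  add_mem' := fun ha hb z => by rw [map_add, ha z, hb z, smul_add]
  smul_mem' := fun c u hu z => by rw [map_smul, hu z, smul_comm]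

/-- `d = ∂ + ∂̄` with `∂` of bidegree `(1,0)` and `∂̄` of bidegree `(0,1)`. Since `𝒜_ℂ` is the sum of
its parts of type `(p,q)`, this determines `∂` and `∂̄`. -/
def IsDolbeaultSplitting (del delbar : Module.End ℂ (DeRhamC E M)) : Prop :=
  (dR E M).baseChange ℂ = del + delbar ∧
  ∀ p q : ℕ, ∀ u ∈ bidegreePart E M p q,
    del u ∈ bidegreePart E M (p + 1) q ∧ delbar u ∈ bidegreePart E M p (q + 1)

/-- `Q` is the adjoint of `P` for the pointwise Hermitian inner product of complex forms, the
sesquilinear extension `⟨u, v̄⟩` of the pointwise inner product. -/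
def IsHermitianAdjoint (g : HermitianMetric E M) (P Q : Module.End ℂ (DeRhamC E M)) : Prop :=
  ∀ (x : M) (u v : DeRhamC E M),
    (pairing g x).baseChange ℂ (P u) (conjC E M v) = (pairing g x).baseChange ℂ u (conjC E M (Q v))

/-- The formal adjoint `∂^* = -⋆ ∂̄ ⋆` of `∂`. -/
def delStar (g : HermitianMetric E M) (delbar : Module.End ℂ (DeRhamC E M)) :
    Module.End ℂ (DeRhamC E M) :=
  -((hodge g).baseChange ℂ * delbar * (hodge g).baseChange ℂ)

/-- The operator `λ = [∂, L]`, which is the multiplication by `∂ω`. -/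
def lamOp (g : HermitianMetric E M) (del : Module.End ℂ (DeRhamC E M)) :
    Module.End ℂ (DeRhamC E M) :=
  gradedComm 1 2 del ((lefschetz g).baseChange ℂ)

/-- The operator `τ = [Λ, λ]`. -/
def tauOp (g : HermitianMetric E M) (Λ : Module.End ℝ (DeRham E M))
    (del : Module.End ℂ (DeRhamC E M)) : Module.End ℂ (DeRhamC E M) :=
  gradedComm (-2) 3 (Λ.baseChange ℂ) (lamOp g del)

/-- The real operator `Q` is, on complex forms, the sum of `P` and of its complex conjugate. -/
def IsSumWithConj (Q : Module.End ℝ (DeRham E M)) (P : Module.End ℂ (DeRhamC E M)) : Prop :=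
  ∀ u : DeRhamC E M, Q.baseChange ℂ u = P u + conjC E M (P (conjC E M u))

end Eval
end
end
end HermitianBV

/-! The operators Δ₁ and Δ₂ turn out to be the derived brackets [Λ, d] and ½[Λ, [Λ, d]] (`delta₁`,
`delta₂`), and [Λ, Δ₂] = 0. Once this is known, the conjugate of d by e^{Λξ} stops at ξ²
(`expSeries_conj`). Bracketing d² = 0 repeatedly with Λ gives all the quadratic relations
(`multicomplex_relations`). The orders follow because Λ, a sum of products of two contractions, has
order ≤ 2, d has order ≤ 1, and a graded commutator loses one order
(`IsGradedCommAlg.gradedComm_order`).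

The identification of the derived brackets with adjoints rests on sl₂-theory. Let H be the degree
minus n. Then (L, Λ, H) is a nilpotent sl₂-triple, with Weyl element W = e^L e^{-Λ} e^L. The
operator dω = [d, L] commutes with L and has weight 3, so repeated brackets with Λ give a string dω,
T, … of at most four terms. The operator d + T/3 commutes with L and has weight 1, so it generates a
doublet. W acts explicitly on both strings, and this yields W(d + T)W⁻¹ = -[Λ, d], W dω W⁻¹ = ½[Λ,
[Λ, d]] and [Λ, [Λ, [Λ, d]]] = 0 (`IsNilTriple.weyl_differential`).

On the metric side, W carries exterior multiplication by v♭ to minus the contraction with Jv. An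
operator on the forms at a point is determined by its value at 1 and its commutation with linear
forms (`formAlg_op_ext`). Comparing commutation rules gives ⋆ = f · W J (-1)^{k(k+1)/2}, with f a
function of square 1 (`hodgeF_eq`, `hodgeG_eq`). As f is smooth, f² = 1 forces df = 0. Hence f
cancels in ⋆ d_c ⋆, and d_c^* = W d W⁻¹ (`weylG_carries_dG`). The same kind of argument shows that
the adjoint of J⁻¹(b ∧ -)J is W(±b ∧ -)W⁻¹ (`isAdj_twist_wedgeF`), so that (dω_c)^* = W dω W⁻¹ and
T_c^* = W T W⁻¹. Adding up, d_c^* + T_c^* = W(d + T)W⁻¹ = -[Λ, d]. These formulas also provide the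
adjoints as operators on smooth forms.

Everything except d is tensorial and is proved on the forms of one tangent space, then globalized
through `Fibrewise`.

For the Dolbeault statement, the commutation of d with the action of z ∈ ℂ (`actG_dG`) gives ∂ = ½(d
+ i d_c) and ∂̄ = ½(d - i d_c). Then λ = ½(dω + i dω_c) and τ = ½(T + i T_c). The adjoints of such
operators are ½(P^* - i P_c^*), and the three identities are their real and imaginary parts. -/

namespace HermitianBV
noncomputable section

/-! ### Signed sums over permutations. -/

section AltSum
variable {E : Type*}

/-- The signed sum of the values of `T` over all the permutations of the arguments. -/
def altSum {n : ℕ} (T : (Fin n → E) → ℝ) (u : Fin n → E) : ℝ :=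
  ∑ σ : Equiv.Perm (Fin n), ((Equiv.Perm.sign σ : ℤ) : ℝ) * T (u ∘ σ)

theorem altSum_comp_perm {n : ℕ} (T : (Fin n → E) → ℝ) (ρ : Equiv.Perm (Fin n)) (u : Fin n → E) :
    altSum (fun w => T (w ∘ ρ)) u = ((Equiv.Perm.sign ρ : ℤ) : ℝ) * altSum T u := by
  unfold altSum
  rw [Finset.mul_sum]
  refine Fintype.sum_equiv (Equiv.mulRight ρ) _ _ fun σ => ?_
  have h : ((Equiv.Perm.sign ρ : ℤ) : ℝ) * ((Equiv.Perm.sign ρ : ℤ) : ℝ) = 1 := by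
    rw [← Int.cast_mul, Int.units_coe_mul_self, Int.cast_one]
  simp only [Equiv.coe_mulRight, Equiv.Perm.sign_mul, Units.val_mul, Int.cast_mul,
    Equiv.Perm.coe_mul, Function.comp_assoc]
  linear_combination (-((Equiv.Perm.sign σ : ℤ) : ℝ) * T (u ∘ σ ∘ ρ)) * h

theorem altSum_cast {n m : ℕ} (h : n = m) (T : (Fin m → E) → ℝ) (u : Fin n → E) :
    altSum (fun w => T (w ∘ Fin.cast h.symm)) u = altSum T (u ∘ Fin.cast h.symm) := by
  subst h; rfl

theorem altSum_congr {n : ℕ} {T T' : (Fin n → E) → ℝ} (h : ∀ w, T w = T' w) (u : Fin n → E) :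
    altSum T u = altSum T' u := by
  unfold altSum; simp only [h]

theorem altSum_const_mul {n : ℕ} (c : ℝ) (T : (Fin n → E) → ℝ) (u : Fin n → E) :
    altSum (fun w => c * T w) u = c * altSum T u := by
  unfold altSum; rw [Finset.mul_sum]; exact Finset.sum_congr rfl fun σ _ => by ring

theorem altSum_sum {n : ℕ} {ι : Type*} (s : Finset ι) (T : ι → (Fin n → E) → ℝ) (u : Fin n → E) :
    altSum (fun w => ∑ i ∈ s, T i w) u = ∑ i ∈ s, altSum (T i) u := by
  unfold altSum; simp only [Finset.mul_sum]; exact Finset.sum_comm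

/-- A permutation of the first block of arguments extends to all of them with the same sign, so each
of the n! terms of the inner signed sum contributes the same amount to the outer one. -/
theorem altSum_left {n m : ℕ} (T : (Fin n → E) → ℝ) (R : (Fin m → E) → ℝ) (u : Fin (n + m) → E) :
    altSum (fun w => altSum T (w ∘ Fin.castAdd m) * R (w ∘ Fin.natAdd n)) u =
      n.factorial * altSum (fun w => T (w ∘ Fin.castAdd m) * R (w ∘ Fin.natAdd n)) u := by
  have h : ∀ τ : Equiv.Perm (Fin n), altSum (fun w => ((Equiv.Perm.sign τ : ℤ) : ℝ) *
      (T ((w ∘ Fin.castAdd m) ∘ τ) * R (w ∘ Fin.natAdd n))) u =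
      altSum (fun w => T (w ∘ Fin.castAdd m) * R (w ∘ Fin.natAdd n)) u := by
    intro τ
    rw [altSum_const_mul]
    have h1 := altSum_comp_perm (fun w : Fin (n + m) → E => T (w ∘ Fin.castAdd m) *
      R (w ∘ Fin.natAdd n)) (finSumFinEquiv.permCongr (Equiv.Perm.sumCongr τ 1)) u
    rw [Equiv.Perm.sign_permCongr, Equiv.Perm.sign_sumCongr, Equiv.Perm.sign_one, mul_one] at h1
    have h2 : ∀ w : Fin (n + m) → E,
        (w ∘ (finSumFinEquiv.permCongr (Equiv.Perm.sumCongr τ 1))) ∘ Fin.castAdd m =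
          (w ∘ Fin.castAdd m) ∘ τ := fun w => funext fun i => by simp [Equiv.permCongr_apply]
    have h3 : ∀ w : Fin (n + m) → E,
        (w ∘ (finSumFinEquiv.permCongr (Equiv.Perm.sumCongr τ 1))) ∘ Fin.natAdd n =
          w ∘ Fin.natAdd n := fun w => funext fun i => by simp [Equiv.permCongr_apply]
    simp only [h2, h3] at h1
    rw [h1, ← mul_assoc, ← Int.cast_mul, Int.units_coe_mul_self, Int.cast_one, one_mul]
  have h0 : ∀ w : Fin (n + m) → E, altSum T (w ∘ Fin.castAdd m) * R (w ∘ Fin.natAdd n) =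
      ∑ τ : Equiv.Perm (Fin n), ((Equiv.Perm.sign τ : ℤ) : ℝ) *
      (T ((w ∘ Fin.castAdd m) ∘ τ) * R (w ∘ Fin.natAdd n)) := fun w => by
    rw [altSum, Finset.sum_mul]; exact Finset.sum_congr rfl fun σ _ => by ring
  rw [altSum_congr h0, altSum_sum, Finset.sum_congr rfl fun τ _ => h τ, Finset.sum_const,
    Finset.card_univ, Fintype.card_perm, Fintype.card_fin, nsmul_eq_mul]

theorem altSum_right {n m : ℕ} (R : (Fin n → E) → ℝ) (T : (Fin m → E) → ℝ) (u : Fin (n + m) → E) :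
    altSum (fun w => R (w ∘ Fin.castAdd m) * altSum T (w ∘ Fin.natAdd n)) u =
      m.factorial * altSum (fun w => R (w ∘ Fin.castAdd m) * T (w ∘ Fin.natAdd n)) u := by
  have h : ∀ τ : Equiv.Perm (Fin m), altSum (fun w => ((Equiv.Perm.sign τ : ℤ) : ℝ) *
      (R (w ∘ Fin.castAdd m) * T ((w ∘ Fin.natAdd n) ∘ τ))) u =
      altSum (fun w => R (w ∘ Fin.castAdd m) * T (w ∘ Fin.natAdd n)) u := by
    intro τ
    rw [altSum_const_mul]
    have h1 := altSum_comp_perm (fun w : Fin (n + m) → E => R (w ∘ Fin.castAdd m) *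
      T (w ∘ Fin.natAdd n)) (finSumFinEquiv.permCongr (Equiv.Perm.sumCongr 1 τ)) u
    rw [Equiv.Perm.sign_permCongr, Equiv.Perm.sign_sumCongr, Equiv.Perm.sign_one, one_mul] at h1
    have h2 : ∀ w : Fin (n + m) → E,
        (w ∘ (finSumFinEquiv.permCongr (Equiv.Perm.sumCongr 1 τ))) ∘ Fin.castAdd m =
          w ∘ Fin.castAdd m := fun w => funext fun i => by simp [Equiv.permCongr_apply]
    have h3 : ∀ w : Fin (n + m) → E,
        (w ∘ (finSumFinEquiv.permCongr (Equiv.Perm.sumCongr 1 τ))) ∘ Fin.natAdd n =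
          (w ∘ Fin.natAdd n) ∘ τ := fun w => funext fun i => by simp [Equiv.permCongr_apply]
    simp only [h2, h3] at h1
    rw [h1, ← mul_assoc, ← Int.cast_mul, Int.units_coe_mul_self, Int.cast_one, one_mul]
  have h0 : ∀ w : Fin (n + m) → E, R (w ∘ Fin.castAdd m) * altSum T (w ∘ Fin.natAdd n) =
      ∑ τ : Equiv.Perm (Fin m), ((Equiv.Perm.sign τ : ℤ) : ℝ) *
      (R (w ∘ Fin.castAdd m) * T ((w ∘ Fin.natAdd n) ∘ τ)) := fun w => by
    rw [altSum, Finset.mul_sum]; exact Finset.sum_congr rfl fun σ _ => by ring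
  rw [altSum_congr h0, altSum_sum, Finset.sum_congr rfl fun τ _ => h τ, Finset.sum_const,
    Finset.card_univ, Fintype.card_perm, Fintype.card_fin, nsmul_eq_mul]

/-- Expansion of a signed sum of a function that is alternating in all the arguments but the
first. -/
theorem altSum_succ {n : ℕ} (T : (Fin (n + 1) → E) → ℝ)
    (hT : ∀ (τ : Equiv.Perm (Fin n)) (w : Fin (n + 1) → E),
      T (w ∘ Equiv.Perm.decomposeFin.symm (0, τ)) = ((Equiv.Perm.sign τ : ℤ) : ℝ) * T w)
    (u : Fin (n + 1) → E) :
    altSum T u = n.factorial * ∑ p : Fin (n + 1), (-1) ^ (p : ℕ) * T (u ∘ p.cycleRange.symm) := by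
  -- Every permutation factors uniquely as the cycle bringing position p to the front times a
  -- permutation fixing 0; the hypothesis on `T` absorbs the second factor.
  let φ : Fin (n + 1) × Equiv.Perm (Fin n) → Equiv.Perm (Fin (n + 1)) := fun q =>
    q.1.cycleRange.symm * Equiv.Perm.decomposeFin.symm (0, q.2)
  have hφ0 : ∀ q, φ q 0 = q.1 := fun q => by
    simp [φ, Equiv.Perm.mul_apply]
  have hinj : Function.Injective φ := by
    rintro ⟨p, τ⟩ ⟨p', τ'⟩ h
    have hp : p = p' := (hφ0 (p, τ)).symm.trans ((congrArg (fun σ => σ 0) h).trans (hφ0 (p', τ')))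
    subst hp
    have := mul_left_cancel h
    have := Equiv.Perm.decomposeFin.symm.injective this
    simp_all
  have hbij : Function.Bijective φ := by
    refine (Fintype.bijective_iff_injective_and_card φ).2 ⟨hinj, ?_⟩
    simp [Fintype.card_perm, Nat.factorial_succ]
  unfold altSum
  rw [← Fintype.sum_bijective φ hbij (fun q => (-1) ^ (q.1 : ℕ) * T (u ∘ q.1.cycleRange.symm)) _ ?_,
    Fintype.sum_prod_type, Finset.mul_sum]
  · refine Finset.sum_congr rfl fun p _ => ?_
    simp [Fintype.card_perm]
  · rintro ⟨p, τ⟩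
    have h1 : u ∘ φ (p, τ) = (u ∘ p.cycleRange.symm) ∘ Equiv.Perm.decomposeFin.symm (0, τ) := rfl
    have h : ((Equiv.Perm.sign τ : ℤ) : ℝ) * ((Equiv.Perm.sign τ : ℤ) : ℝ) = 1 := by
      rw [← Int.cast_mul, Int.units_coe_mul_self, Int.cast_one]
    rw [h1, hT]
    have h2 : ((Equiv.Perm.sign (φ (p, τ)) : ℤ) : ℝ) =
        (-1) ^ (p : ℕ) * ((Equiv.Perm.sign τ : ℤ) : ℝ) := by
      simp [φ, Equiv.Perm.sign_mul, Equiv.Perm.sign_symm]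
    rw [h2]
    linear_combination (-(-1) ^ (p : ℕ) * T (u ∘ p.cycleRange.symm)) * h

end AltSum

/-! ### Associativity of the wedge product and products with linear forms. -/

section WedgeAt
variable {E : Type*} [NormedAddCommGroup E] [NormedSpace ℂ E]

theorem wedgeAt_eq_altSum {k l : ℕ} (β : E [⋀^Fin k]→L[ℝ] ℝ) (γ : E [⋀^Fin l]→L[ℝ] ℝ)
    (u : Fin (k + l) → E) : wedgeAt β γ u = ((k.factorial : ℝ) * (l.factorial : ℝ))⁻¹ *
      altSum (fun w => β (w ∘ Fin.castAdd l) * γ (w ∘ Fin.natAdd k)) u := by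
  rw [wedgeAt_apply]; rfl

theorem altSum_alternating {k : ℕ} (β : E [⋀^Fin k]→L[ℝ] ℝ) (u : Fin k → E) :
    altSum β u = k.factorial * β u := by
  have h : ∀ σ : Equiv.Perm (Fin k), ((Equiv.Perm.sign σ : ℤ) : ℝ) * β (u ∘ σ) = β u := fun σ => by
    have h2 := β.toAlternatingMap.map_perm u σ
    have h3 : β (u ∘ σ) = ((Equiv.Perm.sign σ : ℤ) : ℝ) * β u := by
      simpa [Units.smul_def] using h2
    rw [h3, ← mul_assoc, ← Int.cast_mul, Int.units_coe_mul_self, Int.cast_one, one_mul]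
  rw [altSum, Finset.sum_congr rfl fun σ _ => h σ, Finset.sum_const, Finset.card_univ,
    Fintype.card_perm, Fintype.card_fin, nsmul_eq_mul]

/-- Both bracketings equal 1/(k! l! m!) times the signed sum of the triple product, the inner
antisymmetrization being redundant by `altSum_left` and `altSum_right`. -/
theorem wedgeAt_assoc {k l m : ℕ} (α : E [⋀^Fin k]→L[ℝ] ℝ) (β : E [⋀^Fin l]→L[ℝ] ℝ)
    (γ : E [⋀^Fin m]→L[ℝ] ℝ) (u : Fin (k + l + m) → E) :
    wedgeAt (wedgeAt α β) γ u =
      wedgeAt α (wedgeAt β γ) (u ∘ Fin.cast (Nat.add_assoc k l m).symm) := by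
  have f : ∀ n : ℕ, (n.factorial : ℝ) ≠ 0 := fun n => by positivity
  have h1 : wedgeAt (wedgeAt α β) γ u = ((k.factorial : ℝ) * l.factorial * m.factorial)⁻¹ *
      altSum (fun w : Fin (k + l + m) → E => α ((w ∘ Fin.castAdd m) ∘ Fin.castAdd l) *
        β ((w ∘ Fin.castAdd m) ∘ Fin.natAdd k) * γ (w ∘ Fin.natAdd (k + l))) u := by
    rw [wedgeAt_eq_altSum, altSum_congr (fun w => by rw [wedgeAt_eq_altSum, mul_assoc]),
      altSum_const_mul, altSum_left]
    have := f k; have := f l; have := f m; have := f (k + l)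
    field_simp
  have h2 : ∀ v, wedgeAt α (wedgeAt β γ) v = ((k.factorial : ℝ) * l.factorial * m.factorial)⁻¹ *
      altSum (fun w : Fin (k + (l + m)) → E => α (w ∘ Fin.castAdd (l + m)) *
        (β ((w ∘ Fin.natAdd k) ∘ Fin.castAdd m) * γ ((w ∘ Fin.natAdd k) ∘ Fin.natAdd l))) v := by
    intro v
    rw [wedgeAt_eq_altSum, altSum_congr (fun w => by rw [wedgeAt_eq_altSum, mul_left_comm]),
      altSum_const_mul, altSum_right]
    have := f k; have := f l; have := f m; have := f (l + m)
    field_simp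
  rw [h1, h2, ← altSum_cast (Nat.add_assoc k l m)]
  congr 1
  refine altSum_congr (fun w => ?_) u
  rw [mul_assoc]
  refine congrArg₂ (· * ·) (congrArg α ?_) (congrArg₂ (· * ·) (congrArg β ?_) (congrArg γ ?_)) <;>
  · funext i
    simp only [Function.comp_apply]
    congr 1
    try { ext; simp [Nat.add_assoc] }

/-- A linear form, as an alternating form of degree `1`. -/
def oneFormAt (a : E →L[ℝ] ℝ) : E [⋀^Fin 1]→L[ℝ] ℝ :=
  ContinuousAlternatingMap.ofSubsingleton ℝ E ℝ 0 a

theorem oneFormAt_apply (a : E →L[ℝ] ℝ) (u : Fin 1 → E) : oneFormAt a u = a (u 0) := rfl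

/-- The factor `γ` is already alternating, so only the choice of the argument fed to `a` remains.
This compares the wedge normalization with the operation used in the exterior derivative. -/
theorem wedgeAt_oneFormAt {l : ℕ} (a : E →L[ℝ] ℝ) (γ : E [⋀^Fin l]→L[ℝ] ℝ) (u : Fin (1 + l) → E) :
    wedgeAt (oneFormAt a) γ u =
      ContinuousAlternatingMap.alternatizeUncurryFin (a.smulRight γ)
        (u ∘ Fin.cast (Nat.add_comm l 1)) := by
  have hl : (l.factorial : ℝ) ≠ 0 := by positivity
  set T : (Fin (l + 1) → E) → ℝ := fun w => a (w 0) * γ (w ∘ Fin.succ) with hTdef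
  have hT : ∀ (τ : Equiv.Perm (Fin l)) (w : Fin (l + 1) → E),
      T (w ∘ Equiv.Perm.decomposeFin.symm (0, τ)) = ((Equiv.Perm.sign τ : ℤ) : ℝ) * T w := by
    intro τ w
    have h1 : (w ∘ Equiv.Perm.decomposeFin.symm (0, τ)) ∘ Fin.succ = (w ∘ Fin.succ) ∘ τ :=
      funext fun i => by simp
    have h2 := γ.toAlternatingMap.map_perm (w ∘ Fin.succ) τ
    simp only [hTdef, h1]
    have h3 : γ ((w ∘ Fin.succ) ∘ τ) = ((Equiv.Perm.sign τ : ℤ) : ℝ) * γ (w ∘ Fin.succ) := by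
      simpa [Units.smul_def] using h2
    rw [h3]
    simp
    ring
  rw [wedgeAt_eq_altSum]
  have h4 : altSum (fun w : Fin (1 + l) → E => oneFormAt a (w ∘ Fin.castAdd l) *
      γ (w ∘ Fin.natAdd 1)) u = altSum T (u ∘ Fin.cast (Nat.add_comm l 1)) := by
    rw [← altSum_cast (Nat.add_comm 1 l)]
    refine altSum_congr (fun w => ?_) u
    simp only [hTdef, oneFormAt_apply]
    congr 2
    funext i
    simp only [Function.comp_apply]
    congr 1
    ext
    simp [Nat.add_comm 1]
  rw [h4, altSum_succ T hT, ContinuousAlternatingMap.alternatizeUncurryFin_apply,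
    Nat.factorial_one, Nat.cast_one, one_mul, ← mul_assoc, inv_mul_cancel₀ hl, one_mul]
  refine Finset.sum_congr rfl fun p _ => ?_
  have h5 : ∀ w : Fin (l + 1) → E, (w ∘ p.cycleRange.symm) ∘ Fin.succ = p.removeNth w := fun w =>
    funext fun i => by simp [Fin.removeNth, Fin.cycleRange_symm_succ]
  simp only [hTdef, h5]
  simp [Fin.cycleRange_symm_zero]

/-- The two products differ by the cyclic rotation of l + 1 arguments, which has sign (-1)^l. -/
theorem wedgeAt_oneFormAt_right {l : ℕ} (a : E →L[ℝ] ℝ) (γ : E [⋀^Fin l]→L[ℝ] ℝ)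
    (u : Fin (l + 1) → E) :
    wedgeAt γ (oneFormAt a) u =
      (-1) ^ l * wedgeAt (oneFormAt a) γ (u ∘ Fin.cast (Nat.add_comm 1 l)) := by
  rw [wedgeAt_eq_altSum, wedgeAt_eq_altSum, ← altSum_cast (Nat.add_comm l 1), mul_left_comm]
  rw [mul_comm (l.factorial : ℝ)]
  congr 1
  have h2 : ∀ (T : ℝ), (-1 : ℝ) ^ l * ((-1) ^ l * T) = T := fun T => by
    rw [← mul_assoc, ← mul_pow]; simp
  have h3 := altSum_comp_perm (fun w : Fin (l + 1) → E => γ (w ∘ Fin.castAdd 1) *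
    oneFormAt a (w ∘ Fin.natAdd l)) (finRotate (l + 1)) u
  have h' : ((((-1) ^ (l + 1 - 1) : ℤˣ) : ℤ) : ℝ) = (-1) ^ l := by simp
  rw [sign_finRotate, h'] at h3
  rw [← h2 (altSum _ u), ← h3]
  congr 1
  refine altSum_congr (fun w => ?_) u
  rw [mul_comm]
  refine congrArg₂ (· * ·) ?_ (congrArg γ ?_)
  · simp only [oneFormAt_apply, Function.comp_apply]
    congr 2
    have : Fin.natAdd l (0 : Fin 1) = Fin.last l := by ext; simp
    rw [this, finRotate_last]
    ext; simp
  · funext i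
    simp only [Function.comp_apply]
    congr 1
    have : Fin.castAdd 1 i = i.castSucc := rfl
    rw [this]
    ext
    rw [coe_finRotate_of_ne_last (Fin.castSucc_ne_last i)]
    simp

end WedgeAt

/-! ### Real-valued signs. -/

section Sign

/-- The sign `(-1)^k` as a real number. -/
def sg (k : ℤ) : ℝ := ((k.negOnePow : ℤ) : ℝ)

theorem sg_add (k l : ℤ) : sg (k + l) = sg k * sg l := by
  simp [sg, Int.negOnePow_add]

theorem sg_mul_self (k : ℤ) : sg k * sg k = 1 := by
  rw [sg, ← Int.cast_mul, Int.units_coe_mul_self, Int.cast_one]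

@[simp] theorem sg_zero : sg 0 = 1 := by simp [sg]

@[simp] theorem sg_one : sg 1 = -1 := by simp [sg]

theorem sg_neg (k : ℤ) : sg (-k) = sg k := by simp [sg, Int.negOnePow_neg]

theorem sg_sub (k l : ℤ) : sg (k - l) = sg k * sg l := by
  rw [sub_eq_add_neg, sg_add, sg_neg]

theorem sg_even {k : ℤ} (h : Even k) : sg k = 1 := by simp [sg, Int.negOnePow_even k h]

theorem sg_natCast (k : ℕ) : sg k = (-1) ^ k := by simp [sg]

/-- Replaces unit-valued signs by real scalars, through which linear maps can be moved. -/
theorem negOnePow_smul_eq {V : Type*} [AddCommGroup V] [Module ℝ V] (k : ℤ) (v : V) :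
    k.negOnePow • v = sg k • v := by
  rw [Units.smul_def, sg, Int.cast_smul_eq_zsmul]

end Sign

/-! ### Graded direct sums and operators diagonal in the degree. -/

section Graded
variable {V : ℕ → Type*} [∀ k, AddCommGroup (V k)] [∀ k, Module ℝ (V k)]

variable (V) in
/-- The direct sum of the spaces `V k`; as opposed to `⨁ k, V k` its additive structure is always
that of an additive group. -/
def DSum : Type _ := ⨁ k, V k

instance : AddCommGroup (DSum V) := inferInstanceAs (AddCommGroup (⨁ k, V k))

instance : Module ℝ (DSum V) := inferInstanceAs (Module ℝ (⨁ k, V k))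

/-- The inclusion of a summand. -/
def lofD (k : ℕ) : V k →ₗ[ℝ] DSum V := DirectSum.lof ℝ ℕ V k

/-- The projection to a summand. -/
def compD (k : ℕ) : DSum V →ₗ[ℝ] V k := DirectSum.component ℝ ℕ V k

/-- Linear maps out of a direct sum. -/
def ofD {W : Type*} [AddCommGroup W] [Module ℝ W] (φ : ∀ k, V k →ₗ[ℝ] W) : DSum V →ₗ[ℝ] W :=
  DirectSum.toModule ℝ ℕ W φ

theorem ofD_lofD {W : Type*} [AddCommGroup W] [Module ℝ W] (φ : ∀ k, V k →ₗ[ℝ] W) (k : ℕ)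
    (a : V k) : ofD φ (lofD k a) = φ k a := DirectSum.toModule_lof ℝ k a

theorem compD_lofD (k : ℕ) (a : V k) : compD k (lofD k a) = a := DirectSum.component.lof_self ℝ k a

theorem compD_lofD_of_ne {k l : ℕ} (h : k ≠ l) (a : V l) : compD k (lofD l a) = 0 :=
  DirectSum.of_eq_of_ne _ _ _ h

theorem ext_compD {a b : DSum V} (h : ∀ k, compD k a = compD k b) : a = b := DFinsupp.ext h

theorem induction_lofD {p : DSum V → Prop} (a : DSum V) (h0 : p 0) (h : ∀ k a, p (lofD k a))
    (hadd : ∀ a b, p a → p b → p (a + b)) : p a := DirectSum.induction_on a h0 h hadd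

variable (V) in
/-- The `ℤ`-grading, zero in negative degrees, of a direct sum indexed by `ℕ`. -/
def intGrade : ℤ → Submodule ℝ (DSum V)
  | Int.ofNat k => LinearMap.range (lofD k)
  | Int.negSucc _ => ⊥

theorem lof_mem_intGrade (k : ℕ) (a : V k) : lofD k a ∈ intGrade V k :=
  ⟨a, rfl⟩

theorem intGrade_cases {p : ℤ → (DSum V) → Prop} (h0 : ∀ j, p j 0)
    (h : ∀ (k : ℕ) (a : V k), p k (lofD k a)) {j : ℤ} {a : DSum V}
    (ha : a ∈ intGrade V j) : p j a := by
  cases j with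
  | ofNat k => obtain ⟨b, rfl⟩ := ha; exact h k b
  | negSucc k => rw [(Submodule.mem_bot ℝ).1 ha]; exact h0 _

theorem ext_lof {W : Type*} [AddCommGroup W] [Module ℝ W] {f f' : (DSum V) →ₗ[ℝ] W}
    (h : ∀ k a, f (lofD k a) = f' (lofD k a)) : f = f' :=
  LinearMap.ext fun a => induction_lofD (p := fun a => f a = f' a) a (by simp) h
    fun a b ha hb => by rw [map_add, ha, hb, map_add]

theorem ext_intGrade {W : Type*} [AddCommGroup W] [Module ℝ W] {f f' : (DSum V) →ₗ[ℝ] W}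
    (h : ∀ j, ∀ a ∈ intGrade V j, f a = f' a) : f = f' :=
  ext_lof fun k a => h k _ (lof_mem_intGrade k a)

theorem intGrade_span {S : Submodule ℝ (DSum V)} (h : ∀ j, intGrade V j ≤ S) : S = ⊤ := by
  rw [Submodule.eq_top_iff']
  intro a
  induction a using induction_lofD with
  | h0 => exact S.zero_mem
  | h k a => exact h k (lof_mem_intGrade k a)
  | hadd a b ha hb => exact S.add_mem ha hb

/-- The operator that multiplies the component of degree `k` by `c k`. -/
def scal (c : ℤ → ℝ) : Module.End ℝ (DSum V) :=
  ofD fun k => c k • lofD k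

theorem scal_lof (c : ℤ → ℝ) (k : ℕ) (a : V k) :
    scal c (lofD k a) = c k • lofD k a := by
  rw [scal, ofD_lofD]; rfl

theorem scal_of_mem (c : ℤ → ℝ) {j : ℤ} {a : DSum V} (ha : a ∈ intGrade V j) :
    scal c a = c j • a :=
  intGrade_cases (p := fun j a => scal c a = c j • a) (fun j => by simp) (scal_lof c) ha

theorem scal_mul_scal (c c' : ℤ → ℝ) :
    (scal c * scal c' : Module.End ℝ (DSum V)) = scal (fun k => c k * c' k) :=
  ext_intGrade fun j a ha => by
    rw [Module.End.mul_apply, scal_of_mem c' ha, map_smul, scal_of_mem c ha, scal_of_mem _ ha,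
      smul_smul, mul_comm]

theorem scal_one : (scal (fun _ => 1) : Module.End ℝ (DSum V)) = 1 :=
  ext_intGrade fun j a ha => by rw [scal_of_mem _ ha, one_smul]; rfl

theorem scal_congr {c c' : ℤ → ℝ} (h : ∀ k : ℕ, c k = c' k) :
    (scal c : Module.End ℝ (DSum V)) = scal c' :=
  ext_lof fun k a => by rw [scal_lof, scal_lof, h]

theorem scal_neg (c : ℤ → ℝ) :
    (scal (fun k => -c k) : Module.End ℝ (DSum V)) = -scal c :=
  ext_lof fun k a => by simp [scal_lof]

/-- An operator of degree `j` commutes with `scal` up to a shift. -/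
theorem HasDegree.mul_scal {j : ℤ} {P : Module.End ℝ (DSum V)} (hP : HasDegree (intGrade V) j P)
    (c : ℤ → ℝ) : P * scal c = scal (fun k => c (k - j)) * P :=
  ext_intGrade fun i a ha => by
    rw [Module.End.mul_apply, Module.End.mul_apply, scal_of_mem c ha, map_smul,
      scal_of_mem _ (hP i a ha)]
    simp

theorem HasDegree.scal_mul {j : ℤ} {P : Module.End ℝ (DSum V)} (hP : HasDegree (intGrade V) j P)
    (c : ℤ → ℝ) : scal c * P = P * scal (fun k => c (k + j)) := by
  rw [hP.mul_scal]; simp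

theorem compD_of_mem {j : ℤ} {a : DSum V} (ha : a ∈ intGrade V j) (k : ℕ)
    (hk : (k : ℤ) ≠ j) : compD k a = 0 :=
  intGrade_cases (p := fun j (a : DSum V) => (k : ℤ) ≠ j → compD k a = 0) (fun _ _ => map_zero _)
    (fun l b h => compD_lofD_of_ne (by exact_mod_cast h) b) ha hk

theorem mem_intGrade_of_compD {j : ℕ} {a : DSum V} (h : ∀ k, k ≠ j → compD k a = 0) :
    a ∈ intGrade V j := by
  refine ⟨compD j a, ext_compD fun k => ?_⟩
  by_cases hk : k = j
  · subst hk; exact compD_lofD k _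
  · rw [h k hk, compD_lofD_of_ne hk]

theorem compD_scal (c : ℤ → ℝ) (a : DSum V) (k : ℕ) : compD k (scal c a) = c k • compD k a := by
  induction a using induction_lofD with
  | h0 => simp
  | h l b =>
    rw [scal_lof, map_smul]
    by_cases h : k = l
    · subst h; rfl
    · rw [compD_lofD_of_ne h]; simp
  | hadd a b ha hb => rw [map_add, map_add, ha, hb, map_add, smul_add]

/-- The degrees have distinct eigenvalues, so an eigenvector is homogeneous. Used in `hodgeF_eq` to
read off a degree from a weight. -/
theorem mem_intGrade_of_scal {c : ℤ → ℝ} (hc : Function.Injective c) {j : ℕ} {a : DSum V}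
    (h : scal c a = c j • a) : a ∈ intGrade V j := by
  refine mem_intGrade_of_compD fun k hk => ?_
  have h1 := congrArg (compD k) h
  rw [compD_scal, map_smul, ← sub_eq_zero, ← sub_smul] at h1
  refine (smul_eq_zero.1 h1).resolve_left fun h2 => hk ?_
  exact_mod_cast hc (sub_eq_zero.1 h2)

variable (V) in
theorem isInternal_intGrade : DirectSum.IsInternal (intGrade V) := by
  refine DirectSum.isInternal_submodule_of_iSupIndep_of_iSup_eq_top ?_ ?_
  · intro i
    rw [Submodule.disjoint_def]
    intro a ha hb
    refine ext_compD fun k => ?_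
    rw [map_zero]
    by_cases hk : (k : ℤ) = i
    · have : ⨆ j, ⨆ (_ : j ≠ i), intGrade V j ≤ LinearMap.ker (compD (V := V) k) :=
        iSup_le fun j => iSup_le fun hj c hc =>
          compD_of_mem hc k (fun h => hj (h.symm.trans hk))
      exact this hb
    · exact compD_of_mem ha k hk
  · exact intGrade_span fun j => le_iSup (intGrade V) j

end Graded

/-! ### Calculus of homogeneous operators. -/

section Degree
variable {K A : Type*} [Field K] [AddCommGroup A] [Module K A] {𝒜 : ℤ → Submodule K A}
  {f f' : Module.End K A} {i j : ℤ}

theorem HasDegree.congr (hf : HasDegree 𝒜 i f) (h : i = j) : HasDegree 𝒜 j f := h ▸ hf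

theorem HasDegree.mul (hf : HasDegree 𝒜 i f) (hf' : HasDegree 𝒜 j f') :
    HasDegree 𝒜 (i + j) (f * f') := fun k a ha => by
  have := hf _ _ (hf' k a ha)
  rwa [add_assoc, add_comm j i] at this

theorem HasDegree.add (hf : HasDegree 𝒜 i f) (hf' : HasDegree 𝒜 i f') :
    HasDegree 𝒜 i (f + f') := fun k a ha => (𝒜 _).add_mem (hf k a ha) (hf' k a ha)

theorem HasDegree.neg (hf : HasDegree 𝒜 i f) : HasDegree 𝒜 i (-f) := fun k a ha =>
  (𝒜 _).neg_mem (hf k a ha)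

theorem HasDegree.sub (hf : HasDegree 𝒜 i f) (hf' : HasDegree 𝒜 i f') :
    HasDegree 𝒜 i (f - f') := fun k a ha => (𝒜 _).sub_mem (hf k a ha) (hf' k a ha)

theorem HasDegree.smul (c : K) (hf : HasDegree 𝒜 i f) : HasDegree 𝒜 i (c • f) := fun k a ha =>
  (𝒜 _).smul_mem c (hf k a ha)

theorem HasDegree.units_smul (c : ℤˣ) (hf : HasDegree 𝒜 i f) : HasDegree 𝒜 i (c • f) := by
  rcases Int.units_eq_one_or c with rfl | rfl
  · simpa using hf
  · simpa using hf.neg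

theorem HasDegree.zero : HasDegree 𝒜 i (0 : Module.End K A) := fun _ _ _ => Submodule.zero_mem _

theorem HasDegree.sum {ι : Type*} (s : Finset ι) {F : ι → Module.End K A}
    (h : ∀ l ∈ s, HasDegree 𝒜 i (F l)) : HasDegree 𝒜 i (∑ l ∈ s, F l) := fun k a ha => by
  rw [LinearMap.sum_apply]
  exact Submodule.sum_mem _ fun l hl => h l hl k a ha

theorem HasDegree.one : HasDegree 𝒜 0 (1 : Module.End K A) := fun k a ha => by simpa using ha

theorem HasDegree.pow (hf : HasDegree 𝒜 i f) (n : ℕ) : HasDegree 𝒜 (n * i) (f ^ n) := by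
  induction n with
  | zero => simpa using HasDegree.one
  | succ n ih => rw [pow_succ]; exact (ih.mul hf).congr (by push_cast; ring)

theorem HasDegree.gradedComm (hf : HasDegree 𝒜 i f) (hf' : HasDegree 𝒜 j f') :
    HasDegree 𝒜 (i + j) (gradedComm i j f f') :=
  (hf.mul hf').sub (((hf'.mul hf).congr (add_comm j i)).units_smul _)

end Degree

/-! ### The exterior algebra of one tangent space: multiplication and contraction. -/

section FormAlg
variable {E : Type*} [NormedAddCommGroup E] [NormedSpace ℂ E]

variable (E) in
/-- The space of alternating forms of degree `k` on `E`. -/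
def AltForm (k : ℕ) : Type _ := E [⋀^Fin k]→L[ℝ] ℝ

instance (k : ℕ) : AddCommGroup (AltForm E k) :=
  inferInstanceAs (AddCommGroup (E [⋀^Fin k]→L[ℝ] ℝ))

instance (k : ℕ) : Module ℝ (AltForm E k) := inferInstanceAs (Module ℝ (E [⋀^Fin k]→L[ℝ] ℝ))

variable (E) in
/-- The algebra of alternating forms on `E`. -/
abbrev FormAlg : Type _ := DSum (AltForm E)

variable (E) in
/-- The grading of `FormAlg E`. -/
abbrev formGrade : ℤ → Submodule ℝ (FormAlg E) := intGrade (AltForm E)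

variable (E) in
/-- Inclusion of the forms of degree `k`. -/
def incF (k : ℕ) : (E [⋀^Fin k]→L[ℝ] ℝ) →ₗ[ℝ] FormAlg E := lofD (V := AltForm E) k

variable (E) in
/-- Linear maps out of `FormAlg E`. -/
def ofFormAlg {W : Type*} [AddCommGroup W] [Module ℝ W]
    (φ : ∀ k : ℕ, (E [⋀^Fin k]→L[ℝ] ℝ) →ₗ[ℝ] W) : FormAlg E →ₗ[ℝ] W :=
  ofD (V := AltForm E) φ

theorem ofFormAlg_incF {W : Type*} [AddCommGroup W] [Module ℝ W]
    (φ : ∀ k : ℕ, (E [⋀^Fin k]→L[ℝ] ℝ) →ₗ[ℝ] W) {k : ℕ} (α : E [⋀^Fin k]→L[ℝ] ℝ) :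
    ofFormAlg E φ (incF E k α) = φ k α :=
  ofD_lofD (V := AltForm E) φ k α

theorem incF_mem (k : ℕ) (α : E [⋀^Fin k]→L[ℝ] ℝ) : incF E k α ∈ formGrade E k := ⟨α, rfl⟩

theorem formAlg_ext {W : Type*} [AddCommGroup W] [Module ℝ W] {f f' : FormAlg E →ₗ[ℝ] W}
    (h : ∀ (k : ℕ) (α : E [⋀^Fin k]→L[ℝ] ℝ), f (incF E k α) = f' (incF E k α)) : f = f' :=
  ext_lof h

theorem formAlg_induction {p : FormAlg E → Prop} (a : FormAlg E) (h0 : p 0)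
    (h : ∀ (k : ℕ) (α : E [⋀^Fin k]→L[ℝ] ℝ), p (incF E k α)) (hadd : ∀ a b, p a → p b → p (a + b)) :
    p a :=
  induction_lofD a h0 h hadd

theorem formGrade_cases {p : ℤ → FormAlg E → Prop} (h0 : ∀ j, p j 0)
    (h : ∀ (k : ℕ) (α : E [⋀^Fin k]→L[ℝ] ℝ), p k (incF E k α)) {j : ℤ} {a : FormAlg E}
    (ha : a ∈ formGrade E j) : p j a :=
  intGrade_cases h0 h ha

theorem scal_incF (c : ℤ → ℝ) {k : ℕ} (α : E [⋀^Fin k]→L[ℝ] ℝ) :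
    scal c (incF E k α) = c (k : ℤ) • incF E k α :=
  scal_of_mem c (incF_mem k α)

/-- In the direct sum, forms whose degrees are equal but not syntactically so can be compared
without transport; the cast survives only on the arguments. -/
theorem incF_congr {k l : ℕ} (h : k = l) (α : E [⋀^Fin k]→L[ℝ] ℝ) (β : E [⋀^Fin l]→L[ℝ] ℝ)
    (hu : ∀ u : Fin k → E, α u = β (u ∘ Fin.cast h.symm)) : incF E k α = incF E l β := by
  subst h
  congr 1
  ext u
  exact hu u

/-- The wedge product of two forms, as a bilinear map. -/
def wedgeLin (k l : ℕ) :
    (E [⋀^Fin k]→L[ℝ] ℝ) →ₗ[ℝ] (E [⋀^Fin l]→L[ℝ] ℝ) →ₗ[ℝ] (E [⋀^Fin (k + l)]→L[ℝ] ℝ) :=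
  LinearMap.mk₂ ℝ wedgeAt
    (fun α α' β => by
      ext u; simp [wedgeAt_apply, add_mul, mul_add, Finset.sum_add_distrib])
    (fun c α β => by
      ext u; simp [wedgeAt_apply, Finset.mul_sum, mul_assoc, mul_left_comm])
    (fun α β β' => by
      ext u; simp [wedgeAt_apply, mul_add, Finset.sum_add_distrib])
    (fun c α β => by
      ext u; simp [wedgeAt_apply, Finset.mul_sum, mul_left_comm])

variable (E) in
/-- The wedge product of `FormAlg E`. -/
def wedgeF : FormAlg E →ₗ[ℝ] FormAlg E →ₗ[ℝ] FormAlg E :=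
  ofFormAlg E fun k => LinearMap.flip <| ofFormAlg E fun l => LinearMap.flip ((wedgeLin k l).compr₂ (incF E (k + l)))

theorem wedgeF_incF {k l : ℕ} (α : E [⋀^Fin k]→L[ℝ] ℝ) (β : E [⋀^Fin l]→L[ℝ] ℝ) :
    wedgeF E (incF E k α) (incF E l β) = incF E (k + l) (wedgeAt α β) := by
  simp only [wedgeF, ofFormAlg_incF, LinearMap.flip_apply]
  rfl

theorem wedgeF_assoc (a b c : FormAlg E) :
    wedgeF E (wedgeF E a b) c = wedgeF E a (wedgeF E b c) := by
  induction a using formAlg_induction with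
  | h0 => simp
  | hadd a a' ha ha' => simp only [map_add, LinearMap.add_apply, ha, ha']
  | h k α =>
  induction b using formAlg_induction with
  | h0 => simp
  | hadd a a' ha ha' => simp only [map_add, LinearMap.add_apply, ha, ha']
  | h l β =>
  induction c using formAlg_induction with
  | h0 => simp
  | hadd a a' ha ha' => simp only [map_add, ha, ha']
  | h m γ =>
  simp only [wedgeF_incF]
  exact incF_congr (Nat.add_assoc k l m) _ _ (wedgeAt_assoc α β γ)

/-- Exterior multiplication by a linear form. -/
def extMul : (E →L[ℝ] ℝ) →ₗ[ℝ] Module.End ℝ (FormAlg E) :=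
  wedgeF E ∘ₗ incF E 1 ∘ₗ
    { toFun := oneFormAt
      map_add' := fun _ _ => rfl
      map_smul' := fun _ _ => rfl }

theorem extMul_eq (a : E →L[ℝ] ℝ) : extMul a = wedgeF E (incF E 1 (oneFormAt a)) := rfl

theorem extMul_incF (a : E →L[ℝ] ℝ) {k : ℕ} (β : E [⋀^Fin k]→L[ℝ] ℝ) :
    extMul a (incF E k β) =
      incF E (k + 1) (ContinuousAlternatingMap.alternatizeUncurryFin (a.smulRight β)) := by
  rw [extMul_eq, wedgeF_incF]
  exact incF_congr (Nat.add_comm 1 k) _ _ (wedgeAt_oneFormAt a β)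

theorem hasDegree_extMul (a : E →L[ℝ] ℝ) : HasDegree (formGrade E) 1 (extMul a) := by
  intro j b hb
  refine formGrade_cases (p := fun j b => extMul a b ∈ formGrade E (j + 1)) ?_ ?_ hb
  · intro j; simp
  · intro k β; rw [extMul_incF]; exact incF_mem _ _

theorem extMul_wedgeF (a : E →L[ℝ] ℝ) (b c : FormAlg E) :
    extMul a (wedgeF E b c) = wedgeF E (extMul a b) c := (wedgeF_assoc _ _ _).symm

theorem wedgeF_extMul (a : E →L[ℝ] ℝ) (b : FormAlg E) :
    wedgeF E (extMul a b) = extMul a * wedgeF E b :=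
  LinearMap.ext fun _ => wedgeF_assoc _ _ _

/-- The interior product on forms of degree `k`. -/
def intProdAux (v : E) : ∀ k : ℕ, (E [⋀^Fin k]→L[ℝ] ℝ) →ₗ[ℝ] FormAlg E
  | 0 => 0
  | k + 1 => incF E k ∘ₗ
    { toFun := fun α => α.curryLeft v
      map_add' := fun _ _ => rfl
      map_smul' := fun _ _ => rfl }

/-- The interior product with a vector. -/
def intProd : E →ₗ[ℝ] Module.End ℝ (FormAlg E) where
  toFun v := ofFormAlg E (intProdAux v)
  map_add' v w := formAlg_ext fun k α => by
    rw [LinearMap.add_apply, ofFormAlg_incF, ofFormAlg_incF,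
      ofFormAlg_incF]
    cases k with
    | zero => simp [intProdAux]
    | succ k =>
      simp only [intProdAux, LinearMap.comp_apply, ← map_add]
      exact congrArg _ (α.curryLeft.map_add v w)
  map_smul' _ v := formAlg_ext fun k α => by
    rw [LinearMap.smul_apply, ofFormAlg_incF, ofFormAlg_incF]
    cases k with
    | zero => simp [intProdAux]
    | succ k =>
      simp only [intProdAux, LinearMap.comp_apply, ← map_smul, RingHom.id_apply]
      exact congrArg _ (α.curryLeft.map_smul _ v)

theorem intProd_incF_zero (v : E) (α : E [⋀^Fin 0]→L[ℝ] ℝ) : intProd v (incF E 0 α) = 0 := by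
  show ofFormAlg E (intProdAux v) _ = _
  rw [ofFormAlg_incF]; rfl

theorem intProd_incF_succ (v : E) {k : ℕ} (α : E [⋀^Fin (k + 1)]→L[ℝ] ℝ) :
    intProd v (incF E (k + 1) α) = incF E k (α.curryLeft v) := by
  show ofFormAlg E (intProdAux v) _ = _
  rw [ofFormAlg_incF]; rfl

theorem hasDegree_intProd (v : E) : HasDegree (formGrade E) (-1) (intProd v) := by
  intro j b hb
  refine formGrade_cases (p := fun j b => intProd v b ∈ formGrade E (j + -1)) ?_ ?_ hb
  · intro j; simp
  · intro k β
    cases k with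
    | zero => rw [intProd_incF_zero]; simp
    | succ k =>
      rw [intProd_incF_succ]
      have : ((k + 1 : ℕ) : ℤ) + -1 = k := by push_cast; ring
      rw [this]; exact incF_mem _ _

/-- In the expansion of a ∧ β along the argument v, the term where v is fed to a gives a(v)β, and
the remaining terms are minus a ∧ (contraction of β). With the two anticommutation rules this is the
Clifford algebra in which all fibre computations take place. -/
theorem intProd_extMul (v : E) (a : E →L[ℝ] ℝ) :
    intProd v * extMul a + extMul a * intProd v = a v • (1 : Module.End ℝ (FormAlg E)) := by
  refine formAlg_ext fun k β => ?_
  simp only [LinearMap.add_apply, Module.End.mul_apply, LinearMap.smul_apply, Module.End.one_apply]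
  rw [extMul_incF, intProd_incF_succ]
  cases k with
  | zero =>
    rw [intProd_incF_zero, map_zero, add_zero, ← map_smul]
    congr 1
    ext u
    simp [ContinuousAlternatingMap.alternatizeUncurryFin_apply, Subsingleton.elim _ u]
  | succ k =>
    rw [intProd_incF_succ, extMul_incF, ← map_add, ← map_smul]
    congr 1
    ext u
    simp only [ContinuousAlternatingMap.add_apply, ContinuousAlternatingMap.curryLeft_apply_apply,
      ContinuousAlternatingMap.alternatizeUncurryFin_apply, Fin.sum_univ_succ (n := k + 1),
      ContinuousAlternatingMap.smul_apply]
    simp only [Fin.val_zero, pow_zero, one_smul, Matrix.cons_val_zero, Fin.val_succ, pow_succ,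
      Matrix.cons_val_succ, ContinuousLinearMap.smulRight_apply, ContinuousAlternatingMap.smul_apply,
      ContinuousAlternatingMap.curryLeft_apply_apply, add_assoc]
    have h0 : Fin.removeNth 0 (Matrix.vecCons v u) = u := funext fun i => by simp [Fin.removeNth]
    have hs : ∀ i : Fin (k + 1), Fin.removeNth i.succ (Matrix.vecCons v u) =
        Matrix.vecCons v (Fin.removeNth i u) := fun i => funext fun j => by
      refine Fin.cases ?_ (fun j => ?_) j <;> simp [Fin.removeNth]
    simp only [h0, hs, mul_neg, mul_one, neg_smul, Finset.sum_neg_distrib, neg_add_cancel, add_zero]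

theorem intProd_mul_self (v : E) : intProd v * intProd v = 0 := by
  refine formAlg_ext fun k β => ?_
  rw [Module.End.mul_apply]
  match k, β with
  | 0, β => rw [intProd_incF_zero]; simp
  | 1, β => rw [intProd_incF_succ, intProd_incF_zero]; rfl
  | k + 2, β =>
    rw [intProd_incF_succ, intProd_incF_succ, ContinuousAlternatingMap.curryLeft_same]; simp

/-- Polarization of `intProd_mul_self`. -/
theorem intProd_anticomm (v w : E) : intProd v * intProd w = -(intProd w * intProd v) := by
  have h := intProd_mul_self (v + w)
  rw [map_add, add_mul, mul_add, mul_add, intProd_mul_self, intProd_mul_self, zero_add,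
    add_zero] at h
  exact eq_neg_of_add_eq_zero_left h

theorem wedgeF_oneForm_right (a : E →L[ℝ] ℝ) (b : FormAlg E) :
    wedgeF E b (incF E 1 (oneFormAt a)) = extMul a (scal sg b) := by
  induction b using formAlg_induction with
  | h0 => simp
  | hadd a a' ha ha' => simp only [map_add, LinearMap.add_apply, ha, ha']
  | h k β =>
    rw [scal_incF, map_smul, extMul_eq, wedgeF_incF, wedgeF_incF, ← map_smul, sg_natCast]
    exact incF_congr (Nat.add_comm k 1) _ _ (wedgeAt_oneFormAt_right a β)

/-- By associativity only the product of the two linear forms has to be compared, where the sign is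
that of degree 1. -/
theorem extMul_anticomm (a b : E →L[ℝ] ℝ) : extMul a * extMul b = -(extMul b * extMul a) := by
  refine LinearMap.ext fun c => ?_
  have h : ∀ a b : E →L[ℝ] ℝ, extMul a (extMul b c) = wedgeF E (wedgeF E (incF E 1 (oneFormAt a))
      (incF E 1 (oneFormAt b))) c := fun a b => (wedgeF_assoc _ _ _).symm
  rw [LinearMap.neg_apply, Module.End.mul_apply, Module.End.mul_apply, h, h, wedgeF_oneForm_right,
    scal_incF, Nat.cast_one, sg_one, map_smul, map_smul, LinearMap.smul_apply, neg_one_smul]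
  rfl

variable (E) in
/-- The unit of `FormAlg E`. -/
def oneF : FormAlg E := incF E 0 (ContinuousAlternatingMap.constOfIsEmpty ℝ E (Fin 0) (1 : ℝ))

theorem oneF_mem : oneF E ∈ formGrade E 0 := incF_mem 0 _

theorem incF_zero_eq (α : E [⋀^Fin 0]→L[ℝ] ℝ) : incF E 0 α = α ![] • oneF E := by
  rw [oneF, ← map_smul]
  congr 1
  ext u
  simp [Subsingleton.elim u ![]]

theorem wedgeF_one (a : FormAlg E) : wedgeF E a (oneF E) = a := by
  induction a using formAlg_induction with
  | h0 => simp
  | hadd a a' ha ha' => simp only [map_add, LinearMap.add_apply, ha, ha']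
  | h k β =>
    rw [oneF, wedgeF_incF]
    refine incF_congr (Nat.add_zero k) _ _ fun u => ?_
    rw [wedgeAt_eq_altSum, altSum_congr (T' := β) (fun w => by
      rw [ContinuousAlternatingMap.constOfIsEmpty_apply, mul_one]; rfl), altSum_alternating]
    have : (k.factorial : ℝ) ≠ 0 := by positivity
    field_simp
    simp

theorem one_wedgeF (a : FormAlg E) : wedgeF E (oneF E) a = a := by
  induction a using formAlg_induction with
  | h0 => simp
  | hadd a a' ha ha' => simp only [map_add, ha, ha']
  | h k β =>
    rw [oneF, wedgeF_incF]
    refine incF_congr (Nat.zero_add k) _ _ fun u => ?_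
    rw [wedgeAt_eq_altSum, altSum_congr (T' := fun w => β (w ∘ Fin.cast (Nat.zero_add k).symm))
      (fun w => by
        rw [ContinuousAlternatingMap.constOfIsEmpty_apply, one_mul]
        congr 2; funext i; ext; simp), altSum_cast (Nat.zero_add k), altSum_alternating]
    have : (k.factorial : ℝ) ≠ 0 := by positivity
    field_simp
    simp

/-- Euler's formula. -/
theorem sum_extMul_intProd {ι : Type*} (s : Finset ι) (a : ι → E →L[ℝ] ℝ) (v : ι → E)
    (h : ∀ w, ∑ i ∈ s, a i w • v i = w) :
    ∑ i ∈ s, extMul (a i) * intProd (v i) = scal (fun k => k) := by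
  refine formAlg_ext fun k β => ?_
  simp only [LinearMap.sum_apply, Module.End.mul_apply]
  rw [scal_incF]
  cases k with
  | zero => simp [intProd_incF_zero]
  | succ k =>
    simp only [intProd_incF_succ, extMul_incF]
    rw [← map_sum, ← map_smul]
    congr 1
    have h1 : ∑ i ∈ s, (a i).smulRight (β.curryLeft (v i)) = β.curryLeft := by
      ext w : 1
      simp only [sum_apply, ContinuousLinearMap.smulRight_apply]
      conv_rhs => rw [← h w, map_sum]
      simp only [map_smul]
    have h2 := ContinuousAlternatingMap.alternatizeUncurryFin_curryLeft β
    rw [← h1, ← ContinuousAlternatingMap.alternatizeUncurryFinCLM_apply, map_sum] at h2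
    simp only [ContinuousAlternatingMap.alternatizeUncurryFinCLM_apply] at h2
    rw [h2]
    ext u
    simp

end FormAlg

/-! ### Pullback of forms along a linear map. -/

section Pull
variable {E : Type*} [NormedAddCommGroup E] [NormedSpace ℂ E]

/-- Pullback of forms along a linear map. -/
def pullF (A : E →L[ℝ] E) : Module.End ℝ (FormAlg E) :=
  ofFormAlg E fun k => incF E k ∘ₗ
    { toFun := fun α => α.compContinuousLinearMap A
      map_add' := fun _ _ => rfl
      map_smul' := fun _ _ => rfl }

theorem pullF_incF (A : E →L[ℝ] E) {k : ℕ} (α : E [⋀^Fin k]→L[ℝ] ℝ) :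
    pullF A (incF E k α) = incF E k (α.compContinuousLinearMap A) :=
  ofFormAlg_incF _ α

theorem hasDegree_pullF (A : E →L[ℝ] E) : HasDegree (formGrade E) 0 (pullF A) := fun j b hb =>
  formGrade_cases (p := fun j b => pullF A b ∈ formGrade E (j + 0)) (fun j => by simp)
    (fun k β => by rw [pullF_incF, add_zero]; exact incF_mem _ _) hb

theorem pullF_wedgeF (A : E →L[ℝ] E) (b c : FormAlg E) :
    pullF A (wedgeF E b c) = wedgeF E (pullF A b) (pullF A c) := by
  induction b using formAlg_induction with
  | h0 => simp
  | hadd a a' ha ha' => simp only [map_add, LinearMap.add_apply, ha, ha']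
  | h k β =>
  induction c using formAlg_induction with
  | h0 => simp
  | hadd a a' ha ha' => simp only [map_add, ha, ha']
  | h l γ =>
    simp only [wedgeF_incF, pullF_incF]
    congr 1
    ext u
    simp only [ContinuousAlternatingMap.compContinuousLinearMap_apply, wedgeAt_apply]
    rfl

theorem pullF_oneF (A : E →L[ℝ] E) : pullF A (oneF E) = oneF E := pullF_incF _ _

theorem pullF_extMul (A : E →L[ℝ] E) (a : E →L[ℝ] ℝ) :
    pullF A * extMul a = extMul (a ∘L A) * pullF A := by
  refine LinearMap.ext fun b => ?_
  rw [Module.End.mul_apply, Module.End.mul_apply, extMul_eq, extMul_eq, pullF_wedgeF, pullF_incF]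
  rfl

theorem intProd_pullF (A : E →L[ℝ] E) (v : E) :
    intProd v * pullF A = pullF A * intProd (A v) := by
  refine formAlg_ext fun k β => ?_
  rw [Module.End.mul_apply, Module.End.mul_apply, pullF_incF]
  cases k with
  | zero => rw [intProd_incF_zero, intProd_incF_zero, map_zero]
  | succ k =>
    rw [intProd_incF_succ, intProd_incF_succ, pullF_incF]
    congr 1
    ext u
    simp only [ContinuousAlternatingMap.curryLeft_apply_apply,
      ContinuousAlternatingMap.compContinuousLinearMap_apply]
    congr 1
    funext i
    refine Fin.cases ?_ (fun j => ?_) i <;> simp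

theorem pullF_mul_pullF (A B : E →L[ℝ] E) : pullF A * pullF B = pullF (B ∘L A) :=
  formAlg_ext fun k β => by
    rw [Module.End.mul_apply, pullF_incF, pullF_incF, pullF_incF]; rfl

theorem pullF_id : pullF (ContinuousLinearMap.id ℝ E) = 1 :=
  formAlg_ext fun k β => by rw [pullF_incF]; rfl

end Pull

/-! ### Generation by linear forms; commutativity and antiderivations. -/

section Generation
variable {E : Type*} [NormedAddCommGroup E] [NormedSpace ℂ E] [FiniteDimensional ℂ E]

/-- The algebra of forms is generated by the linear forms. -/
theorem formAlg_generation {S : Submodule ℝ (FormAlg E)} (h1 : oneF E ∈ S)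
    (h : ∀ (a : E →L[ℝ] ℝ), ∀ b ∈ S, extMul a b ∈ S) (b : FormAlg E) : b ∈ S := by
  have key : ∀ (k : ℕ) (β : E [⋀^Fin k]→L[ℝ] ℝ), incF E k β ∈ S := by
    intro k
    induction k with
    | zero => intro β; rw [incF_zero_eq]; exact S.smul_mem _ h1
    | succ k ih =>
      intro β
      -- Euler's formula writes (k + 1)β as a sum of products of linear forms with the contractions
      -- of β, which have degree k; dividing by k + 1 gives the induction step.
      have e := sum_extMul_intProd Finset.univ
        (fun i => LinearMap.toContinuousLinearMap ((realBasis E).coord i)) (realBasis E)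
        (fun w => (realBasis E).sum_repr w)
      have e' := LinearMap.congr_fun e (incF E (k + 1) β)
      rw [scal_incF, LinearMap.sum_apply] at e'
      have hk : (((k + 1 : ℕ) : ℤ) : ℝ) ≠ 0 := by positivity
      rw [← one_smul ℝ (incF E (k + 1) β), ← inv_mul_cancel₀ hk, mul_smul, ← e']
      refine S.smul_mem _ (Submodule.sum_mem _ fun i _ => ?_)
      rw [Module.End.mul_apply, intProd_incF_succ]
      exact h _ _ (ih _)
  induction b using formAlg_induction with
  | h0 => exact S.zero_mem
  | hadd a a' ha ha' => exact S.add_mem ha ha'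
  | h k β => exact key k β

/-- Operators that agree on `1` and satisfy the same commutation relations with the linear forms
are equal. -/
theorem formAlg_op_ext {P Q : Module.End ℝ (FormAlg E)} (h1 : P (oneF E) = Q (oneF E))
    (h : ∀ a : E →L[ℝ] ℝ, ∃ R : Module.End ℝ (FormAlg E), P * extMul a = R * P ∧
      Q * extMul a = R * Q) : P = Q := by
  refine LinearMap.ext fun b => ?_
  refine formAlg_generation (S := LinearMap.eqLocus P Q) h1 (fun a b hb => ?_) b
  obtain ⟨R, hP, hQ⟩ := h a
  have hb' : P b = Q b := hb
  show (P * extMul a) b = (Q * extMul a) b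
  rw [hP, hQ, Module.End.mul_apply, Module.End.mul_apply, hb']

/-- Written with the diagonal operator `scal` so that b need not be homogeneous: the admissible b
then form a subspace, to which the generation principle applies. -/
theorem wedgeF_comm' (b : FormAlg E) (j : ℤ) (c : FormAlg E) (hc : c ∈ formGrade E j) :
    wedgeF E b c = wedgeF E c (scal (fun i => sg (i * j)) b) := by
  revert j c
  let S : Submodule ℝ (FormAlg E) :=
    { carrier := {b | ∀ (j : ℤ) (c : FormAlg E), c ∈ formGrade E j →
        wedgeF E b c = wedgeF E c (scal (fun i => sg (i * j)) b)}
      zero_mem' := fun j c _ => by simp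
      add_mem' := fun ha hb j c hc => by
        simp only [map_add, LinearMap.add_apply, ha j c hc, hb j c hc]
      smul_mem' := fun r b hb j c hc => by
        simp only [map_smul, LinearMap.smul_apply, hb j c hc] }
  refine formAlg_generation (S := S) ?_ ?_ b
  · intro j c _
    rw [scal_of_mem _ oneF_mem, one_wedgeF, zero_mul, sg_zero, one_smul, wedgeF_one]
  · intro a b hb j c hc
    have h1 : extMul a c = sg j • wedgeF E c (incF E 1 (oneFormAt a)) := by
      rw [wedgeF_oneForm_right, scal_of_mem _ hc, map_smul, smul_smul, sg_mul_self, one_smul]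
    have h2 : scal (fun i => sg (i * j)) (extMul a b) =
        sg j • extMul a (scal (fun i => sg (i * j)) b) := by
      rw [← Module.End.mul_apply, (hasDegree_extMul a).scal_mul, Module.End.mul_apply, ← map_smul]
      congr 1
      have : (scal (fun i => sg ((i + 1) * j)) : Module.End ℝ (FormAlg E)) =
          sg j • scal (fun i => sg (i * j)) := formAlg_ext fun k β => by
        rw [LinearMap.smul_apply, scal_incF, scal_incF, add_mul, sg_add, one_mul, smul_smul,
          mul_comm]
      rw [this]; rfl
    rw [← extMul_wedgeF, hb j c hc, extMul_wedgeF, h1, h2, map_smul, map_smul,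
      LinearMap.smul_apply, wedgeF_assoc]
    rfl

theorem wedgeF_comm {i j : ℤ} {b c : FormAlg E} (hb : b ∈ formGrade E i) (hc : c ∈ formGrade E j) :
    wedgeF E b c = sg (i * j) • wedgeF E c b := by
  rw [wedgeF_comm' b j c hc, scal_of_mem _ hb, map_smul]

/-- The interior product is an antiderivation. -/
theorem intProd_wedgeF (v : E) (b c : FormAlg E) :
    intProd v (wedgeF E b c) = wedgeF E (intProd v b) c + wedgeF E (scal sg b) (intProd v c) := by
  revert c
  let S : Submodule ℝ (FormAlg E) :=
    { carrier := {b | ∀ c, intProd v (wedgeF E b c) =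
        wedgeF E (intProd v b) c + wedgeF E (scal sg b) (intProd v c)}
      zero_mem' := fun c => by simp
      add_mem' := fun ha hb c => by
        simp only [map_add, LinearMap.add_apply, ha c, hb c]; abel
      smul_mem' := fun r b hb c => by
        simp only [map_smul, LinearMap.smul_apply, hb c, smul_add] }
  refine formAlg_generation (S := S) ?_ ?_ b
  · intro c
    rw [one_wedgeF, scal_of_mem _ oneF_mem, sg_zero, one_smul, one_wedgeF, oneF, intProd_incF_zero]
    simp
  · intro a b hb c
    have h1 : ∀ x, intProd v (extMul a x) = a v • x - extMul a (intProd v x) := fun x => by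
      have := LinearMap.congr_fun (intProd_extMul v a) x
      simp only [LinearMap.add_apply, Module.End.mul_apply, LinearMap.smul_apply,
        Module.End.one_apply] at this
      rw [← this]; abel
    have h2 : scal sg (extMul a b) = -extMul a (scal sg b) := by
      rw [← Module.End.mul_apply, (hasDegree_extMul a).scal_mul, Module.End.mul_apply, ← map_neg]
      congr 1
      have : (scal (fun i => sg (i + 1)) : Module.End ℝ (FormAlg E)) = -scal sg := by
        rw [← scal_neg]; exact scal_congr fun k => by rw [sg_add]; simp
      rw [this]; rfl
    rw [← extMul_wedgeF, h1, hb c, h1, h2]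
    simp only [map_add, map_sub, map_neg, map_smul, LinearMap.sub_apply, LinearMap.neg_apply,
      LinearMap.smul_apply, extMul_wedgeF]
    abel

/-- Forms of degree greater than the real dimension vanish. -/
theorem incF_eq_zero {k : ℕ} (hk : realDim E < k) (α : E [⋀^Fin k]→L[ℝ] ℝ) : incF E k α = 0 := by
  have : α = 0 := by
    apply ContinuousAlternatingMap.toAlternatingMap_injective
    refine Module.Basis.ext_alternating (realBasis E) fun I hI => ?_
    have := Fintype.card_le_of_injective I hI
    simp only [Fintype.card_fin] at this
    omega
  rw [this, map_zero]

theorem formGrade_eq_zero {j : ℤ} (hj : j < 0 ∨ (realDim E : ℤ) < j) {a : FormAlg E}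
    (ha : a ∈ formGrade E j) : a = 0 :=
  formGrade_cases (p := fun j (a : FormAlg E) => (j < 0 ∨ (realDim E : ℤ) < j) → a = 0) (fun _ _ => rfl)
    (fun k α h => incF_eq_zero (by omega) α) ha hj

/-- Such an operator moves every degree out of the range [0, 2n]. This is the source of all
nilpotency below. -/
theorem eq_zero_of_hasDegree {j : ℤ} (hj : j < -(realDim E : ℤ) ∨ (realDim E : ℤ) < j)
    {P : Module.End ℝ (FormAlg E)} (hP : HasDegree (formGrade E) j P) : P = 0 := by
  refine formAlg_ext fun k α => ?_
  rw [LinearMap.zero_apply]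
  by_cases hk : realDim E < k
  · rw [incF_eq_zero hk, map_zero]
  · exact formGrade_eq_zero (by omega) (hP k _ (incF_mem k α))

end Generation

/-! ### Hermitian inner products on a tangent space. -/

variable {E : Type*} [NormedAddCommGroup E] [NormedSpace ℂ E]

/-- `g` is an inner product for which the multiplication by `i` is an isometry. -/
structure IsHermInner (g : E →L[ℝ] E →L[ℝ] ℝ) : Prop where
  symm : ∀ v w, g v w = g w v
  pos : ∀ v, v ≠ 0 → 0 < g v v
  herm : ∀ v w, g (Complex.I • v) (Complex.I • w) = g v w

theorem IsHermInner.apply_I {g : E →L[ℝ] E →L[ℝ] ℝ} (hg : IsHermInner g) (v w : E) :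
    g v (Complex.I • w) = -g (Complex.I • v) w := by
  rw [← hg.herm v, smul_smul, Complex.I_mul_I, neg_one_smul, map_neg]

/-- Exterior multiplication by the linear form `g(v, ·)`. -/
def flatMul (g : E →L[ℝ] E →L[ℝ] ℝ) : E →ₗ[ℝ] Module.End ℝ (FormAlg E) := extMul ∘ₗ g.toLinearMap

theorem flatMul_eq (g : E →L[ℝ] E →L[ℝ] ℝ) (v : E) : flatMul g v = extMul (g v) := rfl

theorem hasDegree_flatMul (g : E →L[ℝ] E →L[ℝ] ℝ) (v : E) :
    HasDegree (formGrade E) 1 (flatMul g v) := hasDegree_extMul _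

theorem intProd_flatMul (g : E →L[ℝ] E →L[ℝ] ℝ) (v w : E) (a : FormAlg E) :
    intProd v (flatMul g w a) = g w v • a - flatMul g w (intProd v a) := by
  have := LinearMap.congr_fun (intProd_extMul v (g w)) a
  simp only [LinearMap.add_apply, Module.End.mul_apply, LinearMap.smul_apply,
    Module.End.one_apply] at this
  rw [← this, flatMul_eq]; abel

variable [FiniteDimensional ℂ E] {g : E →L[ℝ] E →L[ℝ] ℝ}

/-! ### Expansions in a basis and its metric dual. -/

section DualBasis

theorem dualBasisAt_apply (hg : IsHermInner g) (i j : Fin (realDim E)) :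
    g (dualBasisAt g i) (realBasis E j) = if i = j then 1 else 0 := by
  have h : IsUnit (gram g).det := (gram_det_pos hg.symm hg.pos).ne'.isUnit
  have h1 := congrFun (congrFun (Matrix.nonsing_inv_mul (gram g) h) i) j
  rw [Matrix.one_apply, Matrix.mul_apply] at h1
  rw [← h1, dualBasisAt, map_sum, sum_apply]
  exact Finset.sum_congr rfl fun k _ => by simp [gram]

theorem sum_dualBasisAt_smul (hg : IsHermInner g) (v : E) :
    ∑ i, g (dualBasisAt g i) v • realBasis E i = v := by
  conv_rhs => rw [← (realBasis E).sum_repr v]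
  refine Finset.sum_congr rfl fun i _ => ?_
  congr 1
  conv_lhs => rw [← (realBasis E).sum_repr v]
  simp only [map_sum, map_smul, dualBasisAt_apply hg, smul_eq_mul, mul_ite, mul_one, mul_zero,
    Finset.sum_ite_eq, Finset.mem_univ, if_true]

theorem sum_realBasis_smul (hg : IsHermInner g) (v : E) :
    ∑ i, g (realBasis E i) v • dualBasisAt g i = v := by
  have h : ∀ w, g (∑ i, g (realBasis E i) v • dualBasisAt g i) w = g v w := fun w => by
    conv_rhs => rw [← sum_dualBasisAt_smul hg w]
    simp only [map_sum, map_smul, sum_apply, smul_apply, smul_eq_mul]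
    exact Finset.sum_congr rfl fun i _ => by rw [hg.symm v, mul_comm]
  -- Both sides have the same inner product with every vector, so positivity applied to their
  -- difference finishes.
  by_contra hne
  have h1 := hg.pos _ (sub_ne_zero.2 hne)
  set d := ∑ i, g (realBasis E i) v • dualBasisAt g i - v with hd
  have h2 : g d d = 0 := by
    have h3 : g d = g (∑ i, g (realBasis E i) v • dualBasisAt g i) - g v := by rw [hd, map_sub]
    rw [h3, sub_apply, h, sub_self]
  exact h1.ne' h2

theorem exists_flat (hg : IsHermInner g) (a : E →L[ℝ] ℝ) : ∃ v, a = g v := by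
  refine ⟨∑ i, a (realBasis E i) • dualBasisAt g i, ?_⟩
  ext w
  conv_lhs => rw [← sum_dualBasisAt_smul hg w]
  simp only [map_sum, map_smul, sum_apply, smul_apply, smul_eq_mul]
  exact Finset.sum_congr rfl fun i _ => mul_comm _ _

/-- By the Riesz isomorphism it is enough to test the commutation with the forms v♭; `R v` is
whatever v♭ becomes when moved across both operators. -/
theorem formAlg_flat_ext (hg : IsHermInner g) {P Q : Module.End ℝ (FormAlg E)}
    (h1 : P (oneF E) = Q (oneF E)) (R : E → Module.End ℝ (FormAlg E))
    (hP : ∀ v, P * flatMul g v = R v * P) (hQ : ∀ v, Q * flatMul g v = R v * Q) : P = Q :=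
  formAlg_op_ext h1 fun a => by
    obtain ⟨v, rfl⟩ := exists_flat hg a
    exact ⟨R v, hP v, hQ v⟩

theorem sum_flatMul_dualBasis (hg : IsHermInner g) :
    ∑ i, flatMul g (dualBasisAt g i) * intProd (realBasis E i) = scal (fun k => k) :=
  sum_extMul_intProd Finset.univ (fun i => g (dualBasisAt g i)) _ (sum_dualBasisAt_smul hg)

end DualBasis

/-! ### The Hodge star and its commutation with multiplication and contraction. -/

section Hodge

/-- The Hodge star, as a linear map on forms of degree `k`. -/
def hodgeLin (g : E →L[ℝ] E →L[ℝ] ℝ) {k l : ℕ} (h : k + l = realDim E) :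
    (E [⋀^Fin k]→L[ℝ] ℝ) →ₗ[ℝ] (E [⋀^Fin l]→L[ℝ] ℝ) where
  toFun := hodgeAt g h
  map_add' α β := by
    ext u; simp [hodgeAt_apply, add_mul, mul_add, Finset.sum_add_distrib]
  map_smul' c α := by
    ext u; simp [hodgeAt_apply, Finset.mul_sum, mul_assoc, mul_left_comm]

/-- The Hodge star operator of `FormAlg E`. -/
def hodgeF (g : E →L[ℝ] E →L[ℝ] ℝ) : Module.End ℝ (FormAlg E) :=
  ofFormAlg E fun k =>
    if h : k ≤ realDim E then incF E (realDim E - k) ∘ₗ hodgeLin g (Nat.add_sub_cancel' h) else 0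

theorem hodgeF_incF (g : E →L[ℝ] E →L[ℝ] ℝ) {k l : ℕ} (h : k + l = realDim E)
    (α : E [⋀^Fin k]→L[ℝ] ℝ) : hodgeF g (incF E k α) = incF E l (hodgeAt g h α) := by
  obtain rfl : l = realDim E - k := by omega
  rw [hodgeF, ofFormAlg_incF, dif_pos (by omega)]
  rfl

theorem hodgeF_mem (g : E →L[ℝ] E →L[ℝ] ℝ) {k : ℤ} {a : FormAlg E} (ha : a ∈ formGrade E k) :
    hodgeF g a ∈ formGrade E (realDim E - k) :=
  formGrade_cases (p := fun k a => hodgeF g a ∈ formGrade E (realDim E - k)) (fun j => by simp)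
    (fun k α => by
      by_cases hk : realDim E < k
      · rw [incF_eq_zero hk, map_zero]; exact Submodule.zero_mem _
      · have h : k + (realDim E - k) = realDim E := by omega
        rw [hodgeF_incF g h]
        have : (realDim E : ℤ) - k = ((realDim E - k : ℕ) : ℤ) := by omega
        rw [this]; exact incF_mem _ _) ha

theorem hodgeF_mul_scal (g : E →L[ℝ] E →L[ℝ] ℝ) (c : ℤ → ℝ) :
    hodgeF g * scal c = scal (fun k => c (realDim E - k)) * hodgeF g :=
  ext_intGrade fun j a ha => by
    rw [Module.End.mul_apply, Module.End.mul_apply, scal_of_mem c ha, map_smul,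
      scal_of_mem _ (hodgeF_mem g ha)]
    simp

/-- The real dimension is even, so ⋆ preserves the parity of degrees. -/
theorem sg_realDim : sg (realDim E) = 1 := sg_even ⟨Module.finrank ℂ E, by push_cast; ring⟩

theorem hodgeF_mul_sg (g : E →L[ℝ] E →L[ℝ] ℝ) : hodgeF g * scal sg = scal sg * hodgeF g := by
  rw [hodgeF_mul_scal]
  congr 2
  funext k
  rw [sg_sub, sg_realDim, one_mul]

/-- Evaluation of the top degree component on the basis `realBasis E`. -/
def topEval : FormAlg E →ₗ[ℝ] ℝ :=
  ofFormAlg E fun k =>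
    if h : k = realDim E then
      { toFun := fun α => α (fun i => realBasis E (Fin.cast h i))
        map_add' := fun _ _ => rfl
        map_smul' := fun _ _ => rfl }
    else 0

theorem topEval_incF {k : ℕ} (h : k = realDim E) (α : E [⋀^Fin k]→L[ℝ] ℝ) :
    topEval (incF E k α) = α (fun i => realBasis E (Fin.cast h i)) := by
  rw [topEval, ofFormAlg_incF, dif_pos h]; rfl

/-- The values of ⋆β are the top coefficients of β ∧ w♭. Identities for ⋆ thereby become identities
in the exterior algebra. -/
theorem hodgeAt_eq_topEval (hg : IsHermInner g) {k l : ℕ} (h : k + l = realDim E)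
    (β : E [⋀^Fin k]→L[ℝ] ℝ) (w : Fin l → E) : hodgeAt g h β w =
      (√(gram g).det)⁻¹ * topEval (wedgeF E (incF E k β) (incF E l (flatWedge g w))) := by
  rw [hodgeAt_eq_wedgeAt g hg.symm, wedgeF_incF, topEval_incF h]

/-- Laplace expansion of the Gram determinant along its first column. -/
theorem incF_flatWedge_cons (g : E →L[ℝ] E →L[ℝ] ℝ) {l : ℕ} (v : E) (w : Fin l → E) :
    incF E (l + 1) (flatWedge g (Matrix.vecCons v w)) =
      flatMul g v (incF E l (flatWedge g w)) := by
  rw [flatMul_eq, extMul_incF]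
  congr 1
  ext u
  rw [flatWedge_apply, Matrix.det_succ_column_zero,
    ContinuousAlternatingMap.alternatizeUncurryFin_apply]
  refine Finset.sum_congr rfl fun i _ => ?_
  simp only [Matrix.of_apply, Matrix.cons_val_zero, ContinuousLinearMap.smulRight_apply,
    ContinuousAlternatingMap.smul_apply, smul_eq_mul, flatWedge_apply, mul_assoc, zsmul_eq_mul,
    Int.cast_pow, Int.cast_neg, Int.cast_one]
  rfl

/-- Laplace expansion of the same determinant along its first row. -/
theorem intProd_flatWedge (g : E →L[ℝ] E →L[ℝ] ℝ) {l : ℕ} (v : E) (w : Fin (l + 1) → E) :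
    intProd v (incF E (l + 1) (flatWedge g w)) =
      ∑ j : Fin (l + 1), ((-1) ^ (j : ℕ) * g (w j) v) • incF E l (flatWedge g (j.removeNth w)) := by
  rw [intProd_incF_succ]
  simp only [← map_smul, ← map_sum]
  congr 1
  ext u
  rw [ContinuousAlternatingMap.curryLeft_apply_apply, flatWedge_apply, Matrix.det_succ_row_zero,
    ContinuousAlternatingMap.sum_apply]
  refine Finset.sum_congr rfl fun i _ => ?_
  simp only [Matrix.of_apply, Matrix.cons_val_zero,
    ContinuousAlternatingMap.smul_apply, smul_eq_mul, flatWedge_apply]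
  rfl

/-- Testing against w♭, the factor v♭ is moved across β at the cost of (-1)^k and becomes an
additional first entry of w, that is, a contraction with v. -/
theorem hodgeF_flatMul (hg : IsHermInner g) (v : E) :
    hodgeF g * flatMul g v = intProd v * hodgeF g * scal sg := by
  refine formAlg_ext fun k β => ?_
  simp only [Module.End.mul_apply]
  rw [scal_incF, map_smul, map_smul, sg_natCast]
  by_cases hk : realDim E < k
  · rw [incF_eq_zero hk]; simp
  by_cases hk' : k = realDim E
  · have h1 : flatMul g v (incF E k β) = 0 :=
      formGrade_eq_zero (Or.inr (by omega)) (hasDegree_flatMul g v k _ (incF_mem k β))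
    rw [h1, hodgeF_incF g (show k + 0 = realDim E by omega), intProd_incF_zero, smul_zero, map_zero]
  obtain ⟨l, hl⟩ : ∃ l, k + (l + 1) = realDim E := ⟨realDim E - k - 1, by omega⟩
  rw [hodgeF_incF g hl, intProd_incF_succ, flatMul_eq, extMul_incF,
    hodgeF_incF g (show k + 1 + l = realDim E by omega), ← map_smul]
  congr 1
  ext w
  rw [hodgeAt_eq_topEval hg, ContinuousAlternatingMap.smul_apply,
    ContinuousAlternatingMap.curryLeft_apply_apply, hodgeAt_eq_topEval hg, incF_flatWedge_cons,
    ← extMul_incF, flatMul_eq]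
  have h2 : wedgeF E (incF E k β) (extMul (g v) (incF E l (flatWedge g w))) =
      (-1 : ℝ) ^ k • wedgeF E (extMul (g v) (incF E k β)) (incF E l (flatWedge g w)) := by
    rw [extMul_eq, ← wedgeF_assoc, wedgeF_oneForm_right, scal_incF, sg_natCast]
    simp only [map_smul, LinearMap.smul_apply]
    rfl
  have h3 : (-1 : ℝ) ^ k * (-1) ^ k = 1 := by rw [← mul_pow]; simp
  rw [h2, map_smul, smul_eq_mul, smul_eq_mul]
  linear_combination (-(√(gram g).det)⁻¹ * topEval (wedgeF E (extMul (g v) (incF E k β))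
    (incF E l (flatWedge g w)))) * h3

/-- An integration by parts: β ∧ w♭ has degree above the top one and vanishes, so contracting it
with v exchanges the contraction of β with that of w♭. -/
theorem hodgeF_intProd (hg : IsHermInner g) (v : E) :
    hodgeF g * intProd v = -(flatMul g v * hodgeF g * scal sg) := by
  refine formAlg_ext fun k β => ?_
  simp only [LinearMap.neg_apply, Module.End.mul_apply]
  rw [scal_incF, map_smul, map_smul, sg_natCast]
  by_cases hk : realDim E < k
  · rw [incF_eq_zero hk]; simp
  obtain ⟨l, hl⟩ : ∃ l, k + l = realDim E := ⟨realDim E - k, by omega⟩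
  rw [hodgeF_incF g hl]
  cases k with
  | zero =>
    have h1 : flatMul g v (incF E l (hodgeAt g hl β)) = 0 :=
      formGrade_eq_zero (Or.inr (by omega)) (hasDegree_flatMul g v l _ (incF_mem l _))
    rw [h1, intProd_incF_zero]; simp
  | succ k =>
    rw [intProd_incF_succ, hodgeF_incF g (show k + (l + 1) = realDim E by omega), flatMul_eq,
      extMul_incF, ← map_smul, ← map_neg]
    congr 1
    ext w
    rw [hodgeAt_eq_topEval hg, ContinuousAlternatingMap.neg_apply,
      ContinuousAlternatingMap.smul_apply,
      ContinuousAlternatingMap.alternatizeUncurryFin_apply, ← intProd_incF_succ]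
    have h2 : wedgeF E (intProd v (incF E (k + 1) β)) (incF E (l + 1) (flatWedge g w)) =
        -((-1 : ℝ) ^ (k + 1) • wedgeF E (incF E (k + 1) β)
          (intProd v (incF E (l + 1) (flatWedge g w)))) := by
      -- The degree here is (k + 1) + (l + 1), one more than the real dimension.
      have h3 : wedgeF E (incF E (k + 1) β) (incF E (l + 1) (flatWedge g w)) = 0 := by
        rw [wedgeF_incF]; exact incF_eq_zero (by omega) _
      have h4 := intProd_wedgeF v (incF E (k + 1) β) (incF E (l + 1) (flatWedge g w))
      rw [h3, map_zero, scal_incF, sg_natCast, map_smul, LinearMap.smul_apply] at h4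
      exact eq_neg_of_add_eq_zero_left h4.symm
    rw [h2, intProd_flatWedge]
    simp only [map_neg, map_smul, map_sum, smul_eq_mul, mul_neg, neg_inj,
      ContinuousLinearMap.smulRight_apply, ContinuousAlternatingMap.smul_apply,
      hodgeAt_eq_topEval hg, Finset.mul_sum]
    refine Finset.sum_congr rfl fun j _ => ?_
    rw [hg.symm v]
    ring

/-- Both sides anticommute with every v♭, so only the value at 1 matters. There the two factors
1/√det cancel the Gram determinant produced by the volume form. -/
theorem hodgeF_hodgeF (hg : IsHermInner g) : hodgeF g * hodgeF g = scal sg := by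
  have hs : (scal sg * scal sg : Module.End ℝ (FormAlg E)) = 1 := by
    rw [scal_mul_scal, ← scal_one]; exact scal_congr fun k => sg_mul_self _
  refine formAlg_flat_ext hg ?_ (fun v => -flatMul g v) (fun v => ?_) (fun v => ?_)
  · have h0 : 0 + realDim E = realDim E := Nat.zero_add _
    rw [Module.End.mul_apply, scal_of_mem _ oneF_mem, sg_zero, one_smul]
    rw [oneF, hodgeF_incF g h0, hodgeF_incF g (show realDim E + 0 = realDim E from rfl),
      incF_zero_eq]
    have h1 : ∀ w : Fin (realDim E) → E, hodgeAt g h0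
        (ContinuousAlternatingMap.constOfIsEmpty ℝ E (Fin 0) (1 : ℝ)) w =
        (√(gram g).det)⁻¹ * flatWedge g w (realBasis E) := fun w => by
      rw [hodgeAt_eq_topEval hg]
      show _ * topEval (wedgeF E (oneF E) _) = _
      rw [one_wedgeF, topEval_incF rfl]
      rfl
    have h2 : flatWedge g (![] : Fin 0 → E) =
        ContinuousAlternatingMap.constOfIsEmpty ℝ E (Fin 0) (1 : ℝ) := by
      ext u; simp [flatWedge_apply]
    have h3 : flatWedge g (realBasis E) (realBasis E) = (gram g).det := by
      rw [flatWedge_apply, ← Matrix.det_transpose]; rfl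
    rw [hodgeAt_eq_topEval hg, h2]
    have h4 := wedgeF_one (incF E (realDim E) (hodgeAt g h0
        (ContinuousAlternatingMap.constOfIsEmpty ℝ E (Fin 0) (1 : ℝ))))
    rw [oneF] at h4
    rw [h4, topEval_incF rfl, h1]
    have h5 := gram_det_pos hg.symm hg.pos
    have h6 : (√(gram g).det)⁻¹ * ((√(gram g).det)⁻¹ * flatWedge g (fun i => realBasis E
        (Fin.cast rfl i)) (realBasis E)) = 1 := by
      show (√(gram g).det)⁻¹ * ((√(gram g).det)⁻¹ * flatWedge g (realBasis E) (realBasis E)) = 1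
      rw [h3, ← mul_assoc, ← mul_inv, Real.mul_self_sqrt h5.le, inv_mul_cancel₀ h5.ne']
    exact (congrArg (fun c : ℝ => c • oneF E) h6).trans (one_smul ℝ _)
  · calc hodgeF g * hodgeF g * flatMul g v = hodgeF g * (hodgeF g * flatMul g v) := mul_assoc _ _ _
      _ = hodgeF g * intProd v * hodgeF g * scal sg := by rw [hodgeF_flatMul hg]; simp only [mul_assoc]
      _ = -flatMul g v * hodgeF g * (hodgeF g * scal sg) * scal sg := by
        rw [hodgeF_intProd hg, hodgeF_mul_sg]; simp only [mul_assoc, neg_mul]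
      _ = -flatMul g v * (hodgeF g * hodgeF g) := by simp only [mul_assoc, hs, mul_one]
  · rw [(hasDegree_flatMul g v).scal_mul]
    have : (scal (fun i => sg (i + 1)) : Module.End ℝ (FormAlg E)) = -scal sg := by
      rw [← scal_neg]; exact scal_congr fun k => by rw [sg_add]; simp
    rw [this, neg_mul, mul_neg]

end Hodge

/-! ### Calculus of intertwining relations. -/

section Intertwine
variable {A : Type*} [Ring A] [Algebra ℝ A]

/-- `w` carries `x` to `y`: `w x = y w`. -/
def Carries (w x y : A) : Prop := w * x = y * w

variable {w w' x y z x' y' : A}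

theorem Carries.eq (h : Carries w x y) : w * x = y * w := h

theorem Carries.congr (h : Carries w x y) (hy : y = z) : Carries w x z := hy ▸ h

theorem Carries.congr_left (h : Carries w x y) (hx : x = z) : Carries w z y := hx ▸ h

theorem Carries.add (h : Carries w x y) (h' : Carries w x' y') : Carries w (x + x') (y + y') := by
  rw [Carries, mul_add, add_mul, h.eq, h'.eq]

theorem Carries.neg (h : Carries w x y) : Carries w (-x) (-y) := by
  rw [Carries, mul_neg, neg_mul, h.eq]

theorem Carries.sub (h : Carries w x y) (h' : Carries w x' y') : Carries w (x - x') (y - y') := by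
  rw [Carries, mul_sub, sub_mul, h.eq, h'.eq]

theorem Carries.smul (c : ℝ) (h : Carries w x y) : Carries w (c • x) (c • y) := by
  rw [Carries, mul_smul_comm, smul_mul_assoc, h.eq]

theorem Carries.mul (h : Carries w x y) (h' : Carries w x' y') : Carries w (x * x') (y * y') := by
  rw [Carries, ← mul_assoc, h.eq, mul_assoc, h'.eq, mul_assoc]

theorem Carries.one : Carries w (1 : A) 1 := by rw [Carries, mul_one, one_mul]

theorem Carries.pow (h : Carries w x y) (n : ℕ) : Carries w (x ^ n) (y ^ n) := by
  induction n with
  | zero => rw [pow_zero, pow_zero]; exact Carries.one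
  | succ n ih => rw [pow_succ, pow_succ]; exact ih.mul h

theorem Carries.sum {ι : Type*} (s : Finset ι) {X Y : ι → A} (h : ∀ i ∈ s, Carries w (X i) (Y i)) :
    Carries w (∑ i ∈ s, X i) (∑ i ∈ s, Y i) := by
  rw [Carries, Finset.mul_sum, Finset.sum_mul]
  exact Finset.sum_congr rfl fun i hi => h i hi

theorem Carries.trans (h : Carries w x y) (h' : Carries w' y z) : Carries (w' * w) x z := by
  rw [Carries, mul_assoc, h.eq, ← mul_assoc, h'.eq, mul_assoc]

/-- Inverse intertwiners. -/
theorem Carries.symm (h : Carries w x y) (h1 : w' * w = 1) (h2 : w * w' = 1) : Carries w' y x := by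
  have : w' * (y * w) * w' = w' * (w * x) * w' := by rw [h.eq]
  rw [mul_assoc, mul_assoc y, h2, mul_one, ← mul_assoc w' w, h1, one_mul] at this
  exact this

end Intertwine

/-! ### Divided powers and exponentials of nilpotent elements. -/

section Exponential
variable {A : Type*} [Ring A] [Algebra ℝ A]

/-- The divided power `a ^ n / n!`, zero for negative `n`. -/
def divPow (a : A) : ℤ → A
  | Int.ofNat n => ((n.factorial : ℝ)⁻¹) • a ^ n
  | Int.negSucc _ => 0

theorem divPow_natCast (a : A) (n : ℕ) : divPow a n = ((n.factorial : ℝ)⁻¹) • a ^ n := rfl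

theorem divPow_of_neg (a : A) {k : ℤ} (hk : k < 0) : divPow a k = 0 := by
  cases k with
  | ofNat n => exact absurd hk (by simp)
  | negSucc n => rfl

/-- Valid for every integer index, including k = -1 where the coefficient vanishes; shifts of the
index then need no boundary cases. -/
theorem mul_divPow (a : A) (k : ℤ) : a * divPow a k = ((k + 1 : ℤ) : ℝ) • divPow a (k + 1) := by
  rcases lt_trichotomy k (-1) with h | rfl | h
  · rw [divPow_of_neg a (by omega), divPow_of_neg a (by omega), mul_zero, smul_zero]
  · simp [divPow_of_neg]
  · obtain ⟨n, rfl⟩ : ∃ n : ℕ, k = n := ⟨k.toNat, by omega⟩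
    have h1 : (n : ℤ) + 1 = ((n + 1 : ℕ) : ℤ) := by push_cast; ring
    have h2 : (n.factorial : ℝ) ≠ 0 := by positivity
    rw [h1, divPow_natCast, divPow_natCast, mul_smul_comm, ← pow_succ', smul_smul,
      Nat.factorial_succ]
    congr 1
    push_cast
    field_simp

/-- Divided powers of `a` to the left of `c₀`, when the iterated commutators of `a` with `c₀` are
`c₁, c₂, c₃, 0`. -/
theorem divPow_mul {a c₀ c₁ c₂ c₃ : A} (h0 : a * c₀ - c₀ * a = c₁) (h1 : a * c₁ - c₁ * a = c₂)
    (h2 : a * c₂ - c₂ * a = c₃) (h3 : a * c₃ - c₃ * a = 0) (k : ℤ) :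
    divPow a k * c₀ = c₀ * divPow a k + c₁ * divPow a (k - 1) + (1 / 2 : ℝ) • (c₂ * divPow a (k - 2))
      + (1 / 6 : ℝ) • (c₃ * divPow a (k - 3)) := by
  rcases lt_or_ge k 0 with hk | hk
  · simp [divPow_of_neg a hk, divPow_of_neg a (show k - 1 < 0 by omega),
      divPow_of_neg a (show k - 2 < 0 by omega), divPow_of_neg a (show k - 3 < 0 by omega)]
  obtain ⟨n, rfl⟩ : ∃ n : ℕ, k = n := ⟨k.toNat, by omega⟩
  clear hk
  induction n with
  | zero =>
    rw [divPow_of_neg a (show ((0 : ℕ) : ℤ) - 1 < 0 by omega),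
      divPow_of_neg a (show ((0 : ℕ) : ℤ) - 2 < 0 by omega),
      divPow_of_neg a (show ((0 : ℕ) : ℤ) - 3 < 0 by omega), divPow_natCast]
    simp
  | succ n ih =>
    have hn : (((n : ℤ) + 1 : ℤ) : ℝ) ≠ 0 := by push_cast; positivity
    have e0 : a * c₀ = c₀ * a + c₁ := by rw [← h0]; abel
    have e1 : a * c₁ = c₁ * a + c₂ := by rw [← h1]; abel
    have e2 : a * c₂ = c₂ * a + c₃ := by rw [← h2]; abel
    have e3 : a * c₃ = c₃ * a := by rw [← sub_eq_zero, h3]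
    refine (smul_right_injective A hn) ?_
    have m0 := mul_divPow a n
    have m1 := mul_divPow a (n - 1)
    have m2 := mul_divPow a (n - 2)
    have m3 := mul_divPow a (n - 3)
    rw [show (n : ℤ) - 1 + 1 = n by ring] at m1
    rw [show (n : ℤ) - 2 + 1 = n - 1 by ring] at m2
    rw [show (n : ℤ) - 3 + 1 = n - 2 by ring] at m3
    have hl : (((n : ℤ) + 1 : ℤ) : ℝ) • (divPow a ((n + 1 : ℕ) : ℤ) * c₀) = a * (divPow a n * c₀) := by
      rw [← smul_mul_assoc, ← mul_assoc, m0]; norm_cast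
    simp only
    rw [hl, ih, mul_add, mul_add, mul_add, mul_smul_comm, mul_smul_comm, ← mul_assoc, ← mul_assoc,
      ← mul_assoc, ← mul_assoc, e0, e1, e2, e3, add_mul, add_mul, add_mul, mul_assoc, mul_assoc,
      mul_assoc, mul_assoc, m0, m1, m2, m3]
    simp only [mul_smul_comm]
    push_cast
    rw [show (n : ℤ) + 1 - 1 = n by ring, show (n : ℤ) + 1 - 2 = n - 1 by ring,
      show (n : ℤ) + 1 - 3 = n - 2 by ring]
    module

/-- The exponential of a nilpotent element. -/
def nexp (a : A) : A :=
  letI : Module ℚ A := Module.compHom A (algebraMap ℚ ℝ)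
  IsNilpotent.exp a

theorem nexp_eq_sum {a : A} {k : ℕ} (h : a ^ k = 0) :
    nexp a = ∑ i ∈ Finset.range k, divPow a i := by
  let _ : Module ℚ A := Module.compHom A (algebraMap ℚ ℝ)
  refine (IsNilpotent.exp_eq_sum h).trans (Finset.sum_congr rfl fun i _ => ?_)
  rw [divPow_natCast]
  show algebraMap ℚ ℝ (i.factorial : ℚ)⁻¹ • a ^ i = _
  simp

theorem nexp_mul_nexp_neg {a : A} (h : IsNilpotent a) : nexp a * nexp (-a) = 1 := by
  let _ : Module ℚ A := Module.compHom A (algebraMap ℚ ℝ)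
  exact IsNilpotent.exp_mul_exp_neg_self h

theorem nexp_neg_mul_nexp {a : A} (h : IsNilpotent a) : nexp (-a) * nexp a = 1 := by
  have := nexp_mul_nexp_neg h.neg
  rwa [neg_neg] at this

theorem sum_divPow_sub {a : A} {k : ℕ} (h : a ^ k = 0) (j m : ℕ) (hm : k + j ≤ m) :
    ∑ i ∈ Finset.range m, divPow a (i - j) = nexp a := by
  obtain ⟨r, rfl⟩ := Nat.exists_eq_add_of_le hm
  -- The first j terms have negative index and vanish; what is left still contains all the nonzero
  -- powers.
  rw [show k + j + r = j + (k + r) by ring, Finset.sum_range_add]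
  have h1 : ∑ i ∈ Finset.range j, divPow a ((i : ℤ) - j) = 0 :=
    Finset.sum_eq_zero fun i hi => divPow_of_neg a (by have := Finset.mem_range.1 hi; omega)
  rw [h1, zero_add, nexp_eq_sum (k := k + r) (by rw [pow_add, h, zero_mul])]
  exact Finset.sum_congr rfl fun i _ => by congr 1; push_cast; ring

/-- This is e^a c e^{-a} = e^{ad a} c, summed from `divPow_mul`. The cubic truncation suffices
because every sl₂-string met below has at most four terms. -/
theorem nexp_carries {a c₀ c₁ c₂ c₃ : A} (ha : IsNilpotent a) (h0 : a * c₀ - c₀ * a = c₁)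
    (h1 : a * c₁ - c₁ * a = c₂) (h2 : a * c₂ - c₂ * a = c₃) (h3 : a * c₃ - c₃ * a = 0) :
    Carries (nexp a) c₀ (c₀ + c₁ + (1 / 2 : ℝ) • c₂ + (1 / 6 : ℝ) • c₃) := by
  obtain ⟨k, hk⟩ := ha
  have s0 := sum_divPow_sub hk 0 (k + 3) (by omega)
  have s1 := sum_divPow_sub hk 1 (k + 3) (by omega)
  have s2 := sum_divPow_sub hk 2 (k + 3) (by omega)
  have s3 := sum_divPow_sub hk 3 (k + 3) (by omega)
  have key := Finset.sum_congr (rfl : Finset.range (k + 3) = _)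
    fun (i : ℕ) _ => divPow_mul h0 h1 h2 h3 i
  simp only [Nat.cast_zero, sub_zero, Nat.cast_one, Nat.cast_ofNat] at s0 s1 s2 s3
  rw [← Finset.sum_mul, Finset.sum_add_distrib, Finset.sum_add_distrib, Finset.sum_add_distrib,
    ← Finset.smul_sum, ← Finset.smul_sum, ← Finset.mul_sum, ← Finset.mul_sum, ← Finset.mul_sum,
    ← Finset.mul_sum, s0, s1, s2, s3] at key
  rw [Carries, key]
  simp only [add_mul, smul_mul_assoc]

theorem nexp_carries_self {a c : A} (ha : IsNilpotent a) (h : a * c - c * a = 0) :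
    Carries (nexp a) c c :=
  (nexp_carries (c₁ := 0) (c₂ := 0) (c₃ := 0) ha h (by simp) (by simp) (by simp)).congr (by simp)

theorem Carries.divPow {w x y : A} (h : Carries w x y) (k : ℤ) :
    Carries w (divPow x k) (divPow y k) := by
  cases k with
  | ofNat n => exact (h.pow n).smul _
  | negSucc n => exact (by rw [Carries, HermitianBV.divPow, HermitianBV.divPow, mul_zero, zero_mul])

theorem Carries.nexp {w x y : A} (h : Carries w x y) (hx : IsNilpotent x) (hy : IsNilpotent y) :
    Carries w (nexp x) (nexp y) := by
  obtain ⟨k, hk⟩ := hx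
  obtain ⟨l, hl⟩ := hy
  rw [nexp_eq_sum (k := k + l) (by rw [pow_add, hk, zero_mul]),
    nexp_eq_sum (k := k + l) (by rw [pow_add, hl, mul_zero])]
  exact Carries.sum _ fun i _ => h.divPow i

end Exponential

/-! ### The Weyl element on representations of dimension two, three and four. -/

section Sl2
variable {A : Type*} [Ring A] [Algebra ℝ A]

/-- A nilpotent `sl₂`-triple, `[L, Λ] = H`, `[H, L] = 2 L`, `[H, Λ] = -2 Λ`. -/
structure IsNilTriple (L Λ H : A) : Prop where
  nilL : IsNilpotent L
  nilΛ : IsNilpotent Λ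
  comm : L * Λ - Λ * L = H
  commL : H * L - L * H = (2 : ℝ) • L
  commΛ : H * Λ - Λ * H = -((2 : ℝ) • Λ)

/-- The Weyl element `e^L e^{-Λ} e^L`. -/
def weyl (L Λ : A) : A := nexp L * nexp (-Λ) * nexp L

/-- The inverse `e^{-L} e^Λ e^{-L}` of the Weyl element. -/
def weylInv (L Λ : A) : A := nexp (-L) * nexp Λ * nexp (-L)

variable {L Λ H : A}

theorem IsNilTriple.weyl_mul_inv (t : IsNilTriple L Λ H) : weyl L Λ * weylInv L Λ = 1 := by
  have h1 := nexp_mul_nexp_neg t.nilL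
  have h2 := nexp_neg_mul_nexp t.nilΛ
  calc weyl L Λ * weylInv L Λ
      = nexp L * (nexp (-Λ) * (nexp L * nexp (-L)) * nexp Λ) * nexp (-L) := by
        simp only [weyl, weylInv, mul_assoc]
    _ = 1 := by rw [h1, mul_one, h2, mul_one, h1]

theorem IsNilTriple.weylInv_mul (t : IsNilTriple L Λ H) : weylInv L Λ * weyl L Λ = 1 := by
  have h1 := nexp_neg_mul_nexp t.nilL
  have h2 := nexp_mul_nexp_neg t.nilΛ
  calc weylInv L Λ * weyl L Λ
      = nexp (-L) * (nexp Λ * (nexp (-L) * nexp L) * nexp (-Λ)) * nexp L := by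
        simp only [weyl, weylInv, mul_assoc]
    _ = 1 := by rw [h1, mul_one, h2, mul_one, h1]

theorem weyl_carries {x y z u : A} (h1 : Carries (nexp L) x y) (h2 : Carries (nexp (-Λ)) y z)
    (h3 : Carries (nexp L) z u) : Carries (weyl L Λ) x u := by
  rw [weyl, mul_assoc]
  exact (h1.trans h2).trans h3

theorem neg_comm_eq {x y : A} (h : Λ * x - x * Λ = y) : -Λ * x - x * -Λ = -y := by
  rw [← h]; noncomm_ring

/-- The Weyl element on a two-dimensional representation. -/
theorem weyl_carries_doublet (hL : IsNilpotent L) (hΛ : IsNilpotent Λ) {x y : A}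
    (hx : L * x - x * L = 0) (hxy : Λ * x - x * Λ = y) (hyx : L * y - y * L = x)
    (hy : Λ * y - y * Λ = 0) : Carries (weyl L Λ) x (-y) ∧ Carries (weyl L Λ) y x := by
  have Lx : Carries (nexp L) x x := nexp_carries_self hL hx
  have Ly : Carries (nexp L) y (y + x) :=
    (nexp_carries (c₂ := 0) (c₃ := 0) hL hyx hx (by simp) (by simp)).congr (by simp)
  have Λy : Carries (nexp (-Λ)) y y := nexp_carries_self hΛ.neg (by rw [neg_comm_eq hy, neg_zero])
  have Λx : Carries (nexp (-Λ)) x (x - y) :=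
    (nexp_carries (c₁ := -y) (c₂ := 0) (c₃ := 0) hΛ.neg (neg_comm_eq hxy)
      (by rw [neg_comm_eq (y := 0) (by rw [mul_neg, neg_mul, ← neg_sub', hy, neg_zero]), neg_zero])
      (by simp) (by simp)).congr (by simp [sub_eq_add_neg])
  exact ⟨weyl_carries Lx Λx ((Lx.sub Ly).congr (by abel)),
    weyl_carries Ly ((Λy.add Λx).congr (by abel)) Lx⟩

/-- The triple is its own adjoint representation, on which each exponential is a quadratic
polynomial in the bracket; W reverses the weights. -/
theorem IsNilTriple.weyl_carries_self (t : IsNilTriple L Λ H) :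
    Carries (weyl L Λ) L (-Λ) ∧ Carries (weyl L Λ) Λ (-L) ∧ Carries (weyl L Λ) H (-H) := by
  have hLH : L * H - H * L = (-2 : ℝ) • L := by rw [← neg_sub, t.commL]; module
  have hΛL : Λ * L - L * Λ = -H := by rw [← t.comm]; abel
  have hΛH : Λ * H - H * Λ = (2 : ℝ) • Λ := by rw [← neg_sub, t.commΛ]; module
  have LL : Carries (nexp L) L L := nexp_carries_self t.nilL (sub_self _)
  have LH : Carries (nexp L) H (H - (2 : ℝ) • L) :=
    (nexp_carries (c₂ := 0) (c₃ := 0) t.nilL hLH (by simp) (by simp) (by simp)).congr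
      (by simp [sub_eq_add_neg])
  have LΛ : Carries (nexp L) Λ (Λ + H - L) :=
    (nexp_carries (c₃ := 0) t.nilL t.comm hLH (by simp) (by simp)).congr (by module)
  have ΛΛ : Carries (nexp (-Λ)) Λ Λ := nexp_carries_self t.nilΛ.neg (by simp)
  have ΛH : Carries (nexp (-Λ)) H (H - (2 : ℝ) • Λ) :=
    (nexp_carries (c₂ := 0) (c₃ := 0) t.nilΛ.neg (neg_comm_eq hΛH) (by simp) (by simp)
      (by simp)).congr (by simp [sub_eq_add_neg])
  have ΛL : Carries (nexp (-Λ)) L (L + H - Λ) :=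
    (nexp_carries (c₁ := H) (c₂ := (-2 : ℝ) • Λ) (c₃ := 0) t.nilΛ.neg
      (by rw [neg_comm_eq hΛL, neg_neg]) (by rw [neg_comm_eq hΛH]; module) (by simp)
      (by simp)).congr (by module)
  refine ⟨weyl_carries LL ΛL (((LL.add LH).sub LΛ).congr (by module)),
    weyl_carries LΛ (((ΛΛ.add ΛH).sub ΛL).congr (z := -L) (by module)) LL.neg,
    weyl_carries LH ((ΛH.sub (ΛL.smul 2)).congr (z := -H - (2 : ℝ) • L) (by module))
      ((LH.neg.sub (LL.smul 2)).congr (by module))⟩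

/-- The Weyl element on a four-dimensional representation. -/
theorem weyl_carries_quadruplet (hL : IsNilpotent L) (hΛ : IsNilpotent Λ) {v₀ v₁ v₂ v₃ : A}
    (h0 : Λ * v₀ - v₀ * Λ = v₁) (h1 : Λ * v₁ - v₁ * Λ = v₂) (h2 : Λ * v₂ - v₂ * Λ = v₃)
    (h3 : Λ * v₃ - v₃ * Λ = 0) (k0 : L * v₀ - v₀ * L = 0) (k1 : L * v₁ - v₁ * L = (3 : ℝ) • v₀)
    (k2 : L * v₂ - v₂ * L = (4 : ℝ) • v₁) (k3 : L * v₃ - v₃ * L = (3 : ℝ) • v₂) :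
    Carries (weyl L Λ) v₀ (-((1 / 6 : ℝ) • v₃)) ∧ Carries (weyl L Λ) v₁ ((1 / 2 : ℝ) • v₂) := by
  have neg2 : ∀ {x y : A}, Λ * x - x * Λ = y → -Λ * -x - -x * -Λ = y := fun h => by
    rw [← h]; noncomm_ring
  have ks : ∀ {x y : A} (c : ℝ), L * x - x * L = y → L * (c • x) - (c • x) * L = c • y :=
    fun c h => by rw [← h, mul_smul_comm, smul_mul_assoc, smul_sub]
  have L0 : Carries (nexp L) v₀ v₀ := nexp_carries_self hL k0
  have L1 : Carries (nexp L) v₁ (v₁ + (3 : ℝ) • v₀) :=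
    (nexp_carries (c₂ := (3 : ℝ) • (0 : A)) (c₃ := 0) hL k1 (ks 3 k0) (by simp) (by simp)).congr
      (by module)
  have L2 : Carries (nexp L) v₂ (v₂ + (4 : ℝ) • v₁ + (6 : ℝ) • v₀) :=
    (nexp_carries (c₂ := (4 : ℝ) • (3 : ℝ) • v₀) (c₃ := (4 : ℝ) • (3 : ℝ) • (0 : A)) hL k2
      (ks 4 k1) (ks 4 (ks 3 k0)) (by simp)).congr (by module)
  have L3 : Carries (nexp L) v₃ (v₃ + (3 : ℝ) • v₂ + (6 : ℝ) • v₁ + (6 : ℝ) • v₀) :=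
    (nexp_carries (c₂ := (3 : ℝ) • (4 : ℝ) • v₁) (c₃ := (3 : ℝ) • (4 : ℝ) • (3 : ℝ) • v₀) hL k3
      (ks 3 k2) (ks 3 (ks 4 k1)) ((ks 3 (ks 4 (ks 3 k0))).trans (by simp))).congr (by module)
  have Λ0 : Carries (nexp (-Λ)) v₀ (v₀ - v₁ + (1 / 2 : ℝ) • v₂ - (1 / 6 : ℝ) • v₃) :=
    (nexp_carries (c₁ := -v₁) (c₂ := v₂) (c₃ := -v₃) hΛ.neg (neg_comm_eq h0) (neg2 h1)
      (neg_comm_eq h2) ((neg2 h3))).congr (by module)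
  have Λ1 : Carries (nexp (-Λ)) v₁ (v₁ - v₂ + (1 / 2 : ℝ) • v₃) :=
    (nexp_carries (c₁ := -v₂) (c₂ := v₃) (c₃ := 0) hΛ.neg (neg_comm_eq h1) (neg2 h2)
      ((neg_comm_eq h3).trans neg_zero) (by simp)).congr (by module)
  exact ⟨weyl_carries L0 Λ0 (((L0.sub L1).add (L2.smul _)).sub (L3.smul _) |>.congr (by module)),
    weyl_carries L1 ((Λ1.add (Λ0.smul 3)).congr
      (z := (3 : ℝ) • v₀ - (2 : ℝ) • v₁ + (1 / 2 : ℝ) • v₂) (by module))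
      ((((L0.smul 3).sub (L1.smul 2)).add (L2.smul _)).congr (by module))⟩

end Sl2

/-! ### Highest weight vectors under the adjoint action, and the differential. -/

section HighestWeight
variable {A : Type*} [Ring A] [Algebra ℝ A] {L Λ H : A}

/-- Left and right multiplication commute, and each is nilpotent. This replaces finite
dimensionality, which fails for the space of global forms. -/
theorem isNilpotent_ad {a : A} (h : IsNilpotent a) :
    IsNilpotent (LinearMap.mulLeft ℝ a - LinearMap.mulRight ℝ a) :=
  Commute.isNilpotent_sub (LinearMap.ext fun c => (mul_assoc a c a).symm)
    ((LinearMap.isNilpotent_mulLeft_iff ℝ a).2 h) ((LinearMap.isNilpotent_mulRight_iff ℝ a).2 h)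

/-- The Jacobi identity for commutators, arranged so that `ad x` passes through `ad y`. -/
theorem comm_comm_jacobi {x y m : A} : x * (y * m - m * y) - (y * m - m * y) * x =
    ((x * y - y * x) * m - m * (x * y - y * x)) + (y * (x * m - m * x) - (x * m - m * x) * y) := by
  noncomm_ring

/-- A vector of weight `μ` that is annihilated by `ad L` is annihilated by `(ad Λ) ^ (μ + 1)`. -/
theorem IsNilTriple.ad_pow_eq_zero (t : IsNilTriple L Λ H) {m : A} {μ : ℕ} (h0 : L * m - m * L = 0)
    (hH : H * m - m * H = (μ : ℝ) • m) :
    ((LinearMap.mulLeft ℝ Λ - LinearMap.mulRight ℝ Λ) ^ (μ + 1)) m = 0 := by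
  set f := LinearMap.mulLeft ℝ Λ - LinearMap.mulRight ℝ Λ with hf
  have hfa : ∀ x, f x = Λ * x - x * Λ := fun x => rfl
  have hs : ∀ k, (f ^ (k + 1)) m = Λ * (f ^ k) m - (f ^ k) m * Λ := fun k => by
    rw [pow_succ', Module.End.mul_apply, hfa]
  have hHk : ∀ k : ℕ, H * (f ^ k) m - (f ^ k) m * H = ((μ : ℝ) - 2 * k) • (f ^ k) m := by
    intro k
    induction k with
    | zero => simpa using hH
    | succ k ih =>
      rw [hs, comm_comm_jacobi, ih, t.commΛ]
      simp only [mul_smul_comm, smul_mul_assoc, neg_mul, mul_neg, Nat.cast_add, Nat.cast_one]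
      module
  have hLk : ∀ k : ℕ, L * (f ^ (k + 1)) m - (f ^ (k + 1)) m * L =
      (((k : ℝ) + 1) * (μ - k)) • (f ^ k) m := by
    intro k
    induction k with
    | zero => rw [hs, comm_comm_jacobi, t.comm, hHk, pow_zero, Module.End.one_apply, h0]; simp
    | succ k ih =>
      rw [hs, comm_comm_jacobi, t.comm, hHk, ih]
      simp only [mul_smul_comm, smul_mul_assoc, hs, Nat.cast_add, Nat.cast_one]
      module
  -- For k > μ the coefficient (k + 1)(μ - k) is nonzero, so vanishing descends; starting from the
  -- nilpotency of ad Λ, it reaches the power μ + 1.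
  have hdesc : ∀ k : ℕ, μ + 1 ≤ k → (f ^ (k + 1)) m = 0 → (f ^ k) m = 0 := by
    intro k hk h
    have h1 := hLk k
    rw [h, mul_zero, zero_mul, sub_zero] at h1
    refine (smul_eq_zero.1 h1.symm).resolve_left (mul_ne_zero (by positivity) ?_)
    have : (μ : ℝ) + 1 ≤ k := by exact_mod_cast hk
    linarith
  obtain ⟨N, hN⟩ := isNilpotent_ad t.nilΛ
  have hN' : (f ^ (μ + 1 + N)) m = 0 := by rw [pow_add, hN, mul_zero]; rfl
  clear hN
  induction N with
  | zero => exact hN'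
  | succ N ih => exact ih (hdesc _ (by omega) hN')

/-- The consequences for the Weyl element of the commutation relations between an operator `d` of
weight one, with `[d, L] = v`, and an `sl₂`-triple. -/
theorem IsNilTriple.weyl_differential (t : IsNilTriple L Λ H) {d v : A} (hv : d * L - L * d = v)
    (hLv : L * v - v * L = 0) (hHd : H * d - d * H = d) (hHv : H * v - v * H = (3 : ℝ) • v)
    {T D₁ D₂ : A} (hT : Λ * v - v * Λ = T) (hD₁ : Λ * d - d * Λ = D₁)
    (hD₂ : Λ * D₁ - D₁ * Λ = (2 : ℝ) • D₂) :
    Carries (weyl L Λ) (d + T) (-D₁) ∧ Carries (weyl L Λ) v D₂ ∧ Carries (weyl L Λ) T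
      ((1 / 2 : ℝ) • (Λ * T - T * Λ)) ∧ Λ * D₂ - D₂ * Λ = 0 := by
  obtain ⟨v₂, hv₂⟩ : ∃ v₂, Λ * T - T * Λ = v₂ := ⟨_, rfl⟩
  obtain ⟨v₃, hv₃⟩ : ∃ v₃, Λ * v₂ - v₂ * Λ = v₃ := ⟨_, rfl⟩
  have hLT : L * T - T * L = (3 : ℝ) • v := by
    rw [← hT, comm_comm_jacobi, t.comm, hHv, hLv]; simp
  have hHT : H * T - T * H = T := by
    rw [← hT, comm_comm_jacobi, t.commΛ, hHv]
    simp only [mul_smul_comm, smul_mul_assoc, neg_mul, mul_neg]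
    module
  have hL2 : L * v₂ - v₂ * L = (4 : ℝ) • T := by
    rw [← hv₂, comm_comm_jacobi, t.comm, hHT, hLT]
    simp only [mul_smul_comm, smul_mul_assoc, ← smul_sub, hT]
    module
  have hH2 : H * v₂ - v₂ * H = -v₂ := by
    rw [← hv₂, comm_comm_jacobi, t.commΛ, hHT]
    simp only [mul_smul_comm, smul_mul_assoc, neg_mul, mul_neg]
    module
  have hL3 : L * v₃ - v₃ * L = (3 : ℝ) • v₂ := by
    rw [← hv₃, comm_comm_jacobi, t.comm, hH2, hL2]
    simp only [mul_smul_comm, smul_mul_assoc, ← smul_sub, hv₂]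
    module
  -- The operator v commutes with L and has weight 3, so its string ends after four terms.
  have h4 : Λ * v₃ - v₃ * Λ = 0 := by
    have := t.ad_pow_eq_zero (μ := 3) hLv (by rw [hHv]; norm_num)
    simp only [Nat.reduceAdd, pow_succ', pow_zero, Module.End.mul_apply, Module.End.one_apply,
      LinearMap.sub_apply, LinearMap.mulLeft_apply, LinearMap.mulRight_apply, hT, hv₂, hv₃] at this
    exact this
  -- The coefficient 1/3 is forced by [L, d] = -v and [L, T] = 3v: it makes d' commute with L.
  obtain ⟨d', hd'⟩ : ∃ d', d + (1 / 3 : ℝ) • T = d' := ⟨_, rfl⟩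
  obtain ⟨y, hy⟩ : ∃ y, Λ * d' - d' * Λ = y := ⟨_, rfl⟩
  have hy' : y = D₁ + (1 / 3 : ℝ) • v₂ := by
    rw [← hy, ← hd', ← hD₁, ← hv₂]
    simp only [mul_add, add_mul, mul_smul_comm, smul_mul_assoc, smul_sub]
    abel
  have hLd' : L * d' - d' * L = 0 := by
    have : L * d' - d' * L = -(d * L - L * d) + (1 / 3 : ℝ) • (L * T - T * L) := by
      rw [← hd']
      simp only [mul_add, add_mul, mul_smul_comm, smul_mul_assoc, smul_sub]
      abel
    rw [this, hv, hLT]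
    module
  have hHd' : H * d' - d' * H = d' := by
    have : H * d' - d' * H = (H * d - d * H) + (1 / 3 : ℝ) • (H * T - T * H) := by
      rw [← hd']
      simp only [mul_add, add_mul, mul_smul_comm, smul_mul_assoc, smul_sub]
      abel
    rw [this, hHd, hHT, hd']
  have hΛy : Λ * y - y * Λ = 0 := by
    have := t.ad_pow_eq_zero (μ := 1) hLd' (by rw [hHd']; norm_num)
    simp only [Nat.reduceAdd, pow_succ', pow_zero, Module.End.mul_apply, Module.End.one_apply,
      LinearMap.sub_apply, LinearMap.mulLeft_apply, LinearMap.mulRight_apply, hy] at this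
    exact this
  have hLy : L * y - y * L = d' := by
    rw [← hy, comm_comm_jacobi, t.comm, hHd', hLd']; simp
  -- The vanishing of [Λ, [Λ, d']] reads 2 D₂ + v₃/3 = 0, which identifies D₂ with the last term of
  -- the quadruplet.
  have hD : D₂ = -((1 / 6 : ℝ) • v₃) := by
    have h : (2 : ℝ) • D₂ + (1 / 3 : ℝ) • v₃ = 0 := by
      rw [← hΛy, hy', ← hD₂, ← hv₃]
      simp only [mul_add, add_mul, mul_smul_comm, smul_mul_assoc, smul_sub]
      abel
    have h' := congrArg (fun z => (1 / 2 : ℝ) • z) h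
    simp only [smul_zero] at h'
    rw [eq_neg_iff_add_eq_zero, ← h']
    module
  obtain ⟨q0, q1⟩ := weyl_carries_quadruplet t.nilL t.nilΛ hT hv₂ hv₃ h4 hLv hLT hL2 hL3
  have q2 := (weyl_carries_doublet t.nilL t.nilΛ hLd' hy hLy hΛy).1
  refine ⟨?_, q0.congr hD.symm, q1.congr (by rw [hv₂]), ?_⟩
  -- With d + T = d' + (2/3) T, the images -D₁ - v₂/3 and (2/3)(v₂/2) add up to -D₁.
  · refine ((q2.add (q1.smul (2 / 3))).congr_left ?_).congr ?_
    · rw [← hd']; module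
    · rw [hy']; module
  · rw [hD]
    simp only [mul_neg, neg_mul, mul_smul_comm, smul_mul_assoc]
    rw [sub_neg_eq_add, neg_add_eq_sub, ← smul_sub, ← neg_sub (Λ * v₃), h4]
    simp

end HighestWeight

/-! ### The inner product of forms; multiplication and contraction are adjoint. -/

section Pairing
variable {E : Type*} [NormedAddCommGroup E] [NormedSpace ℂ E] [FiniteDimensional ℂ E]
  {g : E →L[ℝ] E →L[ℝ] ℝ}

/-- The inner product of forms of degree `k`, as a bilinear form. -/
def pairLin (g : E →L[ℝ] E →L[ℝ] ℝ) (k : ℕ) :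
    (E [⋀^Fin k]→L[ℝ] ℝ) →ₗ[ℝ] (E [⋀^Fin k]→L[ℝ] ℝ) →ₗ[ℝ] ℝ :=
  LinearMap.mk₂ ℝ (pairAt g)
    (fun α α' β => by simp [pairAt, add_mul, mul_add, Finset.sum_add_distrib])
    (fun c α β => by simp [pairAt, Finset.mul_sum, mul_assoc, mul_left_comm])
    (fun α β β' => by simp [pairAt, mul_add, Finset.sum_add_distrib])
    (fun c α β => by simp [pairAt, Finset.mul_sum, mul_left_comm])

/-- The inner product of `FormAlg E`; different degrees are orthogonal. -/
def pairF (g : E →L[ℝ] E →L[ℝ] ℝ) : LinearMap.BilinForm ℝ (FormAlg E) :=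
  ofFormAlg E fun k => (pairLin g k).compl₂ (compD (V := AltForm E) k)

theorem pairF_incF (k : ℕ) (α : E [⋀^Fin k]→L[ℝ] ℝ) (b : FormAlg E) :
    pairF g (incF E k α) b = pairAt g α (compD (V := AltForm E) k b) := by
  rw [pairF, ofFormAlg_incF]; rfl

theorem pairF_incF_self (k : ℕ) (α β : E [⋀^Fin k]→L[ℝ] ℝ) :
    pairF g (incF E k α) (incF E k β) = pairAt g α β := by
  rw [pairF_incF]
  congr 1
  exact compD_lofD (V := AltForm E) k β

theorem pairF_incF_of_ne {k l : ℕ} (h : k ≠ l) (α : E [⋀^Fin k]→L[ℝ] ℝ) (β : E [⋀^Fin l]→L[ℝ] ℝ) :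
    pairF g (incF E k α) (incF E l β) = 0 := by
  have h1 : compD (V := AltForm E) k (incF E l β) = 0 := compD_lofD_of_ne (V := AltForm E) h β
  rw [pairF_incF, h1]
  exact ((pairLin g k) α).map_zero

/-- The first index is split off from the multi-index, and (k + 1)/(k + 1)! = 1/k!. -/
theorem pairAt_succ (k : ℕ) (α β : E [⋀^Fin (k + 1)]→L[ℝ] ℝ) :
    ((k : ℝ) + 1) * pairAt g α β =
      ∑ i, pairAt g (α.curryLeft (realBasis E i)) (β.curryLeft (dualBasisAt g i)) := by
  have h : ((k : ℝ) + 1) * (((k + 1).factorial : ℝ))⁻¹ = ((k.factorial : ℝ))⁻¹ := by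
    have h2 : (k.factorial : ℝ) ≠ 0 := by positivity
    rw [Nat.factorial_succ]; push_cast; field_simp
  simp only [pairAt]
  rw [← mul_assoc, h, ← Finset.mul_sum]
  congr 1
  rw [← (Fin.consEquiv fun _ : Fin (k + 1) => Fin (realDim E)).sum_comp, Fintype.sum_prod_type]
  refine Finset.sum_congr rfl fun i _ => Finset.sum_congr rfl fun I _ => ?_
  have hc : ∀ (γ : E [⋀^Fin (k + 1)]→L[ℝ] ℝ) (e : Fin (realDim E) → E),
      γ (fun a => e ((Fin.consEquiv fun _ : Fin (k + 1) => Fin (realDim E)) (i, I) a)) =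
      γ.curryLeft (e i) (fun a => e (I a)) := fun γ e => by
    rw [ContinuousAlternatingMap.curryLeft_apply_apply]
    congr 1
    funext a
    refine Fin.cases ?_ (fun a => ?_) a <;> simp [Fin.consEquiv, Matrix.vecCons]
  rw [hc, hc]

/-- Expresses the pairing in positive degree through pairings of contractions, in lower degree;
symmetry and adjointness are proved by induction with it. -/
theorem pairF_scal (a b : FormAlg E) : pairF g (scal (fun k => k) a) b =
    ∑ i, pairF g (intProd (realBasis E i) a) (intProd (dualBasisAt g i) b) := by
  induction a using formAlg_induction with
  | h0 => simp
  | hadd a a' ha ha' => simp only [map_add, LinearMap.add_apply, ha, ha', Finset.sum_add_distrib]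
  | h k α =>
  induction b using formAlg_induction with
  | h0 => simp
  | hadd a a' ha ha' => simp only [map_add, ha, ha', Finset.sum_add_distrib]
  | h l β =>
  rw [scal_incF, map_smul, LinearMap.smul_apply]
  cases k with
  | zero => simp [intProd_incF_zero]
  | succ k =>
  cases l with
  | zero => simp [intProd_incF_zero, pairF_incF_of_ne]
  | succ l =>
  simp only [intProd_incF_succ]
  by_cases h : k = l
  · subst h
    simp only [pairF_incF_self, ← pairAt_succ]
    push_cast; rfl
  · simp only [pairF_incF_of_ne h, pairF_incF_of_ne (show k + 1 ≠ l + 1 by omega)]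
    simp

/-- Both sums are the contraction of `B` with the inverse metric tensor, which is symmetric. -/
theorem sum_bilin_dualBasis {W : Type*} [AddCommGroup W] [Module ℝ W] (hg : IsHermInner g)
    (B : E →ₗ[ℝ] E →ₗ[ℝ] W) :
    ∑ i, B (realBasis E i) (dualBasisAt g i) = ∑ i, B (dualBasisAt g i) (realBasis E i) := by
  have h1 : ∀ i, dualBasisAt g i = ∑ j, g (dualBasisAt g j) (dualBasisAt g i) • realBasis E j :=
    fun i => (sum_dualBasisAt_smul hg _).symm
  have e1 : ∀ i, B (realBasis E i) (dualBasisAt g i) =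
      ∑ j, g (dualBasisAt g j) (dualBasisAt g i) • B (realBasis E i) (realBasis E j) := fun i => by
    conv_lhs => rw [h1 i]
    simp only [map_sum, map_smul]
  have e2 : ∀ i, B (dualBasisAt g i) (realBasis E i) =
      ∑ j, g (dualBasisAt g j) (dualBasisAt g i) • B (realBasis E j) (realBasis E i) := fun i => by
    conv_lhs => rw [h1 i]
    simp only [map_sum, map_smul, LinearMap.sum_apply, LinearMap.smul_apply]
  simp only [e1, e2]
  rw [Finset.sum_comm]
  exact Finset.sum_congr rfl fun i _ => Finset.sum_congr rfl fun j _ => by rw [hg.symm]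

theorem pairF_symm (hg : IsHermInner g) (a b : FormAlg E) : pairF g a b = pairF g b a := by
  have key : ∀ (k : ℕ) (α β : E [⋀^Fin k]→L[ℝ] ℝ),
      pairF g (incF E k α) (incF E k β) = pairF g (incF E k β) (incF E k α) := by
    intro k
    induction k with
    | zero =>
      intro α β
      have h : ∀ I : Fin 0 → Fin (realDim E), (fun a => dualBasisAt g (I a)) =
        fun a => realBasis E (I a) := fun I => Subsingleton.elim _ _
      simp only [pairF_incF_self, pairAt, h]
      simp only [mul_comm]
    | succ k ih =>
      intro α β
      have hk : ((k + 1 : ℕ) : ℝ) ≠ 0 := by positivity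
      refine mul_left_cancel₀ hk ?_
      have h := fun α β : E [⋀^Fin (k + 1)]→L[ℝ] ℝ => pairF_scal (g := g) (incF E (k + 1) α) (incF E (k + 1) β)
      simp only [scal_incF, map_smul, LinearMap.smul_apply, smul_eq_mul, Int.cast_natCast] at h
      rw [h, h]
      let B : E →ₗ[ℝ] E →ₗ[ℝ] ℝ := LinearMap.mk₂ ℝ
        (fun v w => pairF g (intProd v (incF E (k + 1) β)) (intProd w (incF E (k + 1) α)))
        (by simp) (by simp) (by simp) (by simp)
      refine Eq.trans ?_ (sum_bilin_dualBasis hg B).symm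
      refine Finset.sum_congr rfl fun i _ => ?_
      show _ = pairF g (intProd _ (incF E (k + 1) β)) (intProd _ (incF E (k + 1) α))
      simp only [intProd_incF_succ]
      exact ih _ _
  induction a using formAlg_induction with
  | h0 => simp
  | hadd a a' ha ha' => simp only [map_add, LinearMap.add_apply, ha, ha']
  | h k α =>
  induction b using formAlg_induction with
  | h0 => simp
  | hadd a a' ha ha' => simp only [map_add, LinearMap.add_apply, ha, ha']
  | h l β =>
  by_cases h : k = l
  · subst h; exact key k α β
  · rw [pairF_incF_of_ne h, pairF_incF_of_ne (Ne.symm h)]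

/-- `Q` is adjoint to `P`. -/
def IsAdj (g : E →L[ℝ] E →L[ℝ] ℝ) (P Q : Module.End ℝ (FormAlg E)) : Prop :=
  ∀ a b, pairF g (P a) b = pairF g a (Q b)

variable {P Q P' Q' : Module.End ℝ (FormAlg E)}

theorem IsAdj.add (h : IsAdj g P Q) (h' : IsAdj g P' Q') : IsAdj g (P + P') (Q + Q') := fun a b => by
  simp only [LinearMap.add_apply, map_add, h a b, h' a b]

theorem IsAdj.smul (c : ℝ) (h : IsAdj g P Q) : IsAdj g (c • P) (c • Q) := fun a b => by
  simp only [LinearMap.smul_apply, map_smul, h a b]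

theorem IsAdj.mul (h : IsAdj g P Q) (h' : IsAdj g P' Q') : IsAdj g (P * P') (Q' * Q) := fun a b => by
  simp only [Module.End.mul_apply, h _ b, h' a _]

theorem IsAdj.sum {ι : Type*} (s : Finset ι) {F G : ι → Module.End ℝ (FormAlg E)}
    (h : ∀ i ∈ s, IsAdj g (F i) (G i)) : IsAdj g (∑ i ∈ s, F i) (∑ i ∈ s, G i) := fun a b => by
  simp only [LinearMap.sum_apply, map_sum]
  exact Finset.sum_congr rfl fun i hi => h i hi a b

theorem IsAdj.one : IsAdj g 1 1 := fun _ _ => rfl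

/-- Expand (k + 1)⟨v♭ ∧ α, b⟩ by `pairF_scal` and move the contractions across v♭. The terms g(v,
eᵢ) add up to ⟨α, ι_v b⟩, and by induction the others give k times the same quantity. -/
theorem isAdj_flatMul (hg : IsHermInner g) (v : E) : IsAdj g (flatMul g v) (intProd v) := by
  have key : ∀ (k : ℕ) (α : E [⋀^Fin k]→L[ℝ] ℝ) (b : FormAlg E),
      pairF g (flatMul g v (incF E k α)) b = pairF g (incF E k α) (intProd v b) := by
    have aux : ∀ (k : ℕ) (α : E [⋀^Fin k]→L[ℝ] ℝ) (b : FormAlg E),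
        (∀ i, pairF g (flatMul g v (intProd (realBasis E i) (incF E k α)))
          (intProd (dualBasisAt g i) b) = pairF g (intProd (realBasis E i) (incF E k α))
            (intProd v (intProd (dualBasisAt g i) b))) →
        pairF g (flatMul g v (incF E k α)) b = pairF g (incF E k α) (intProd v b) := by
      intro k α b h
      have hk : ((k : ℝ) + 1) ≠ 0 := by positivity
      refine mul_left_cancel₀ hk ?_
      have h1 := pairF_scal (g := g) (flatMul g v (incF E k α)) b
      rw [scal_of_mem _ (hasDegree_flatMul g v k _ (incF_mem k α)), map_smul, LinearMap.smul_apply,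
        smul_eq_mul] at h1
      push_cast at h1
      rw [h1]
      simp only [intProd_flatMul, map_sub, map_smul, LinearMap.sub_apply, LinearMap.smul_apply, h,
        Finset.sum_sub_distrib, smul_eq_mul]
      have h2 : ∑ i, g v (realBasis E i) * pairF g (incF E k α) (intProd (dualBasisAt g i) b) =
          pairF g (incF E k α) (intProd v b) := by
        conv_rhs => rw [← sum_realBasis_smul hg v]
        simp only [map_sum, map_smul, LinearMap.sum_apply, LinearMap.smul_apply, smul_eq_mul]
        exact Finset.sum_congr rfl fun i _ => by rw [hg.symm]
      have h3 := pairF_scal (g := g) (incF E k α) (intProd v b)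
      rw [scal_incF, map_smul, LinearMap.smul_apply, smul_eq_mul] at h3
      push_cast at h3
      have h4 : ∀ i, intProd v (intProd (dualBasisAt g i) b) =
          -intProd (dualBasisAt g i) (intProd v b) := fun i =>
        LinearMap.congr_fun (intProd_anticomm v (dualBasisAt g i)) b
      simp only [h4, map_neg, Finset.sum_neg_distrib]
      rw [h2, ← h3]
      ring
    intro k
    induction k with
    | zero => exact fun α b => aux 0 α b fun i => by simp [intProd_incF_zero]
    | succ k ih =>
      exact fun α b => aux (k + 1) α b fun i => by rw [intProd_incF_succ]; exact ih _ _
  intro a b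
  induction a using formAlg_induction with
  | h0 => simp
  | hadd a a' ha ha' => simp only [map_add, LinearMap.add_apply, ha, ha']
  | h k α => exact key k α b

end Pairing

/-! ### The Lefschetz operators of one tangent space and their sl₂-triple. -/

section Lefschetz
variable {E : Type*} [NormedAddCommGroup E] [NormedSpace ℂ E] [FiniteDimensional ℂ E]
  {g : E →L[ℝ] E →L[ℝ] ℝ}

/-- The Lefschetz operator in terms of a basis. -/
def lefF (g : E →L[ℝ] E →L[ℝ] ℝ) : Module.End ℝ (FormAlg E) :=
  (1 / 2 : ℝ) • ∑ i, flatMul g (dualBasisAt g i) * flatMul g (Complex.I • realBasis E i)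

theorem hasDegree_lefF (g : E →L[ℝ] E →L[ℝ] ℝ) : HasDegree (formGrade E) 2 (lefF g) :=
  (HasDegree.sum _ fun _ _ => (hasDegree_flatMul g _).mul (hasDegree_flatMul g _)).smul _

theorem flatMul_anticomm (g : E →L[ℝ] E →L[ℝ] ℝ) (v w : E) :
    flatMul g v * flatMul g w = -(flatMul g w * flatMul g v) := extMul_anticomm _ _

theorem lefF_mul_flatMul (g : E →L[ℝ] E →L[ℝ] ℝ) (v : E) :
    lefF g * flatMul g v = flatMul g v * lefF g := by
  rw [lefF, smul_mul_assoc, mul_smul_comm, Finset.sum_mul, Finset.mul_sum]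
  congr 1
  refine Finset.sum_congr rfl fun i _ => ?_
  rw [mul_assoc, flatMul_anticomm g _ v, mul_neg, ← mul_assoc, flatMul_anticomm g _ v, neg_mul,
    neg_neg, mul_assoc]

theorem intProd_mul_flatMul (g : E →L[ℝ] E →L[ℝ] ℝ) (v w : E) :
    intProd v * flatMul g w = g w v • 1 - flatMul g w * intProd v :=
  LinearMap.ext fun a => intProd_flatMul g v w a

/-- Each product of two multiplications yields two terms; by J-invariance of the metric the two
basis sums are -(Jv)♭ and (Jv)♭, and their difference compensates the factor 1/2. -/
theorem lefF_mul_intProd (hg : IsHermInner g) (v : E) :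
    lefF g * intProd v - intProd v * lefF g = -flatMul g (Complex.I • v) := by
  have h : ∀ a b : E, flatMul g a * flatMul g b * intProd v - intProd v * (flatMul g a * flatMul g b)
      = g b v • flatMul g a - g a v • flatMul g b := fun a b => by
    rw [← mul_assoc (intProd v), intProd_mul_flatMul, sub_mul, mul_assoc (flatMul g a) (intProd v),
      intProd_mul_flatMul, mul_sub, smul_mul_assoc, one_mul, mul_smul_comm, mul_one, ← mul_assoc]
    abel
  rw [lefF, smul_mul_assoc, mul_smul_comm, Finset.sum_mul, Finset.mul_sum, ← smul_sub,
    ← Finset.sum_sub_distrib]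
  simp only [h]
  rw [Finset.sum_sub_distrib]
  have h1 : ∑ i, g (Complex.I • realBasis E i) v • flatMul g (dualBasisAt g i) =
      -flatMul g (Complex.I • v) := by
    conv_rhs => rw [← sum_realBasis_smul hg (Complex.I • v)]
    simp only [map_sum, map_smul, map_neg, hg.apply_I, neg_smul, Finset.sum_neg_distrib, neg_neg]
  have h2 : ∑ i, g (dualBasisAt g i) v • flatMul g (Complex.I • realBasis E i) =
      flatMul g (Complex.I • v) := by
    conv_rhs => rw [← sum_dualBasisAt_smul hg v]
    simp only [Finset.smul_sum, map_sum, smul_comm Complex.I, map_smul]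
  rw [h1, h2]
  module

/-- The Lefschetz operator is the multiplication by the fundamental form. -/
theorem wedgeF_fundamental (hg : IsHermInner g) {Ω : E [⋀^Fin 2]→L[ℝ] ℝ}
    (hΩ : ∀ v, Ω v = g (Complex.I • v 0) (v 1)) : wedgeF E (incF E 2 Ω) = lefF g := by
  refine formAlg_flat_ext hg ?_ (flatMul g) (fun v => ?_) (lefF_mul_flatMul g)
  · rw [wedgeF_one]
    have h1 := LinearMap.congr_fun (sum_flatMul_dualBasis hg) (incF E 2 Ω)
    have h2 : ∀ i, intProd (realBasis E i) (incF E 2 Ω) =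
        flatMul g (Complex.I • realBasis E i) (oneF E) := fun i => by
      rw [intProd_incF_succ, flatMul_eq, extMul_eq, wedgeF_one]
      congr 1
      ext u
      exact hΩ _
    rw [scal_incF] at h1
    simp only [LinearMap.sum_apply, Module.End.mul_apply, h2] at h1
    rw [lefF, LinearMap.smul_apply, LinearMap.sum_apply]
    simp only [Module.End.mul_apply]
    rw [h1, smul_smul]
    norm_num
  · refine LinearMap.ext fun b => ?_
    simp only [Module.End.mul_apply]
    rw [flatMul_eq, extMul_eq, ← wedgeF_assoc, ← wedgeF_assoc,
      wedgeF_comm (incF_mem 2 Ω) (incF_mem 1 (oneFormAt (g v))), sg_even (by decide), one_smul]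

/-- The adjoint of the Lefschetz operator. -/
def lamF (g : E →L[ℝ] E →L[ℝ] ℝ) : Module.End ℝ (FormAlg E) :=
  scal sg * hodgeF g * lefF g * hodgeF g

theorem sg_scal_mul_self {V : ℕ → Type*} [∀ k, AddCommGroup (V k)] [∀ k, Module ℝ (V k)] :
    (scal sg * scal sg : Module.End ℝ (DSum V)) = 1 := by
  rw [scal_mul_scal, ← scal_one]; exact scal_congr fun k => sg_mul_self _

theorem HasDegree.sg_mul {j : ℤ} {P : Module.End ℝ (FormAlg E)} (hP : HasDegree (formGrade E) j P) :
    scal sg * P = sg j • (P * scal sg) := by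
  rw [hP.scal_mul]
  refine ext_intGrade fun i a ha => ?_
  rw [Module.End.mul_apply, LinearMap.smul_apply, Module.End.mul_apply, scal_of_mem _ ha,
    scal_of_mem _ ha, map_smul, map_smul, smul_smul, sg_add, mul_comm]

theorem sg_mul_intProd (v : E) :
    scal sg * intProd v = -(intProd v * scal sg : Module.End ℝ (FormAlg E)) := by
  rw [(hasDegree_intProd v).sg_mul, sg_neg, sg_one, neg_one_smul]

theorem hodgeF_mul_flatMul_mul_hodgeF (hg : IsHermInner g) (v : E) :
    hodgeF g * flatMul g v * hodgeF g = intProd v := by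
  rw [hodgeF_flatMul hg, mul_assoc _ (scal sg), ← hodgeF_mul_sg, ← mul_assoc,
    mul_assoc (intProd v), hodgeF_hodgeF hg, mul_assoc, sg_scal_mul_self, mul_one]

/-- Insert ⋆(-1)^k⋆ = 1 between the two factors of each term of L: each ⋆ v♭ ⋆ becomes a
contraction, and the sign left over reverses the order of the two. Thus the definition through ⋆,
which preserves smoothness, agrees with the adjoint. -/
theorem lamF_eq (hg : IsHermInner g) : lamF g =
    (1 / 2 : ℝ) • ∑ i, intProd (Complex.I • realBasis E i) * intProd (dualBasisAt g i) := by
  have h : ∀ v w : E, scal sg * hodgeF g * (flatMul g v * flatMul g w) * hodgeF g =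
      intProd w * intProd v := fun v w => by
    have h1 : hodgeF g * scal sg * hodgeF g = 1 := by
      rw [mul_assoc, ← hodgeF_mul_sg, ← mul_assoc, hodgeF_hodgeF hg, sg_scal_mul_self]
    calc scal sg * hodgeF g * (flatMul g v * flatMul g w) * hodgeF g
        = scal sg * (hodgeF g * flatMul g v * 1 * flatMul g w * hodgeF g) := by
          simp only [mul_assoc, one_mul]
      _ = scal sg * (hodgeF g * flatMul g v * hodgeF g * scal sg * (hodgeF g * flatMul g w *
          hodgeF g)) := by rw [← h1]; simp only [mul_assoc]
      _ = -(intProd v * intProd w) := by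
        rw [hodgeF_mul_flatMul_mul_hodgeF hg, hodgeF_mul_flatMul_mul_hodgeF hg, ← mul_assoc,
          ← mul_assoc, sg_mul_intProd, neg_mul, neg_mul, mul_assoc (intProd v), sg_scal_mul_self,
          mul_one]
      _ = intProd w * intProd v := (intProd_anticomm w v).symm
  rw [lamF, lefF, mul_smul_comm, smul_mul_assoc, Finset.mul_sum, Finset.sum_mul]
  simp only [h]

theorem hasDegree_lamF (hg : IsHermInner g) : HasDegree (formGrade E) (-2) (lamF g) := by
  rw [lamF_eq hg]
  exact (HasDegree.sum _ fun _ _ => (hasDegree_intProd _).mul (hasDegree_intProd _)).smul _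

/-- The adjoint counterpart of `lefF_mul_intProd`. Together they say that v♭ and the contraction
with Jv form an sl₂-doublet. -/
theorem lamF_mul_flatMul (hg : IsHermInner g) (v : E) :
    lamF g * flatMul g v - flatMul g v * lamF g = intProd (Complex.I • v) := by
  have h : ∀ a b : E, intProd a * intProd b * flatMul g v - flatMul g v * (intProd a * intProd b) =
      g v b • intProd a - g v a • intProd b := fun a b => by
    rw [mul_assoc, intProd_mul_flatMul, mul_sub, ← mul_assoc (intProd a), intProd_mul_flatMul,
      sub_mul, smul_mul_assoc, one_mul, mul_smul_comm, mul_one, ← mul_assoc]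
    abel
  rw [lamF_eq hg, smul_mul_assoc, mul_smul_comm, Finset.sum_mul, Finset.mul_sum, ← smul_sub,
    ← Finset.sum_sub_distrib]
  simp only [h]
  rw [Finset.sum_sub_distrib]
  have e : ∀ w, g v (Complex.I • w) = -g w (Complex.I • v) := fun w => by
    rw [hg.apply_I, hg.symm (Complex.I • v)]
  have h1 : ∑ i, g v (Complex.I • realBasis E i) • intProd (dualBasisAt g i) =
      -intProd (Complex.I • v) := by
    conv_rhs => rw [← sum_realBasis_smul hg (Complex.I • v)]
    simp only [map_sum, map_smul, e, neg_smul, Finset.sum_neg_distrib]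
  have h2 : ∑ i, g v (dualBasisAt g i) • intProd (Complex.I • realBasis E i) =
      intProd (Complex.I • v) := by
    conv_rhs => rw [← sum_dualBasisAt_smul hg v]
    simp only [Finset.smul_sum, map_sum, smul_comm Complex.I, map_smul, hg.symm v]
  rw [h1, h2]
  module

theorem lamF_mul_intProd (hg : IsHermInner g) (v : E) :
    lamF g * intProd v = intProd v * lamF g := by
  rw [lamF_eq hg, smul_mul_assoc, mul_smul_comm, Finset.sum_mul, Finset.mul_sum]
  congr 1
  refine Finset.sum_congr rfl fun i _ => ?_
  rw [mul_assoc, intProd_anticomm _ v, mul_neg, ← mul_assoc, intProd_anticomm _ v, neg_mul,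
    neg_neg, mul_assoc]

theorem isAdj_lefF (hg : IsHermInner g) : IsAdj g (lefF g) (lamF g) := by
  rw [lamF_eq hg]
  exact (IsAdj.sum _ fun i _ => (isAdj_flatMul hg _).mul (isAdj_flatMul hg _)).smul _

variable (E) in
/-- The operator `k - n` on forms of degree `k`, where `n` is the complex dimension. -/
def weightF : Module.End ℝ (FormAlg E) := scal fun k => k - Module.finrank ℂ E

theorem HasDegree.weightF_mul {j : ℤ} {P : Module.End ℝ (FormAlg E)}
    (hP : HasDegree (formGrade E) j P) : weightF E * P - P * weightF E = (j : ℝ) • P := by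
  rw [weightF, hP.scal_mul, ← mul_sub]
  refine ext_intGrade fun i a ha => ?_
  rw [Module.End.mul_apply, LinearMap.sub_apply, scal_of_mem _ ha, scal_of_mem _ ha, ← sub_smul,
    map_smul, LinearMap.smul_apply]
  congr 1
  push_cast
  ring

/-- The difference of the two sides commutes with every v♭, by the doublet relations, and kills 1;
operators with these properties vanish. -/
theorem lefF_lamF_comm (hg : IsHermInner g) : lefF g * lamF g - lamF g * lefF g = weightF E := by
  have h1 : lefF g * lamF g - lamF g * lefF g - weightF E = 0 := by
    refine formAlg_flat_ext hg ?_ (flatMul g) (fun v => ?_) (fun v => by rw [zero_mul, mul_zero])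
    · have e1 : lamF g (oneF E) = 0 :=
        formGrade_eq_zero (Or.inl (by norm_num)) (hasDegree_lamF hg 0 _ oneF_mem)
      have e2 : ∀ a b : E, lamF g (flatMul g a (flatMul g b (oneF E))) =
          g b (Complex.I • a) • oneF E := fun a b => by
        have h := fun v x => LinearMap.congr_fun (sub_eq_iff_eq_add.1 (lamF_mul_flatMul hg v)) x
        simp only [Module.End.mul_apply, LinearMap.add_apply] at h
        have h0 : ∀ v : E, intProd v (oneF E) = 0 := fun v => intProd_incF_zero _ _
        rw [h, h, e1, h0, intProd_flatMul, h0]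
        simp
      -- The sum has 2n terms equal to 1, and the factor 1/2 leaves the complex dimension.
      have e3 : lamF g (lefF g (oneF E)) = (Module.finrank ℂ E : ℝ) • oneF E := by
        rw [lefF, LinearMap.smul_apply, LinearMap.sum_apply, map_smul, map_sum]
        simp only [Module.End.mul_apply, e2, hg.herm, hg.symm (realBasis E _), dualBasisAt_apply hg,
          if_true, one_smul, Finset.sum_const, Finset.card_univ, Fintype.card_fin]
        rw [← Nat.cast_smul_eq_nsmul ℝ, smul_smul]
        congr 1
        push_cast
        ring
      simp only [LinearMap.sub_apply, Module.End.mul_apply, e1, e3, map_zero, weightF,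
        scal_of_mem _ oneF_mem, LinearMap.zero_apply]
      push_cast
      module
    · have a1 := lefF_mul_flatMul g v
      have a2 := sub_eq_iff_eq_add.1 (lamF_mul_flatMul hg v)
      have a3 := sub_eq_iff_eq_add.1 (lefF_mul_intProd hg (Complex.I • v))
      rw [smul_smul, Complex.I_mul_I, neg_one_smul, map_neg, neg_neg] at a3
      have a4 := sub_eq_iff_eq_add.1 (hasDegree_flatMul g v).weightF_mul
      rw [Int.cast_one, one_smul] at a4
      calc (lefF g * lamF g - lamF g * lefF g - weightF E) * flatMul g v
          = lefF g * (lamF g * flatMul g v) - lamF g * (lefF g * flatMul g v) -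
            weightF E * flatMul g v := by simp only [sub_mul, mul_assoc]
        _ = lefF g * (intProd (Complex.I • v) + flatMul g v * lamF g) - lamF g * (flatMul g v *
            lefF g) - (flatMul g v + flatMul g v * weightF E) := by rw [a1, a2, a4]
        _ = lefF g * intProd (Complex.I • v) + lefF g * flatMul g v * lamF g -
            lamF g * flatMul g v * lefF g - (flatMul g v + flatMul g v * weightF E) := by
            simp only [mul_add, mul_assoc]
        _ = flatMul g v + intProd (Complex.I • v) * lefF g + flatMul g v * lefF g * lamF g -
            (intProd (Complex.I • v) + flatMul g v * lamF g) * lefF g -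
            (flatMul g v + flatMul g v * weightF E) := by rw [a1, a2, a3]
        _ = flatMul g v * (lefF g * lamF g - lamF g * lefF g - weightF E) := by
            simp only [mul_sub, add_mul, mul_assoc]; abel
  exact sub_eq_zero.1 h1

/-- The power shifts degrees by more than the real dimension. The exponent does not depend on the
operator, hence not on the point of the manifold. -/
theorem isNilpotent_of_hasDegree {j : ℤ} (hj : j ≠ 0) {P : Module.End ℝ (FormAlg E)}
    (hP : HasDegree (formGrade E) j P) : P ^ (realDim E + 1) = 0 := by
  refine eq_zero_of_hasDegree ?_ (hP.pow (realDim E + 1))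
  rcases lt_or_gt_of_ne hj with h | h
  · left; push_cast; nlinarith
  · right; push_cast; nlinarith

theorem isNilTripleF (hg : IsHermInner g) : IsNilTriple (lefF g) (lamF g) (weightF E) where
  nilL := ⟨_, isNilpotent_of_hasDegree (by norm_num) (hasDegree_lefF g)⟩
  nilΛ := ⟨_, isNilpotent_of_hasDegree (by norm_num) (hasDegree_lamF hg)⟩
  comm := lefF_lamF_comm hg
  commL := by rw [(hasDegree_lefF g).weightF_mul]; norm_num
  commΛ := by rw [(hasDegree_lamF hg).weightF_mul]; norm_num

end Lefschetz

/-! ### The sign (-1)^{k(k+1)/2} as an operator. -/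

section Sign

/-- The sign `(-1) ^ (k (k + 1) / 2)`. -/
def triSg (k : ℤ) : ℝ := sg (k * (k + 1) / 2)

theorem triSg_succ (k : ℤ) : triSg (k + 1) = sg (k + 1) * triSg k := by
  rw [triSg, triSg, ← sg_add]
  congr 1
  rw [show (k + 1) * (k + 1 + 1) = k * (k + 1) + (k + 1) * 2 by ring,
    Int.add_mul_ediv_right _ _ (by norm_num)]
  ring

theorem triSg_add_two (k : ℤ) : triSg (k + 2) = -triSg k := by
  have h := sg_mul_self (k + 1)
  rw [show k + 2 = k + 1 + 1 by ring, triSg_succ, triSg_succ, sg_add (k + 1), sg_one]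
  linear_combination (-triSg k) * h

theorem triSg_zero : triSg 0 = 1 := by simp [triSg]

section
variable {V : ℕ → Type*} [∀ k, AddCommGroup (V k)] [∀ k, Module ℝ (V k)] {P : Module.End ℝ (DSum V)}

variable (V) in
/-- The operator `(-1) ^ (k (k + 1) / 2)` on the summand of degree `k`. -/
def triOp : Module.End ℝ (DSum V) := scal triSg

theorem triOp_mul_self : triOp V * triOp V = 1 := by
  rw [triOp, scal_mul_scal, ← scal_one]; exact scal_congr fun k => sg_mul_self _

/-- The degree-dependent sign created here is the one in `hodgeF_flatMul`; the two cancel when ⋆ is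
compared with W. -/
theorem triOp_mul_of_odd (hP : HasDegree (intGrade V) 1 P) :
    triOp V * P = -(P * scal sg * triOp V) := by
  rw [triOp, hP.scal_mul, mul_assoc, scal_mul_scal, ← mul_neg, ← scal_neg]
  congr 1
  exact scal_congr fun k => by rw [triSg_succ, sg_add, sg_one]; ring

theorem triOp_carries_of_two (hP : HasDegree (intGrade V) 2 P) : Carries (triOp V) P (-P) := by
  rw [Carries, triOp, hP.scal_mul, neg_mul, ← mul_neg, ← scal_neg]
  congr 1
  exact scal_congr fun k => triSg_add_two k

theorem triOp_carries_of_neg_two (hP : HasDegree (intGrade V) (-2) P) :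
    Carries (triOp V) P (-P) := by
  rw [Carries, triOp, hP.scal_mul, neg_mul, ← mul_neg, ← scal_neg]
  congr 1
  exact scal_congr fun k => by
    have := triSg_add_two ((k : ℤ) + -2)
    rw [show (k : ℤ) + -2 + 2 = k by ring] at this
    rw [this, neg_neg]

/-- Operators of degree ±2 change sign under this conjugation, so all the exponents in W are
negated. -/
theorem triOp_carries_weyl {L Λ H : Module.End ℝ (DSum V)} (t : IsNilTriple L Λ H)
    (hL : HasDegree (intGrade V) 2 L) (hΛ : HasDegree (intGrade V) (-2) Λ) :
    Carries (triOp V) (weyl L Λ) (weylInv L Λ) := by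
  have h1 := (triOp_carries_of_two hL).nexp t.nilL t.nilL.neg
  have h2 := (triOp_carries_of_neg_two hΛ).neg.nexp t.nilΛ.neg t.nilΛ.neg.neg
  rw [neg_neg] at h2
  exact (h1.mul h2).mul h1

end
end Sign

/-! ### Operators that commute with the triple. -/

section Weyl
variable {A : Type*} [Ring A] [Algebra ℝ A] {L Λ H : A}

theorem IsNilTriple.carries_weyl (t : IsNilTriple L Λ H) {w : A} (hL : Carries w L L)
    (hΛ : Carries w Λ Λ) : Carries w (weyl L Λ) (weyl L Λ) :=
  ((hL.nexp t.nilL t.nilL).mul (hΛ.neg.nexp t.nilΛ.neg t.nilΛ.neg)).mul (hL.nexp t.nilL t.nilL)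

theorem IsNilTriple.carries_weylInv (t : IsNilTriple L Λ H) {w : A} (hL : Carries w L L)
    (hΛ : Carries w Λ Λ) : Carries w (weylInv L Λ) (weylInv L Λ) :=
  ((hL.neg.nexp t.nilL.neg t.nilL.neg).mul (hΛ.nexp t.nilΛ t.nilΛ)).mul
    (hL.neg.nexp t.nilL.neg t.nilL.neg)

end Weyl

/-! ### The complex structure, and the Hodge star in terms of the Weyl element. -/

section Complex
variable {E : Type*} [NormedAddCommGroup E] [NormedSpace ℂ E]

/-- The action of `z` on forms. -/
def actF (z : ℂ) : Module.End ℝ (FormAlg E) := pullF (mulMap z)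

theorem actF_mul (z w : ℂ) : (actF z * actF w : Module.End ℝ (FormAlg E)) = actF (z * w) := by
  rw [actF, actF, pullF_mul_pullF, actF]
  congr 1
  ext v
  show w • z • v = (z * w) • v
  rw [smul_smul, mul_comm]

theorem actF_one : (actF 1 : Module.End ℝ (FormAlg E)) = 1 := by
  rw [actF, ← pullF_id]
  congr 1
  ext v
  exact one_smul ℂ v

theorem actF_inv_mul : (actF Complex.I⁻¹ * actF Complex.I : Module.End ℝ (FormAlg E)) = 1 := by
  rw [actF_mul, inv_mul_cancel₀ Complex.I_ne_zero, actF_one]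

theorem actF_mul_inv : (actF Complex.I * actF Complex.I⁻¹ : Module.End ℝ (FormAlg E)) = 1 := by
  rw [actF_mul, mul_inv_cancel₀ Complex.I_ne_zero, actF_one]

theorem actF_neg_one : (actF (-1) : Module.End ℝ (FormAlg E)) = scal sg := by
  refine formAlg_ext fun k α => ?_
  rw [actF, pullF_incF, scal_incF, ← map_smul, sg_natCast]
  congr 1
  ext u
  have h := α.toMultilinearMap.map_smul_univ (fun _ => (-1 : ℝ)) u
  simp only [Finset.prod_const, Finset.card_univ, Fintype.card_fin] at h
  refine Eq.trans ?_ h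
  show α (fun i => (-1 : ℂ) • u i) = α (fun i => (-1 : ℝ) • u i)
  simp only [neg_one_smul]

theorem actF_mul_actF_I : (actF Complex.I * actF Complex.I : Module.End ℝ (FormAlg E)) = scal sg := by
  rw [actF_mul, Complex.I_mul_I, actF_neg_one]

theorem hasDegree_actF (z : ℂ) : HasDegree (formGrade E) 0 (actF z) := hasDegree_pullF _

theorem actF_inv_carries_intProd (v : E) :
    Carries (actF Complex.I⁻¹) (intProd v) (intProd (Complex.I • v)) := by
  rw [Carries, actF, intProd_pullF]
  congr 2
  show v = Complex.I⁻¹ • Complex.I • v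
  rw [smul_smul, inv_mul_cancel₀ Complex.I_ne_zero, one_smul]

variable [FiniteDimensional ℂ E] {g : E →L[ℝ] E →L[ℝ] ℝ}

theorem actF_inv_carries_flatMul (hg : IsHermInner g) (v : E) :
    Carries (actF Complex.I⁻¹) (flatMul g v) (flatMul g (Complex.I • v)) := by
  rw [Carries, actF, flatMul_eq, pullF_extMul, flatMul_eq]
  congr 2
  ext w
  show g v (Complex.I⁻¹ • w) = g (Complex.I • v) w
  rw [Complex.inv_I, neg_smul, map_neg, hg.apply_I, neg_neg]

/-- Replacing the basis vectors by their images under J, and using J² = -1, merely exchanges a basis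
with its dual in the sum defining L, by symmetry of the contraction. -/
theorem actF_inv_carries_lefF (hg : IsHermInner g) :
    Carries (actF Complex.I⁻¹) (lefF g) (lefF g) := by
  refine Carries.congr ((Carries.sum _ fun i _ => (actF_inv_carries_flatMul hg _).mul
    (actF_inv_carries_flatMul hg _)).smul _) ?_
  rw [lefF]
  congr 1
  let B : E →ₗ[ℝ] E →ₗ[ℝ] Module.End ℝ (FormAlg E) := LinearMap.mk₂ ℝ
    (fun v w => flatMul g v * flatMul g (Complex.I • w))
    (by intros; simp only [map_add, add_mul]) (by intros; simp only [map_smul, smul_mul_assoc])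
    (by intros; simp only [smul_add, map_add, mul_add])
    (by intro c v w; rw [smul_comm Complex.I c w, map_smul, mul_smul_comm])
  refine Eq.trans (Finset.sum_congr rfl fun i _ => ?_) (sum_bilin_dualBasis hg B)
  rw [smul_smul, Complex.I_mul_I, neg_one_smul, map_neg, mul_neg, flatMul_anticomm, neg_neg]
  rfl

theorem actF_inv_carries_lamF (hg : IsHermInner g) :
    Carries (actF Complex.I⁻¹) (lamF g) (lamF g) := by
  rw [lamF_eq hg]
  refine Carries.congr ((Carries.sum _ fun i _ => (actF_inv_carries_intProd _).mul
    (actF_inv_carries_intProd _)).smul _) ?_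
  refine congrArg (fun z : Module.End ℝ (FormAlg E) => (1 / 2 : ℝ) • z) ?_
  let B : E →ₗ[ℝ] E →ₗ[ℝ] Module.End ℝ (FormAlg E) := LinearMap.mk₂ ℝ
    (fun v w => intProd (Complex.I • v) * intProd w)
    (by intros; simp only [smul_add, map_add, add_mul])
    (by intro c v w; rw [smul_comm Complex.I c v, map_smul, smul_mul_assoc])
    (by intros; simp only [map_add, mul_add]) (by intros; simp only [map_smul, mul_smul_comm])
  refine Eq.trans (Finset.sum_congr rfl fun i _ => ?_) (sum_bilin_dualBasis hg B).symm
  rw [smul_smul, Complex.I_mul_I, neg_one_smul, map_neg, neg_mul, intProd_anticomm, neg_neg]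
  rfl

theorem actF_carries_lefF (hg : IsHermInner g) : Carries (actF Complex.I) (lefF g) (lefF g) :=
  (actF_inv_carries_lefF hg).symm actF_mul_inv actF_inv_mul

theorem actF_carries_lamF (hg : IsHermInner g) : Carries (actF Complex.I) (lamF g) (lamF g) :=
  (actF_inv_carries_lamF hg).symm actF_mul_inv actF_inv_mul

/-- The Weyl element on `FormAlg E`. -/
abbrev weylF (g : E →L[ℝ] E →L[ℝ] ℝ) : Module.End ℝ (FormAlg E) := weyl (lefF g) (lamF g)

/-- The inverse of the Weyl element on `FormAlg E`. -/
abbrev weylInvF (g : E →L[ℝ] E →L[ℝ] ℝ) : Module.End ℝ (FormAlg E) := weylInv (lefF g) (lamF g)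

/-- The pair formed by v♭ and the contraction with Jv is a doublet for (L, Λ), with v♭ of highest
weight. -/
theorem weylF_carries_flatMul (hg : IsHermInner g) (v : E) :
    Carries (weylF g) (flatMul g v) (-intProd (Complex.I • v)) := by
  refine (weyl_carries_doublet (isNilTripleF hg).nilL (isNilTripleF hg).nilΛ ?_
    (lamF_mul_flatMul hg v) ?_ ?_).1
  · rw [lefF_mul_flatMul, sub_self]
  · rw [lefF_mul_intProd hg, smul_smul, Complex.I_mul_I, neg_one_smul, map_neg, neg_neg]
  · rw [lamF_mul_intProd hg, sub_self]

/-- The Hodge star operator is, up to sign, `W J (-1) ^ (k (k + 1) / 2)`. -/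
theorem hodgeF_eq (hg : IsHermInner g) : ∃ f : ℝ, (f * f) • oneF E = oneF E ∧
    hodgeF g * (triOp (AltForm E) * actF Complex.I⁻¹ * weylInvF g) = f • 1 := by
  have t := isNilTripleF hg
  -- X obeys the same commutation rule with v♭ as W, so W⁻¹X commutes with all linear forms and is
  -- determined by its value at 1.
  obtain ⟨X, hX⟩ : ∃ X, X = hodgeF g * triOp (AltForm E) * actF Complex.I⁻¹ := ⟨_, rfl⟩
  have hXv : ∀ v, Carries X (flatMul g v) (-intProd (Complex.I • v)) := fun v => by
    have h1 := (actF_inv_carries_flatMul hg v).eq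
    have h2 := triOp_mul_of_odd (hasDegree_flatMul g (Complex.I • v))
    have h3 := hodgeF_flatMul hg (Complex.I • v)
    calc X * flatMul g v = hodgeF g * (triOp (AltForm E) * (actF Complex.I⁻¹ * flatMul g v)) := by
          rw [hX]; simp only [mul_assoc]
      _ = -((hodgeF g * flatMul g (Complex.I • v)) * scal sg * triOp (AltForm E) *
          actF Complex.I⁻¹) := by
          rw [h1, ← mul_assoc (triOp _), h2]; simp only [mul_assoc, neg_mul, mul_neg]
      _ = -intProd (Complex.I • v) * X := by
          rw [h3, hX, mul_assoc (intProd _ * hodgeF g) (scal sg) (scal sg), sg_scal_mul_self, mul_one]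
          simp only [mul_assoc, neg_mul]
  have hZv : ∀ v, Carries (weylInvF g * X) (flatMul g v) (flatMul g v) := fun v =>
    (hXv v).trans ((weylF_carries_flatMul hg v).symm t.weylInv_mul t.weyl_mul_inv)
  have hX1 : X (oneF E) = hodgeF g (oneF E) := by
    have h1 : actF Complex.I⁻¹ (oneF E) = oneF E := pullF_oneF _
    rw [hX, Module.End.mul_apply, Module.End.mul_apply, h1, triOp, scal_of_mem _ oneF_mem,
      triSg_zero, one_smul]
  -- ⋆1 has top degree, that is weight n. W⁻¹ negates weights, so the image of 1 has weight -n and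
  -- therefore degree 0.
  have hZ1 : (weylInvF g * X) (oneF E) ∈ formGrade E (0 : ℕ) := by
    refine mem_intGrade_of_scal (c := fun k => (k : ℝ) - Module.finrank ℂ E)
      (fun a b h => by simpa using h) ?_
    have h1 := LinearMap.congr_fun (t.weyl_carries_self.2.2.symm t.weylInv_mul t.weyl_mul_inv)
      (X (oneF E))
    have h2 : weightF E (X (oneF E)) = (Module.finrank ℂ E : ℝ) • X (oneF E) := by
      rw [hX1, weightF, scal_of_mem _ (hodgeF_mem g oneF_mem)]
      congr 1
      push_cast
      ring
    simp only [Module.End.mul_apply, LinearMap.neg_apply, h2, map_neg, map_smul] at h1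
    show weightF E (weylInvF g (X (oneF E))) = _
    rw [← h1, ← neg_smul]
    simp
  obtain ⟨α, hα⟩ : ∃ α, incF E 0 α = (weylInvF g * X) (oneF E) := hZ1
  rw [incF_zero_eq] at hα
  obtain ⟨f, hf⟩ : ∃ f, f = α ![] := ⟨_, rfl⟩
  rw [← hf] at hα
  have hZ : weylInvF g * X = f • 1 :=
    formAlg_flat_ext hg hα.symm (flatMul g) hZv fun v => by
      rw [smul_mul_assoc, mul_smul_comm, one_mul, mul_one]
  have hXW : X = f • weylF g := by
    have := congrArg (fun Y => weylF g * Y) hZ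
    simp only [← mul_assoc, t.weyl_mul_inv, one_mul, mul_smul_comm, mul_one] at this
    exact this
  have hH : hodgeF g = f • (weylF g * actF Complex.I * triOp (AltForm E)) := by
    have h1 : X * actF Complex.I * triOp (AltForm E) = hodgeF g := by
      rw [hX, mul_assoc _ (actF Complex.I⁻¹) (actF Complex.I), actF_inv_mul, mul_one, mul_assoc, triOp_mul_self, mul_one]
    rw [← h1, hXW]
    simp only [smul_mul_assoc]
  refine ⟨f, ?_, ?_⟩
  -- Squaring f W J S: S turns W into W⁻¹, J commutes with both, S² = 1 and J² = (-1)^k. Comparison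
  -- with ⋆² = (-1)^k at the unit gives the relation for f².
  · have hS := (triOp_carries_weyl t (hasDegree_lefF g) (hasDegree_lamF hg)).eq
    have hJ := (t.carries_weylInv (actF_carries_lefF hg) (actF_carries_lamF hg)).eq
    have hJS : triOp (AltForm E) * actF Complex.I = actF Complex.I * triOp (AltForm E) := by
      rw [triOp, (hasDegree_actF _).scal_mul]; simp
    have h : weylF g * actF Complex.I * triOp (AltForm E) *
        (weylF g * actF Complex.I * triOp (AltForm E)) = scal sg := by
      calc weylF g * actF Complex.I * triOp (AltForm E) *
            (weylF g * actF Complex.I * triOp (AltForm E))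
          = weylF g * actF Complex.I * (triOp (AltForm E) * weylF g) * actF Complex.I *
            triOp (AltForm E) := by simp only [mul_assoc]
        _ = weylF g * (actF Complex.I * weylInvF g) * (triOp (AltForm E) * actF Complex.I) *
            triOp (AltForm E) := by rw [hS]; simp only [mul_assoc]
        _ = weylF g * weylInvF g * (actF Complex.I * actF Complex.I) *
            (triOp (AltForm E) * triOp (AltForm E)) := by rw [hJ, hJS]; simp only [mul_assoc]
        _ = scal sg := by
          rw [t.weyl_mul_inv, triOp_mul_self, actF_mul_actF_I, one_mul, mul_one]
    have h1 := hodgeF_hodgeF hg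
    rw [hH, smul_mul_assoc, mul_smul_comm, smul_smul, h] at h1
    have h2 := LinearMap.congr_fun h1 (oneF E)
    rw [LinearMap.smul_apply, scal_of_mem _ oneF_mem, sg_zero, one_smul] at h2
    exact h2
  · have h1 : hodgeF g * (triOp (AltForm E) * actF Complex.I⁻¹ * weylInvF g) = X * weylInvF g := by
      rw [hX]; simp only [mul_assoc]
    rw [h1, hXW, smul_mul_assoc, t.weyl_mul_inv]

/-- Adjoints of multiplication operators. -/
theorem isAdj_twist_wedgeF (hg : IsHermInner g) (b : FormAlg E) :
    IsAdj g (actF Complex.I⁻¹ * wedgeF E b * actF Complex.I)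
      (weylF g * wedgeF E (triOp (AltForm E) b) * weylInvF g) := by
  have t := isNilTripleF hg
  let S : Submodule ℝ (FormAlg E) :=
    { carrier := {b | IsAdj g (actF Complex.I⁻¹ * wedgeF E b * actF Complex.I)
        (weylF g * wedgeF E (triOp (AltForm E) b) * weylInvF g)}
      zero_mem' := by
        have : IsAdj g 0 0 := fun a b => by simp
        simpa using this
      add_mem' := fun ha hb => by
        have := IsAdj.add ha hb
        simp only [Set.mem_ofPred_eq, map_add, mul_add, add_mul]
        exact this
      smul_mem' := fun c a ha => by
        have := IsAdj.smul c ha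
        simp only [Set.mem_ofPred_eq, map_smul, mul_smul_comm, smul_mul_assoc]
        exact this }
  refine formAlg_generation (S := S) ?_ (fun a b hb => ?_) b
  · show IsAdj g _ _
    have h1 : wedgeF E (oneF E) = 1 := LinearMap.ext one_wedgeF
    rw [triOp, scal_of_mem _ oneF_mem, triSg_zero, one_smul, h1, mul_one, mul_one, actF_inv_mul,
      t.weyl_mul_inv]
    exact IsAdj.one
  -- Multiplying b by v♭ puts (Jv)♭ to the left of the first operator and its adjoint, the
  -- contraction with Jv, to the right of the second. The sign of `triOp` accounts for this reversal
  -- of order.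
  · obtain ⟨v, rfl⟩ := exists_flat hg a
    have h1 : actF Complex.I⁻¹ * wedgeF E (extMul (g v) b) * actF Complex.I =
        flatMul g (Complex.I • v) * (actF Complex.I⁻¹ * wedgeF E b * actF Complex.I) := by
      rw [wedgeF_extMul, ← flatMul_eq, ← mul_assoc, (actF_inv_carries_flatMul hg v).eq]
      simp only [mul_assoc]
    have h2 : triOp (AltForm E) (extMul (g v) b) =
        -extMul (g v) (scal sg (triOp (AltForm E) b)) :=
      LinearMap.congr_fun (triOp_mul_of_odd (hasDegree_flatMul g v)) b
    have h3 : ∀ c, wedgeF E c * flatMul g v = flatMul g v * wedgeF E (scal sg c) := fun c =>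
      LinearMap.ext fun x => by
        rw [Module.End.mul_apply, Module.End.mul_apply, flatMul_eq, extMul_eq, ← wedgeF_assoc,
          ← wedgeF_assoc, wedgeF_oneForm_right]
        rfl
    have h4 := ((weylF_carries_flatMul hg v).symm t.weylInv_mul t.weyl_mul_inv).neg.eq
    rw [neg_neg] at h4
    have h5 : weylF g * wedgeF E (triOp (AltForm E) (extMul (g v) b)) * weylInvF g =
        weylF g * wedgeF E (triOp (AltForm E) b) * weylInvF g * intProd (Complex.I • v) := by
      rw [mul_assoc _ (weylInvF g), h4, h2, map_neg, wedgeF_extMul, ← flatMul_eq, ← h3]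
      simp only [mul_assoc, mul_neg, neg_mul]
    show IsAdj g _ _
    rw [h1, h5]
    exact (isAdj_flatMul hg _).mul hb

end Complex

/-! ### Algebraic orders of operators on a graded commutative algebra. -/

section Order
variable {K A : Type*} [Field K] [AddCommGroup A] [Module K A] {𝒜 : ℤ → Submodule K A}
  {μ : A →ₗ[K] A →ₗ[K] A} {one : A}

/-- `(A, mul, one)` is a unital graded commutative algebra. -/
structure IsGradedCommAlg (𝒜 : ℤ → Submodule K A) (mul : A →ₗ[K] A →ₗ[K] A) (one : A) : Prop where
  one_mem : one ∈ 𝒜 0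
  mul_mem : ∀ (i j : ℤ), ∀ a ∈ 𝒜 i, ∀ b ∈ 𝒜 j, mul a b ∈ 𝒜 (i + j)
  one_mul : ∀ a, mul one a = a
  mul_one : ∀ a, mul a one = a
  mul_assoc : ∀ a b c, mul (mul a b) c = mul a (mul b c)
  mul_comm : ∀ (i j : ℤ), ∀ a ∈ 𝒜 i, ∀ b ∈ 𝒜 j, mul a b = (i * j).negOnePow • mul b a
  span : ∀ {S : Submodule K A}, (∀ j, 𝒜 j ≤ S) → S = ⊤

theorem gradedComm_jacobi (i j k : ℤ) (f g h : Module.End K A) :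
    gradedComm i (j + k) f (gradedComm j k g h) =
      gradedComm (i + j) k (gradedComm i j f g) h +
        (i * j).negOnePow • gradedComm j (i + k) g (gradedComm i k f h) := by
  simp only [gradedComm, mul_add, add_mul, Int.negOnePow_add, mul_comm j i]
  rcases Int.units_eq_one_or (i * j).negOnePow with h1 | h1 <;>
  rcases Int.units_eq_one_or (i * k).negOnePow with h2 | h2 <;>
  rcases Int.units_eq_one_or (j * k).negOnePow with h3 | h3 <;>
  simp only [h1, h2, h3, one_smul, mul_one, Units.neg_smul, mul_neg, neg_neg] <;>
  noncomm_ring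

/-- The graded commutator is a graded derivation of the composition product; the bound for the order
of a product follows by induction. -/
theorem gradedComm_mul (i j k : ℤ) (f g h : Module.End K A) :
    gradedComm i (j + k) f (g * h) =
      gradedComm i j f g * h + (i * j).negOnePow • (g * gradedComm i k f h) := by
  simp only [gradedComm, mul_add, Int.negOnePow_add]
  rcases Int.units_eq_one_or (i * j).negOnePow with h1 | h1 <;>
  rcases Int.units_eq_one_or (i * k).negOnePow with h2 | h2 <;>
  simp only [h1, h2, one_smul, mul_one, Units.neg_smul, mul_neg, neg_neg] <;>
  noncomm_ring

theorem gradedComm_add (i j : ℤ) (f g h : Module.End K A) :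
    gradedComm i j f (g + h) = gradedComm i j f g + gradedComm i j f h := by
  simp only [gradedComm, mul_add, add_mul, smul_add]; abel

theorem gradedComm_zero (i j : ℤ) (f : Module.End K A) : gradedComm i j f 0 = 0 := by
  simp [gradedComm]

theorem zero_gradedComm (i j : ℤ) (f : Module.End K A) : gradedComm i j 0 f = 0 := by
  simp [gradedComm]

theorem gradedComm_smul (i j : ℤ) (c : K) (f g : Module.End K A) :
    gradedComm i j f (c • g) = c • gradedComm i j f g := by
  rw [gradedComm, gradedComm, mul_smul_comm, smul_mul_assoc, smul_sub, smul_comm c]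

namespace HasOrderLE
variable {f f' : Module.End K A} {r s : ℕ} {i j : ℤ}

theorem congr (h : HasOrderLE 𝒜 μ r i f) (hij : i = j) : HasOrderLE 𝒜 μ r j f := hij ▸ h

theorem hasDegree (h : HasOrderLE 𝒜 μ r i f) : HasDegree 𝒜 i f := by
  cases r with
  | zero => exact h.1
  | succ r => exact h.1

theorem zero : HasOrderLE 𝒜 μ r i 0 := by
  induction r generalizing i with
  | zero => exact ⟨HasDegree.zero, fun j a _ => gradedComm_zero _ _ _⟩
  | succ r ih => exact ⟨HasDegree.zero, fun j a _ => by rw [gradedComm_zero]; exact ih⟩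

theorem add (h : HasOrderLE 𝒜 μ r i f) (h' : HasOrderLE 𝒜 μ r i f') :
    HasOrderLE 𝒜 μ r i (f + f') := by
  induction r generalizing i f f' with
  | zero => exact ⟨h.1.add h'.1, fun j a ha => by rw [gradedComm_add, h.2 j a ha, h'.2 j a ha, add_zero]⟩
  | succ r ih =>
    exact ⟨h.1.add h'.1, fun j a ha => by rw [gradedComm_add]; exact ih (h.2 j a ha) (h'.2 j a ha)⟩

theorem smul (c : K) (h : HasOrderLE 𝒜 μ r i f) : HasOrderLE 𝒜 μ r i (c • f) := by
  induction r generalizing i f with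
  | zero => exact ⟨h.1.smul c, fun j a ha => by rw [gradedComm_smul, h.2 j a ha, smul_zero]⟩
  | succ r ih => exact ⟨h.1.smul c, fun j a ha => by rw [gradedComm_smul]; exact ih (h.2 j a ha)⟩

theorem neg (h : HasOrderLE 𝒜 μ r i f) : HasOrderLE 𝒜 μ r i (-f) := by
  rw [← neg_one_smul K]; exact h.smul _

theorem units_smul (c : ℤˣ) (h : HasOrderLE 𝒜 μ r i f) : HasOrderLE 𝒜 μ r i (c • f) := by
  rcases Int.units_eq_one_or c with rfl | rfl
  · rwa [one_smul]
  · rw [Units.neg_smul, one_smul]; exact h.neg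

theorem sum {ι : Type*} (t : Finset ι) {F : ι → Module.End K A}
    (h : ∀ l ∈ t, HasOrderLE 𝒜 μ r i (F l)) : HasOrderLE 𝒜 μ r i (∑ l ∈ t, F l) := by
  classical
  induction t using Finset.induction_on with
  | empty => exact zero
  | insert a t ha ih =>
    rw [Finset.sum_insert ha]
    exact (h a (Finset.mem_insert_self _ _)).add (ih fun l hl => h l (Finset.mem_insert_of_mem hl))

theorem mul (h : HasOrderLE 𝒜 μ r i f) (h' : HasOrderLE 𝒜 μ s j f') :
    HasOrderLE 𝒜 μ (r + s) (i + j) (f * f') := by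
  obtain ⟨n, hn⟩ : ∃ n, n = r + s := ⟨_, rfl⟩
  induction n generalizing r s i j f f' with
  | zero =>
    obtain rfl : r = 0 := by omega
    obtain rfl : s = 0 := by omega
    exact ⟨h.1.mul h'.1, fun k a ha => by
      rw [gradedComm_mul, h.2 k a ha, h'.2 k a ha, zero_mul, mul_zero, smul_zero, add_zero]⟩
  | succ n ih =>
    rw [← hn]
    refine ⟨h.hasDegree.mul h'.hasDegree, fun k a ha => ?_⟩
    rw [gradedComm_mul]
    refine add ?_ (units_smul _ ?_)
    · cases r with
      | zero => rw [h.2 k a ha, zero_mul]; exact zero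
      | succ r =>
        have := ih (h.2 k a ha) h' (by omega)
        rw [show r + s = n by omega] at this
        exact this.congr (by ring)
    · cases s with
      | zero => rw [h'.2 k a ha, mul_zero]; exact zero
      | succ s =>
        have := ih h (h'.2 k a ha) (by omega)
        rw [show r + s = n by omega] at this
        exact this.congr (by ring)

end HasOrderLE

namespace IsGradedCommAlg

theorem ext (hA : IsGradedCommAlg 𝒜 μ one) {W : Type*} [AddCommGroup W] [Module K W]
    {f f' : A →ₗ[K] W} (h : ∀ j, ∀ a ∈ 𝒜 j, f a = f' a) : f = f' := by
  have h1 := hA.span (S := LinearMap.eqLocus f f') h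
  exact LinearMap.ext fun a => (h1 ▸ Submodule.mem_top : a ∈ LinearMap.eqLocus f f')

theorem hasOrderLE_mul (hA : IsGradedCommAlg 𝒜 μ one) {j : ℤ} {a : A} (ha : a ∈ 𝒜 j) :
    HasOrderLE 𝒜 μ 0 j (μ a) := by
  refine ⟨fun i b hb => by rw [add_comm]; exact hA.mul_mem j i a ha b hb, fun i b hb => ?_⟩
  refine LinearMap.ext fun c => ?_
  have h := LinearMap.congr_fun (congrArg μ (hA.mul_comm i j b hb a ha)) c
  rw [Units.smul_def, ← Int.cast_smul_eq_zsmul K, map_smul, LinearMap.smul_apply] at h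
  simp only [gradedComm, LinearMap.sub_apply, Module.End.mul_apply, LinearMap.zero_apply]
  rw [← hA.mul_assoc, h, Units.smul_def, ← Int.cast_smul_eq_zsmul K, LinearMap.smul_apply,
    Module.End.mul_apply, hA.mul_assoc, sub_self]

/-- By linearity over the algebra, f(b) is up to sign b f(1); graded commutativity removes the sign.
-/
theorem eq_mul_of_order_zero (hA : IsGradedCommAlg 𝒜 μ one) {i : ℤ} {f : Module.End K A}
    (h : HasOrderLE 𝒜 μ 0 i f) : f = μ (f one) := by
  refine hA.ext fun j b hb => ?_
  have h1 := LinearMap.congr_fun (h.2 j b hb) one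
  have h2 : f one ∈ 𝒜 i := by simpa using h.1 0 one hA.one_mem
  simp only [gradedComm, LinearMap.sub_apply, Module.End.mul_apply, LinearMap.zero_apply,
    Units.smul_def, LinearMap.smul_apply, hA.mul_one] at h1
  rw [sub_eq_zero, hA.mul_comm j i b hb _ h2, ← Units.smul_def] at h1
  rcases Int.units_eq_one_or (j * i).negOnePow with h3 | h3 <;> rw [h3] at h1 <;> simpa using h1.symm

/-- The graded commutator of two operators of orders `r` and `s` has order `r + s - 1`. -/
theorem gradedComm_order (hA : IsGradedCommAlg 𝒜 μ one) {r s n : ℕ} {i j : ℤ}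
    {f f' : Module.End K A} (h : HasOrderLE 𝒜 μ r i f) (h' : HasOrderLE 𝒜 μ s j f')
    (hn : r + s = n + 1) : HasOrderLE 𝒜 μ n (i + j) (gradedComm i j f f') := by
  -- Two operators of order 0 are multiplications and commute in the graded sense. This settles the
  -- case in which the order would drop below zero.
  have base : ∀ {i j : ℤ} {f f' : Module.End K A}, HasOrderLE 𝒜 μ 0 i f →
      HasOrderLE 𝒜 μ 0 j f' → gradedComm i j f f' = 0 := fun {i j f f'} h h' => by
    have h2 : f one ∈ 𝒜 i := by simpa using h.1 0 one hA.one_mem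
    rw [hA.eq_mul_of_order_zero h]
    exact h'.2 i _ h2
  induction n generalizing r s i j f f' with
  | zero =>
    refine ⟨h.hasDegree.gradedComm h'.hasDegree, fun k a ha => ?_⟩
    rw [gradedComm_jacobi]
    rcases (by omega : (r = 0 ∧ s = 1) ∨ (r = 1 ∧ s = 0)) with ⟨rfl, rfl⟩ | ⟨rfl, rfl⟩
    · rw [h.2 k a ha, zero_gradedComm, base h (h'.2 k a ha), smul_zero, add_zero]
    · rw [h'.2 k a ha, gradedComm_zero, base (h.2 k a ha) h', smul_zero, add_zero]
  | succ n ih =>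
    refine ⟨h.hasDegree.gradedComm h'.hasDegree, fun k a ha => ?_⟩
    rw [gradedComm_jacobi]
    refine HasOrderLE.add ?_ (HasOrderLE.units_smul _ ?_)
    · cases r with
      | zero => rw [h.2 k a ha, zero_gradedComm]; exact HasOrderLE.zero
      | succ r => exact (ih (h.2 k a ha) h' (by omega)).congr (by ring)
    · cases s with
      | zero => rw [h'.2 k a ha, gradedComm_zero]; exact HasOrderLE.zero
      | succ s => exact (ih h (h'.2 k a ha) (by omega)).congr (by ring)

/-- Derivations have order one. -/
theorem order_of_derivation (hA : IsGradedCommAlg 𝒜 μ one) {d : Module.End K A}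
    (hd : HasDegree 𝒜 1 d) (h : ∀ i, ∀ a ∈ 𝒜 i, ∀ b, d (μ a b) = μ (d a) b + i.negOnePow • μ a (d b)) :
    HasOrderLE 𝒜 μ 1 1 d := by
  refine ⟨hd, fun j a ha => ?_⟩
  have : gradedComm j 1 (μ a) d = -(j.negOnePow • μ (d a)) := LinearMap.ext fun b => by
    simp only [gradedComm, LinearMap.sub_apply, Module.End.mul_apply, LinearMap.neg_apply,
      Units.smul_def, LinearMap.smul_apply]
    rw [h j a ha, ← Units.smul_def, ← Units.smul_def]
    rcases Int.units_eq_one_or j.negOnePow with h1 | h1 <;> simp [h1]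
  rw [this]
  exact ((hA.hasOrderLE_mul (hd j a ha)).units_smul _).neg

end IsGradedCommAlg
end Order

/-! ### Contractions have order one, and Λ has order two. -/

section FibreOrder
variable {E : Type*} [NormedAddCommGroup E] [NormedSpace ℂ E] [FiniteDimensional ℂ E]
  {g : E →L[ℝ] E →L[ℝ] ℝ}

theorem wedgeF_mem (i j : ℤ) (a : FormAlg E) (ha : a ∈ formGrade E i) (b : FormAlg E)
    (hb : b ∈ formGrade E j) : wedgeF E a b ∈ formGrade E (i + j) :=
  formGrade_cases (p := fun i a => wedgeF E a b ∈ formGrade E (i + j)) (fun i => by simp)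
    (fun k α => formGrade_cases (p := fun j b => wedgeF E (incF E k α) b ∈ formGrade E (k + j))
      (fun j => by simp) (fun l β => by
        rw [wedgeF_incF, ← Nat.cast_add]; exact incF_mem _ _) hb) ha

variable (E) in
theorem isGradedCommAlgF : IsGradedCommAlg (formGrade E) (wedgeF E) (oneF E) where
  one_mem := oneF_mem
  mul_mem := wedgeF_mem
  one_mul := one_wedgeF
  mul_one := wedgeF_one
  mul_assoc := wedgeF_assoc
  mul_comm i j a ha b hb := by rw [negOnePow_smul_eq, wedgeF_comm ha hb]
  span := intGrade_span

/-- The contraction is an antiderivation, so its commutator with a multiplication is, up to sign,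
multiplication by the contracted form. -/
theorem order_intProd (v : E) : HasOrderLE (formGrade E) (wedgeF E) 1 (-1) (intProd v) := by
  refine ⟨hasDegree_intProd v, fun j a ha => ?_⟩
  have : gradedComm j (-1) (wedgeF E a) (intProd v) = (-sg j) • wedgeF E (intProd v a) :=
    LinearMap.ext fun b => by
      simp only [gradedComm, negOnePow_smul_eq, LinearMap.sub_apply, Module.End.mul_apply,
        LinearMap.smul_apply, intProd_wedgeF, scal_of_mem _ ha, map_smul]
      rw [mul_neg_one, sg_neg, smul_add, smul_smul, sg_mul_self]
      module
  rw [this]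
  exact ((isGradedCommAlgF E).hasOrderLE_mul (hasDegree_intProd v j a ha)).smul _

theorem order_lamF (hg : IsHermInner g) : HasOrderLE (formGrade E) (wedgeF E) 2 (-2) (lamF g) := by
  rw [lamF_eq hg]
  exact (HasOrderLE.sum _ fun i _ => (order_intProd _).mul (order_intProd _)).smul _

end FibreOrder

/-! ### Passage from one tangent space to smooth forms on the manifold. -/

section Global
variable {E : Type*} [NormedAddCommGroup E] [NormedSpace ℂ E] {M : Type*} [TopologicalSpace M]
  [ChartedSpace E M] [IsManifold 𝓘(ℂ, E) ω M] [FiniteDimensional ℂ E]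

variable (E M) in
/-- The de Rham algebra. -/
abbrev Forms : Type _ := DSum (Form E M)

variable (E M) in
/-- The grading of the de Rham algebra. -/
abbrev formsGrade : ℤ → Submodule ℝ (Forms E M) := intGrade (Form E M)

/-- The value of a form at a point. -/
def evAt (x : M) : Forms E M →ₗ[ℝ] FormAlg E :=
  ofD fun k =>
    { toFun := fun α => incF E k (α.1 x)
      map_add' := fun α β => map_add (incF E k) (α.1 x) (β.1 x)
      map_smul' := fun c α => map_smul (incF E k) c (α.1 x) }

theorem evAt_lofD (x : M) (k : ℕ) (α : Form E M k) : evAt x (lofD k α) = incF E k (α.1 x) :=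
  ofD_lofD _ k α

theorem compD_evAt (x : M) (k : ℕ) (a : Forms E M) :
    compD (V := AltForm E) k (evAt x a) = (compD k a).1 x := by
  induction a using induction_lofD with
  | h0 => simp only [map_zero]; rfl
  | hadd a b ha hb => simp only [map_add, ha, hb]; rfl
  | h l α =>
    rw [evAt_lofD]
    by_cases h : k = l
    · subst h
      rw [compD_lofD]
      exact compD_lofD (V := AltForm E) k _
    · rw [compD_lofD_of_ne h]
      exact compD_lofD_of_ne (V := AltForm E) h _

theorem evAt_ext {a b : Forms E M} (h : ∀ x, evAt x a = evAt x b) : a = b :=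
  ext_compD fun k => Subtype.ext <| funext fun x => by rw [← compD_evAt, ← compD_evAt, h]

theorem evAt_mem (x : M) {j : ℤ} {a : Forms E M} (ha : a ∈ formsGrade E M j) :
    evAt x a ∈ formGrade E j :=
  intGrade_cases (p := fun j a => evAt x a ∈ formGrade E j) (fun j => by simp)
    (fun k α => by rw [evAt_lofD]; exact incF_mem _ _) ha

theorem mem_of_evAt {j : ℤ} {a : Forms E M} (h : ∀ x, evAt x a ∈ formGrade E j) :
    a ∈ formsGrade E M j := by
  have h1 : ∀ k : ℕ, (k : ℤ) ≠ j → compD k a = 0 := fun k hk =>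
    Subtype.ext <| funext fun x => by
      rw [← compD_evAt]
      exact compD_of_mem (h x) k hk
  cases j with
  | ofNat j => exact mem_intGrade_of_compD fun k hk => h1 k (by simpa using hk)
  | negSucc j => exact (Submodule.mem_bot ℝ).2 (ext_compD fun k => by
      rw [h1 k (by simp), map_zero])

/-- `P` acts at the point `x` by `p x`. -/
def Fibrewise (P : Module.End ℝ (Forms E M)) (p : M → Module.End ℝ (FormAlg E)) : Prop :=
  ∀ x a, evAt x (P a) = p x (evAt x a)

namespace Fibrewise
variable {P Q : Module.End ℝ (Forms E M)} {p q : M → Module.End ℝ (FormAlg E)}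

theorem ext (hP : Fibrewise P p) (hQ : Fibrewise Q q) (h : ∀ x, p x = q x) : P = Q :=
  LinearMap.ext fun a => evAt_ext fun x => by rw [hP, hQ, h]

theorem sub (hP : Fibrewise P p) (hQ : Fibrewise Q q) : Fibrewise (P - Q) fun x => p x - q x :=
  fun x a => by rw [LinearMap.sub_apply, map_sub, hP, hQ, LinearMap.sub_apply]

theorem neg (hP : Fibrewise P p) : Fibrewise (-P) fun x => -p x :=
  fun x a => by rw [LinearMap.neg_apply, map_neg, hP, LinearMap.neg_apply]

theorem smul (c : ℝ) (hP : Fibrewise P p) : Fibrewise (c • P) fun x => c • p x :=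
  fun x a => by rw [LinearMap.smul_apply, map_smul, hP, LinearMap.smul_apply]

theorem mul (hP : Fibrewise P p) (hQ : Fibrewise Q q) : Fibrewise (P * Q) fun x => p x * q x :=
  fun x a => by rw [Module.End.mul_apply, hP, hQ, Module.End.mul_apply]

theorem zero : Fibrewise (0 : Module.End ℝ (Forms E M)) fun _ => 0 := fun x a => by simp

theorem one : Fibrewise (1 : Module.End ℝ (Forms E M)) fun _ => 1 := fun _ _ => rfl

theorem pow (hP : Fibrewise P p) (n : ℕ) : Fibrewise (P ^ n) fun x => p x ^ n := by
  induction n with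
  | zero => simp only [pow_zero]; exact one
  | succ n ih => simp only [pow_succ]; exact ih.mul hP

theorem sum {ι : Type*} (s : Finset ι) {P : ι → Module.End ℝ (Forms E M)}
    {p : ι → M → Module.End ℝ (FormAlg E)} (h : ∀ i ∈ s, Fibrewise (P i) (p i)) :
    Fibrewise (∑ i ∈ s, P i) fun x => ∑ i ∈ s, p i x := fun x a => by
  rw [LinearMap.sum_apply, map_sum, LinearMap.sum_apply]
  exact Finset.sum_congr rfl fun i hi => h i hi x a

theorem units_smul (c : ℤˣ) (hP : Fibrewise P p) : Fibrewise (c • P) fun x => c • p x := by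
  rcases Int.units_eq_one_or c with rfl | rfl
  · simp only [one_smul]; exact hP
  · simp only [Units.neg_smul, one_smul]; exact hP.neg

theorem gradedComm (hP : Fibrewise P p) (hQ : Fibrewise Q q) (i j : ℤ) :
    Fibrewise (gradedComm i j P Q) fun x => HermitianBV.gradedComm i j (p x) (q x) :=
  (hP.mul hQ).sub ((hQ.mul hP).units_smul _)

theorem hasDegree (hP : Fibrewise P p) {j : ℤ} (h : ∀ x, HasDegree (formGrade E) j (p x)) :
    HasDegree (formsGrade E M) j P := fun k a ha => mem_of_evAt fun x => by
  rw [hP]; exact h x k _ (evAt_mem x ha)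

-- With a nilpotency bound uniform in the point, the exponential is the same finite sum everywhere.
theorem nexp {n : ℕ} (hP : Fibrewise P p) (hn : ∀ x, p x ^ n = 0) :
    Fibrewise (nexp P) fun x => HermitianBV.nexp (p x) := by
  have h1 : P ^ n = 0 := (hP.pow n).ext zero hn
  rw [nexp_eq_sum h1]
  have h2 : ∀ x, HermitianBV.nexp (p x) = ∑ i ∈ Finset.range n, divPow (p x) i :=
    fun x => nexp_eq_sum (hn x)
  simp only [h2]
  exact sum _ fun i _ => (hP.pow i).smul _

end Fibrewise

theorem fibrewise_scal (c : ℤ → ℝ) : Fibrewise (M := M) (E := E) (scal c) fun _ => scal c := by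
  intro x a
  induction a using induction_lofD with
  | h0 => simp
  | hadd a b ha hb => simp only [map_add, ha, hb]
  | h k α => rw [scal_lof, map_smul, evAt_lofD, scal_incF]

variable (E M) in
/-- The wedge product. -/
def wedgeG : Forms E M →ₗ[ℝ] Forms E M →ₗ[ℝ] Forms E M := wedge E M

theorem wedgeG_lofD {k l : ℕ} (α : Form E M k) (β : Form E M l) :
    wedgeG E M (lofD k α) (lofD l β) = lofD (k + l) (wedgeForm k l α β) := by
  show wedge E M (inc E M k α) (inc E M l β) = inc E M (k + l) (wedgeForm k l α β)
  simp only [wedge, inc, DirectSum.toModule_lof, LinearMap.flip_apply, LinearMap.compr₂_apply]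

theorem fibrewise_wedge (a : Forms E M) :
    Fibrewise (wedgeG E M a) fun x => wedgeF E (evAt x a) := by
  intro x b
  beta_reduce
  induction a using induction_lofD with
  | h0 => simp
  | hadd a a' ha ha' => simp only [map_add, LinearMap.add_apply, ha, ha']
  | h k α =>
  induction b using induction_lofD with
  | h0 => simp
  | hadd a a' ha ha' => simp only [map_add, ha, ha']
  | h l β =>
  rw [wedgeG_lofD, evAt_lofD, evAt_lofD, evAt_lofD, wedgeF_incF]
  rfl

theorem evAt_wedge (x : M) (a b : Forms E M) :
    evAt x (wedgeG E M a b) = wedgeF E (evAt x a) (evAt x b) := fibrewise_wedge a x b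

variable (E M) in
/-- The unit. -/
def oneG : Forms E M := oneForm E M

theorem evAt_one (x : M) : evAt x (oneG E M) = oneF E := evAt_lofD x 0 _

/-- The action of a complex number. -/
def actG (z : ℂ) : Module.End ℝ (Forms E M) := pull E M z

theorem actG_lofD (z : ℂ) {k : ℕ} (α : Form E M k) :
    actG z (lofD k α) = lofD k (pullForm z k α) := by
  show pull E M z (inc E M k α) = inc E M k (pullForm z k α)
  simp only [pull, inc, DirectSum.toModule_lof]
  rfl

theorem fibrewise_act (z : ℂ) : Fibrewise (M := M) (E := E) (actG z) fun _ => actF z := by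
  intro x a
  induction a using induction_lofD with
  | h0 => simp
  | hadd a b ha hb => simp only [map_add, ha, hb]
  | h k α =>
    rw [actG_lofD, evAt_lofD, evAt_lofD, actF, pullF_incF]
    rfl

variable (g : HermitianMetric E M)

/-- The Hodge star operator. -/
def hodgeG : Module.End ℝ (Forms E M) := hodge g

theorem fibrewise_hodge : Fibrewise (hodgeG g) fun x => hodgeF (g.toBilin x) := by
  intro x a
  induction a using induction_lofD with
  | h0 => simp
  | hadd a b ha hb => simp only [map_add, ha, hb]
  | h k α =>
    rw [evAt_lofD]
    have h1 : hodgeG g = ofD (V := Form E M) fun k => if h : k ≤ realDim E then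
        lofD (V := Form E M) (realDim E - k) ∘ₗ hodgeForm g (Nat.add_sub_cancel' h) else 0 := rfl
    rw [h1, ofD_lofD]
    by_cases h : k ≤ realDim E
    · rw [dif_pos h, LinearMap.comp_apply, evAt_lofD, hodgeF_incF _ (Nat.add_sub_cancel' h)]
      rfl
    · rw [dif_neg h, incF_eq_zero (by omega), map_zero]
      simp

theorem isHermInner_toBilin (x : M) : IsHermInner (g.toBilin x) where
  symm := g.symm x
  pos := g.pos x
  herm := g.hermitian x

/-- The pointwise inner product. -/
def pairG (x : M) : LinearMap.BilinForm ℝ (Forms E M) := pairing g x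

theorem pairG_eq (x : M) (a b : Forms E M) :
    pairG g x a b = pairF (g.toBilin x) (evAt x a) (evAt x b) := by
  induction a using induction_lofD with
  | h0 => simp
  | hadd a b ha hb => simp only [map_add, LinearMap.add_apply, ha, hb]
  | h k α =>
    rw [evAt_lofD, pairF_incF, compD_evAt]
    have h1 : pairG g x = ofD (V := Form E M) fun k =>
      (pairForm g x k).compl₂ (compD (V := Form E M) k) := rfl
    rw [h1, ofD_lofD]
    rfl

/-- `Q` is the pointwise adjoint of `P`. -/
def IsAdjG (P Q : Module.End ℝ (Forms E M)) : Prop := ∀ x a b, pairG g x (P a) b = pairG g x a (Q b)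

theorem isAdjG_of_fibrewise {P Q : Module.End ℝ (Forms E M)} {p q : M → Module.End ℝ (FormAlg E)}
    (hP : Fibrewise P p) (hQ : Fibrewise Q q) (h : ∀ x, IsAdj (g.toBilin x) (p x) (q x)) :
    IsAdjG g P Q := fun x a b => by rw [pairG_eq, pairG_eq, hP, hQ, h]

variable (E M) in
theorem isGradedCommAlg_forms : IsGradedCommAlg (formsGrade E M) (wedgeG E M) (oneG E M) where
  one_mem := mem_of_evAt fun x => by rw [evAt_one]; exact oneF_mem
  mul_mem i j a ha b hb := mem_of_evAt fun x => by
    rw [evAt_wedge]; exact wedgeF_mem i j _ (evAt_mem x ha) _ (evAt_mem x hb)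
  one_mul a := evAt_ext fun x => by rw [evAt_wedge, evAt_one, one_wedgeF]
  mul_one a := evAt_ext fun x => by rw [evAt_wedge, evAt_one, wedgeF_one]
  mul_assoc a b c := evAt_ext fun x => by simp only [evAt_wedge, wedgeF_assoc]
  mul_comm i j a ha b hb := evAt_ext fun x => by
    rw [negOnePow_smul_eq, map_smul, evAt_wedge, evAt_wedge,
      wedgeF_comm (evAt_mem x ha) (evAt_mem x hb)]
  span := intGrade_span

/-- Commutators with a ∧ - act at x as commutators with the value of a at x. Bounds on the fibres
therefore suffice, with no need for forms of prescribed value at a point. -/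
theorem Fibrewise.order {P : Module.End ℝ (Forms E M)} {p : M → Module.End ℝ (FormAlg E)} {r : ℕ}
    {j : ℤ} (hP : Fibrewise P p) (h : ∀ x, HasOrderLE (formGrade E) (wedgeF E) r j (p x)) :
    HasOrderLE (formsGrade E M) (wedgeG E M) r j P := by
  induction r generalizing P p j with
  | zero =>
    exact ⟨hP.hasDegree fun x => (h x).1, fun i a ha =>
      ((fibrewise_wedge a).gradedComm hP i j).ext Fibrewise.zero fun x =>
        (h x).2 i _ (evAt_mem x ha)⟩
  | succ r ih =>
    exact ⟨hP.hasDegree fun x => (h x).1, fun i a ha =>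
      ih ((fibrewise_wedge a).gradedComm hP i j) fun x => (h x).2 i _ (evAt_mem x ha)⟩

/-- The Lefschetz operator. -/
def lefG : Module.End ℝ (Forms E M) := lefschetz g

theorem fibrewise_lef : Fibrewise (lefG g) fun x => lefF (g.toBilin x) := by
  intro x a
  have h : wedgeF E (evAt x (fundamentalForm g)) = lefF (g.toBilin x) := by
    have h1 : evAt x (fundamentalForm g) = incF E 2 (fundAt g x) := evAt_lofD x 2 _
    rw [h1]
    exact wedgeF_fundamental (isHermInner_toBilin g x) fun v => fundAt_apply g x v
  beta_reduce
  rw [← h]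
  exact fibrewise_wedge (fundamentalForm g) x a

/-- The adjoint of the Lefschetz operator. -/
def lamG : Module.End ℝ (Forms E M) := scal sg * hodgeG g * lefG g * hodgeG g

theorem fibrewise_lam : Fibrewise (lamG g) fun x => lamF (g.toBilin x) :=
  (((fibrewise_scal sg).mul (fibrewise_hodge g)).mul (fibrewise_lef g)).mul (fibrewise_hodge g)

theorem hasDegree_lefG : HasDegree (formsGrade E M) 2 (lefG g) :=
  (fibrewise_lef g).hasDegree fun _ => hasDegree_lefF _

theorem hasDegree_lamG : HasDegree (formsGrade E M) (-2) (lamG g) :=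
  (fibrewise_lam g).hasDegree fun x => hasDegree_lamF (isHermInner_toBilin g x)

variable (E M) in
/-- The operator `k - n` on forms of degree `k`. -/
def weightG : Module.End ℝ (Forms E M) := scal fun k => k - Module.finrank ℂ E

theorem HasDegree.weightG_mul {j : ℤ} {P : Module.End ℝ (Forms E M)}
    (hP : HasDegree (formsGrade E M) j P) : weightG E M * P - P * weightG E M = (j : ℝ) • P := by
  rw [weightG, hP.scal_mul, ← mul_sub]
  refine ext_intGrade fun i a ha => ?_
  rw [Module.End.mul_apply, LinearMap.sub_apply, scal_of_mem _ ha, scal_of_mem _ ha, ← sub_smul,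
    map_smul, LinearMap.smul_apply]
  congr 1
  push_cast
  ring

theorem isNilTripleG : IsNilTriple (lefG g) (lamG g) (weightG E M) where
  nilL := ⟨_, ((fibrewise_lef g).pow _).ext Fibrewise.zero fun x =>
    isNilpotent_of_hasDegree (by norm_num) (hasDegree_lefF _)⟩
  nilΛ := ⟨_, ((fibrewise_lam g).pow _).ext Fibrewise.zero fun x =>
    isNilpotent_of_hasDegree (by norm_num) (hasDegree_lamF (isHermInner_toBilin g x))⟩
  comm := (((fibrewise_lef g).mul (fibrewise_lam g)).sub ((fibrewise_lam g).mul
    (fibrewise_lef g))).ext (fibrewise_scal _) fun x => lefF_lamF_comm (isHermInner_toBilin g x)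
  commL := by rw [(hasDegree_lefG g).weightG_mul]; norm_num
  commΛ := by rw [(hasDegree_lamG g).weightG_mul]; norm_num

/-- The Weyl element on forms. -/
abbrev weylG : Module.End ℝ (Forms E M) := weyl (lefG g) (lamG g)

/-- The inverse of the Weyl element on forms. -/
abbrev weylInvG : Module.End ℝ (Forms E M) := weylInv (lefG g) (lamG g)

theorem fibrewise_nexp_lef : Fibrewise (nexp (lefG g)) fun x => nexp (lefF (g.toBilin x)) :=
  (fibrewise_lef g).nexp fun _ => isNilpotent_of_hasDegree (by norm_num) (hasDegree_lefF _)

theorem fibrewise_nexp_neg_lef : Fibrewise (nexp (-lefG g)) fun x => nexp (-lefF (g.toBilin x)) :=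
  (fibrewise_lef g).neg.nexp fun _ => isNilpotent_of_hasDegree (by norm_num) (hasDegree_lefF _).neg

theorem fibrewise_nexp_lam : Fibrewise (nexp (lamG g)) fun x => nexp (lamF (g.toBilin x)) :=
  (fibrewise_lam g).nexp fun x =>
    isNilpotent_of_hasDegree (by norm_num) (hasDegree_lamF (isHermInner_toBilin g x))

theorem fibrewise_nexp_neg_lam : Fibrewise (nexp (-lamG g)) fun x => nexp (-lamF (g.toBilin x)) :=
  (fibrewise_lam g).neg.nexp fun x =>
    isNilpotent_of_hasDegree (by norm_num) (hasDegree_lamF (isHermInner_toBilin g x)).neg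

theorem fibrewise_weyl : Fibrewise (weylG g) fun x => weylF (g.toBilin x) :=
  ((fibrewise_nexp_lef g).mul (fibrewise_nexp_neg_lam g)).mul (fibrewise_nexp_lef g)

theorem fibrewise_weylInv : Fibrewise (weylInvG g) fun x => weylInvF (g.toBilin x) :=
  ((fibrewise_nexp_neg_lef g).mul (fibrewise_nexp_lam g)).mul (fibrewise_nexp_neg_lef g)

end Global

/-! ### The exterior differential: Leibniz rule, d² = 0 and the complex structure. -/

section ExteriorDerivative
variable {E : Type*} [NormedAddCommGroup E] [NormedSpace ℂ E] [FiniteDimensional ℂ E]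

/-- The coordinate forms of `realBasis E`. -/
def coordF (i : Fin (realDim E)) : E →L[ℝ] ℝ := LinearMap.toContinuousLinearMap ((realBasis E).coord i)

theorem sum_coordF_smul (v : E) : ∑ i, coordF i v • realBasis E i = v := (realBasis E).sum_repr v

/-- Antisymmetrization of a linear map from `E` to forms. -/
def antiF (z : ℂ) : (E →ₗ[ℝ] FormAlg E) →ₗ[ℝ] FormAlg E where
  toFun D := ∑ i, extMul (coordF i ∘L mulMap z) (D (realBasis E i))
  map_add' D D' := by simp only [LinearMap.add_apply, map_add, Finset.sum_add_distrib]
  map_smul' c D := by simp only [LinearMap.smul_apply, map_smul, Finset.smul_sum, RingHom.id_apply]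

theorem antiF_apply (z : ℂ) (D : E →ₗ[ℝ] FormAlg E) :
    antiF z D = ∑ i, extMul (coordF i ∘L mulMap z) (D (realBasis E i)) := rfl

theorem mulMap_one : mulMap 1 = ContinuousLinearMap.id ℝ E := by ext v; exact one_smul ℂ v

theorem antiF_one (D : E →ₗ[ℝ] FormAlg E) :
    antiF 1 D = ∑ i, extMul (coordF i) (D (realBasis E i)) := by
  rw [antiF_apply, mulMap_one]; rfl

theorem incF_alternatizeUncurryFin {k : ℕ} (D : E →L[ℝ] E [⋀^Fin k]→L[ℝ] ℝ) :
    incF E (k + 1) (ContinuousAlternatingMap.alternatizeUncurryFin D) =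
      antiF 1 (incF E k ∘ₗ D.toLinearMap) := by
  have h : D = ∑ i, (coordF i).smulRight (D (realBasis E i)) := by
    refine ContinuousLinearMap.ext fun v => ?_
    conv_lhs => rw [← sum_coordF_smul v]
    rw [map_sum, sum_apply]
    exact Finset.sum_congr rfl fun i _ => map_smul D _ _
  rw [antiF_one]
  conv_lhs => rw [h]
  rw [← ContinuousAlternatingMap.alternatizeUncurryFinCLM_apply, map_sum, map_sum]
  exact Finset.sum_congr rfl fun i _ => (extMul_incF _ _).symm

/-- The form eⁱ(z ·) is real-linear in z, so it is Re z eⁱ + Im z eⁱ(i ·). -/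
theorem antiF_eq (z : ℂ) (D : E →ₗ[ℝ] FormAlg E) :
    antiF z D = z.re • antiF 1 D + z.im • antiF Complex.I D := by
  simp only [antiF_apply, Finset.smul_sum, ← Finset.sum_add_distrib]
  refine Finset.sum_congr rfl fun i _ => ?_
  have h : coordF i ∘L mulMap z = z.re • (coordF i ∘L mulMap 1) + z.im • (coordF i ∘L mulMap Complex.I) := by
    ext v
    show coordF i (z • v) = z.re • coordF i ((1 : ℂ) • v) + z.im • coordF i (Complex.I • v)
    rw [← map_smul, ← map_smul, ← map_add]
    congr 1
    conv_lhs => rw [← Complex.re_add_im z]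
    rw [add_smul, one_smul, mul_smul, Complex.coe_smul, Complex.coe_smul]
  rw [h, map_add, map_smul, map_smul]
  rfl

theorem actF_antiF (z w : ℂ) (D : E →ₗ[ℝ] FormAlg E) :
    actF w (antiF z D) = antiF (z * w) (actF w ∘ₗ D) := by
  rw [antiF_apply, antiF_apply, map_sum]
  refine Finset.sum_congr rfl fun i _ => ?_
  have h := LinearMap.congr_fun (pullF_extMul (mulMap w) (coordF i ∘L mulMap z)) (D (realBasis E i))
  have h2 : (coordF i ∘L mulMap z) ∘L mulMap w = coordF i ∘L mulMap (z * w) := by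
    ext v
    show coordF i (z • w • v) = coordF i ((z * w) • v)
    rw [smul_smul]
  rw [h2] at h
  exact h

variable {M : Type*} [TopologicalSpace M] [ChartedSpace E M] [IsManifold 𝓘(ℂ, E) ω M]

theorem differentiableAt_chartRep {k : ℕ} (α : Form E M k) (x : M) :
    DifferentiableAt ℝ (chartRep α.1 x) (extChartAt 𝓘(ℝ, E) x x) :=
  ((α.2 x).contDiffAt ((isOpen_extChartAt_target x).mem_nhds
    (mem_extChartAt_target x))).differentiableAt (by simp)

theorem chartRep_self {k : ℕ} (α : M → E [⋀^Fin k]→L[ℝ] ℝ) (x : M) :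
    chartRep α x (extChartAt 𝓘(ℝ, E) x x) = α x := by
  rw [chartRep, extChartAt_to_inv]
  ext u
  rw [ContinuousAlternatingMap.compContinuousLinearMap_apply]
  congr 1
  funext i
  exact tangentCoordChange_self (mem_extChartAt_source x)

/-- The partial derivatives of forms in the preferred chart. -/
def covD (x : M) : Forms E M →ₗ[ℝ] E →ₗ[ℝ] FormAlg E :=
  ofD fun k =>
    { toFun := fun α => incF E k ∘ₗ
        (fderiv ℝ (chartRep α.1 x) (extChartAt 𝓘(ℝ, E) x x)).toLinearMap
      map_add' := fun α β => by
        have h : fderiv ℝ (chartRep (α + β).1 x) (extChartAt 𝓘(ℝ, E) x x) =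
            fderiv ℝ (chartRep α.1 x) (extChartAt 𝓘(ℝ, E) x x) +
            fderiv ℝ (chartRep β.1 x) (extChartAt 𝓘(ℝ, E) x x) :=
          fderiv_add (differentiableAt_chartRep α x) (differentiableAt_chartRep β x)
        rw [h]
        exact LinearMap.ext fun v => map_add (incF E k) _ _
      map_smul' := fun c α => by
        have h : fderiv ℝ (chartRep (c • α).1 x) (extChartAt 𝓘(ℝ, E) x x) =
            c • fderiv ℝ (chartRep α.1 x) (extChartAt 𝓘(ℝ, E) x x) :=
          fderiv_const_smul (differentiableAt_chartRep α x) c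
        rw [h]
        exact LinearMap.ext fun v => map_smul (incF E k) _ _ }

theorem covD_lofD (x : M) {k : ℕ} (α : Form E M k) (v : E) : covD x (lofD k α) v =
    incF E k (fderiv ℝ (chartRep α.1 x) (extChartAt 𝓘(ℝ, E) x x) v) := by
  rw [covD, ofD_lofD]; rfl

variable (E M) in
/-- The exterior differential. -/
def dG : Module.End ℝ (Forms E M) := dR E M

theorem dG_lofD {k : ℕ} (α : Form E M k) : dG E M (lofD k α) = lofD (k + 1) (dForm k α) := by
  have h : dG E M = ofD (V := Form E M) fun k => lofD (V := Form E M) (k + 1) ∘ₗ dForm k := rfl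
  rw [h, ofD_lofD]; rfl

/-- This is d = Σ eⁱ ∧ ∂ᵢ in the preferred chart at x, which separates the algebra from the
differentiation. -/
theorem evAt_dG (x : M) (a : Forms E M) : evAt x (dG E M a) = antiF 1 (covD x a) := by
  induction a using induction_lofD with
  | h0 => simp
  | hadd a b ha hb => simp only [map_add, ha, hb]
  | h k α =>
    rw [dG_lofD, evAt_lofD]
    have h : covD x (lofD k α) = incF E k ∘ₗ
        (fderiv ℝ (chartRep α.1 x) (extChartAt 𝓘(ℝ, E) x x)).toLinearMap :=
      LinearMap.ext fun v => covD_lofD x α v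
    rw [h, ← incF_alternatizeUncurryFin]
    rfl

theorem hasDegree_dG : HasDegree (formsGrade E M) 1 (dG E M) := fun j a ha =>
  intGrade_cases (p := fun j a => dG E M a ∈ formsGrade E M (j + 1)) (fun j => by simp)
    (fun k α => by rw [dG_lofD, ← Nat.cast_succ]; exact lof_mem_intGrade _ _) ha

/-- Near x, the chart expression of dα is the exterior derivative of that of α, so d² = 0 reduces to
the identity in a vector space. -/
theorem dG_mul_dG : dG E M * dG E M = 0 := by
  refine ext_lof fun k α => ?_
  rw [Module.End.mul_apply, dG_lofD, dG_lofD, LinearMap.zero_apply]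
  have h : dForm (k + 1) (dForm k α) = 0 := by
    refine Subtype.ext (funext fun x => ?_)
    show extDeriv (chartRep (dRaw α.1) x) (extChartAt 𝓘(ℝ, E) x x) = 0
    have h1 : chartRep (dRaw α.1) x =ᶠ[nhds (extChartAt 𝓘(ℝ, E) x x)] extDeriv (chartRep α.1 x) := by
      filter_upwards [(isOpen_extChartAt_target x).mem_nhds (mem_extChartAt_target x)] with y hy
      exact chartRep_dRaw α.2 x hy
    rw [h1.extDeriv_eq]
    refine extDeriv_extDeriv_apply (r := ∞) ((α.2 x).contDiffAt
      ((isOpen_extChartAt_target x).mem_nhds (mem_extChartAt_target x))) ?_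
    simpa using (ENat.LEInfty.out : (2 : WithTop ℕ∞) ≤ ∞)
  rw [h, map_zero]

/-- The charts are holomorphic: their frame maps are complex linear, so in a chart the action of z
is composition with a constant linear map, which commutes with differentiation. -/
theorem covD_actG (x : M) (z : ℂ) (a : Forms E M) : covD x (actG z a) = actF z ∘ₗ covD x a := by
  induction a using induction_lofD with
  | h0 => simp
  | hadd a b ha hb => simp only [map_add, ha, hb, LinearMap.comp_add]
  | h k α =>
    refine LinearMap.ext fun v => ?_
    rw [actG_lofD, covD_lofD, LinearMap.comp_apply, covD_lofD, actF, pullF_incF]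
    congr 1
    let C := ContinuousAlternatingMap.compContinuousLinearMapCLM (ι := Fin k) (F := ℝ) (mulMap z : E →L[ℝ] E)
    have h1 : chartRep (pullForm z k α).1 x =ᶠ[nhds (extChartAt 𝓘(ℝ, E) x x)]
        fun y => C (chartRep α.1 x y) := by
      filter_upwards [(isOpen_extChartAt_target x).mem_nhds (mem_extChartAt_target x)] with y hy
      ext u
      show α.1 _ (fun i => z • frameMap E x _ (u i)) = α.1 _ (fun i => frameMap E x _ (z • u i))
      congr 1
      funext i
      exact (frameMap_smul x _ ((extChartAt 𝓘(ℝ, E) x).map_target hy) z (u i)).symm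
    rw [h1.fderiv_eq]
    have h2 := (C.hasFDerivAt.comp _ (differentiableAt_chartRep α x).hasFDerivAt).fderiv
    have h3 : (C ∘ chartRep α.1 x) = fun y => C (chartRep α.1 x y) := rfl
    rw [h3] at h2
    rw [h2]
    rfl

theorem fderiv_eval {k : ℕ} (α : Form E M k) (x : M) (u : Fin k → E) :
    HasFDerivAt (fun y => chartRep α.1 x y u) ((ContinuousAlternatingMap.apply ℝ E ℝ u).comp
      (fderiv ℝ (chartRep α.1 x) (extChartAt 𝓘(ℝ, E) x x))) (extChartAt 𝓘(ℝ, E) x x) :=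
  (ContinuousAlternatingMap.apply ℝ E ℝ u).hasFDerivAt.comp _
    (differentiableAt_chartRep α x).hasFDerivAt

theorem fderiv_wedge {k l : ℕ} (α : Form E M k) (β : Form E M l) (x : M) (v : E) :
    fderiv ℝ (chartRep (wedgeForm k l α β).1 x) (extChartAt 𝓘(ℝ, E) x x) v =
      wedgeAt (fderiv ℝ (chartRep α.1 x) (extChartAt 𝓘(ℝ, E) x x) v) (β.1 x) +
      wedgeAt (α.1 x) (fderiv ℝ (chartRep β.1 x) (extChartAt 𝓘(ℝ, E) x x) v) := by
  ext u
  have h1 := fderiv_eval (wedgeForm k l α β) x u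
  have h2 : (fun y => chartRep (wedgeForm k l α β).1 x y u) = fun y =>
      ((k.factorial : ℝ) * (l.factorial : ℝ))⁻¹ *
      ∑ σ : Equiv.Perm (Fin (k + l)), ((Equiv.Perm.sign σ : ℤ) : ℝ) *
        (chartRep α.1 x y (fun i => u (σ (Fin.castAdd l i))) *
          chartRep β.1 x y (fun j => u (σ (Fin.natAdd k j)))) :=
    funext fun y => wedgeAt_apply (α.1 ((extChartAt 𝓘(ℝ, E) x).symm y))
      (β.1 ((extChartAt 𝓘(ℝ, E) x).symm y))
      (fun i => frameMap E x ((extChartAt 𝓘(ℝ, E) x).symm y) (u i))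
  have h3 := (HasFDerivAt.fun_sum (u := Finset.univ) fun (σ : Equiv.Perm (Fin (k + l))) _ =>
    ((fderiv_eval α x (fun i => u (σ (Fin.castAdd l i)))).mul
      (fderiv_eval β x (fun j => u (σ (Fin.natAdd k j))))).const_mul
        ((Equiv.Perm.sign σ : ℤ) : ℝ)).const_mul ((k.factorial : ℝ) * (l.factorial : ℝ))⁻¹
  rw [h2] at h1
  have h4 := congrArg (fun T : E →L[ℝ] ℝ => T v) (h1.unique h3)
  simp only [ContinuousLinearMap.comp_apply, ContinuousAlternatingMap.apply_apply] at h4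
  rw [h4, ContinuousAlternatingMap.add_apply, wedgeAt_apply, wedgeAt_apply, ← mul_add,
    ← Finset.sum_add_distrib]
  simp only [chartRep_self, smul_apply, smul_eq_mul, sum_apply, add_apply,
    ContinuousLinearMap.comp_apply, ContinuousAlternatingMap.apply_apply]
  congr 1
  refine Finset.sum_congr rfl fun σ _ => ?_
  ring

theorem covD_wedge (x : M) (a b : Forms E M) (v : E) : covD x (wedgeG E M a b) v =
    wedgeF E (covD x a v) (evAt x b) + wedgeF E (evAt x a) (covD x b v) := by
  induction a using induction_lofD with
  | h0 => simp
  | hadd a a' ha ha' => simp only [map_add, LinearMap.add_apply, ha, ha']; abel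
  | h k α =>
  induction b using induction_lofD with
  | h0 => simp
  | hadd a a' ha ha' => simp only [map_add, LinearMap.add_apply, ha, ha']; abel
  | h l β =>
  rw [wedgeG_lofD, covD_lofD, covD_lofD, covD_lofD, evAt_lofD, evAt_lofD, wedgeF_incF, wedgeF_incF,
    ← map_add, fderiv_wedge]

/-- The partial derivatives obey the product rule; moving eⁱ across a creates the sign (-1)^{deg a},
carried here by `scal sg` for inhomogeneous a. -/
theorem dG_wedge (a b : Forms E M) : dG E M (wedgeG E M a b) =
    wedgeG E M (dG E M a) b + wedgeG E M (scal sg a) (dG E M b) := by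
  refine evAt_ext fun x => ?_
  rw [map_add, evAt_wedge, evAt_wedge, evAt_dG, evAt_dG, evAt_dG, fibrewise_scal sg x a, antiF_one,
    antiF_one, antiF_one]
  simp only [covD_wedge, map_add, Finset.sum_add_distrib, map_sum, LinearMap.sum_apply]
  congr 1
  · exact Finset.sum_congr rfl fun i _ => extMul_wedgeF _ _ _
  · refine Finset.sum_congr rfl fun i _ => ?_
    have h := wedgeF_oneForm_right (coordF i) (scal sg (evAt x a))
    rw [← Module.End.mul_apply (scal sg), sg_scal_mul_self, Module.End.one_apply] at h
    rw [extMul_wedgeF, ← h, wedgeF_assoc]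
    rfl

/-- The commutation of `d` with the action of `z`. -/
theorem actG_dG (z : ℂ) : actG z * dG E M =
    (z.re • dG E M - z.im • (actG Complex.I⁻¹ * dG E M * actG Complex.I)) * actG z := by
  refine LinearMap.ext fun a => evAt_ext fun x => ?_
  simp only [Module.End.mul_apply, LinearMap.sub_apply, LinearMap.smul_apply, map_sub, map_smul]
  have h : ∀ (w : ℂ) (b : Forms E M), evAt x (actG w b) = actF w (evAt x b) := fun w b =>
    fibrewise_act w x b
  rw [h, evAt_dG, actF_antiF, one_mul, antiF_eq z, evAt_dG, h, evAt_dG, actF_antiF, covD_actG,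
    covD_actG, covD_actG, one_mul]
  have h2 : actF Complex.I⁻¹ ∘ₗ actF Complex.I ∘ₗ actF z ∘ₗ covD x a = actF z ∘ₗ covD x a := by
    refine LinearMap.ext fun v => ?_
    exact LinearMap.congr_fun actF_inv_mul (actF z (covD x a v))
  -- Since i⁻¹ = -i, the operator J⁻¹ d J is minus the antisymmetrization with eⁱ(i ·), whence the
  -- sign of the term in Im z.
  rw [h2, antiF_eq Complex.I⁻¹, Complex.inv_I]
  simp only [Complex.neg_re, Complex.I_re, Complex.neg_im, Complex.I_im]
  module

end ExteriorDerivative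

/-! ### Square-zero relations of the derived brackets. -/

section Multicomplex
variable {A : Type*} [Ring A] [Algebra ℝ A]

theorem comm_mul_eq {x y z y' z' : A} (hy : x * y - y * x = y') (hz : x * z - z * x = z') :
    x * (y * z) - y * z * x = y' * z + y * z' := by
  rw [← hy, ← hz]; noncomm_ring

/-- The components of `e^{Λ ξ} d e^{-Λ ξ}` square to zero if `d` does. -/
theorem multicomplex_relations {Λ d D₁ D₂ : A} (hd : d * d = 0) (h0 : Λ * d - d * Λ = D₁)
    (h1 : Λ * D₁ - D₁ * Λ = (2 : ℝ) • D₂) (h2 : Λ * D₂ - D₂ * Λ = 0) :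
    d * D₁ + D₁ * d = 0 ∧ d * D₂ + D₁ * D₁ + D₂ * d = 0 ∧ D₁ * D₂ + D₂ * D₁ = 0 ∧ D₂ * D₂ = 0 := by
  -- Each relation is the bracket of Λ with the preceding one, starting from d² = 0, up to the
  -- factors 2, 3 and 4 divided out below.
  have key : ∀ {x y : A}, x = 0 → Λ * x - x * Λ = y → y = 0 := fun hx h => by
    rw [← h, hx, mul_zero, zero_mul, sub_zero]
  have two : ∀ {x : A} {c : ℝ}, c ≠ 0 → c • x = 0 → x = 0 := fun hc h =>
    (smul_eq_zero.1 h).resolve_left hc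
  have add_comm_eq : ∀ {x y x' y' : A}, Λ * x - x * Λ = x' → Λ * y - y * Λ = y' →
      Λ * (x + y) - (x + y) * Λ = x' + y' := fun hx hy => by rw [← hx, ← hy]; noncomm_ring
  have r1 : d * D₁ + D₁ * d = 0 := by
    have := key hd (comm_mul_eq h0 h0)
    rwa [add_comm] at this
  have r2 : d * D₂ + D₁ * D₁ + D₂ * d = 0 := by
    have := key r1 (add_comm_eq (comm_mul_eq h0 h1) (comm_mul_eq h1 h0))
    refine two (c := 2) two_ne_zero (Eq.trans ?_ this)
    simp only [mul_smul_comm, smul_mul_assoc]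
    module
  have r3 : D₁ * D₂ + D₂ * D₁ = 0 := by
    have := key r2 (add_comm_eq (add_comm_eq (comm_mul_eq h0 h2) (comm_mul_eq h1 h1))
      (comm_mul_eq h2 h0))
    refine two (c := 3) three_ne_zero (Eq.trans ?_ this)
    simp only [mul_smul_comm, smul_mul_assoc, mul_zero, zero_mul]
    module
  have r4 : D₂ * D₂ = 0 := by
    have := key r3 (add_comm_eq (comm_mul_eq h1 h2) (comm_mul_eq h2 h1))
    refine two (c := 4) four_ne_zero (Eq.trans ?_ this)
    simp only [mul_smul_comm, smul_mul_assoc, mul_zero, zero_mul]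
    module
  exact ⟨r1, r2, r3, r4⟩

end Multicomplex

/-! ### Formal conjugation by e^{Λξ}. -/

section PowerSeries
variable {V : Type*} [AddCommGroup V] [Module ℝ V]

theorem coeff_expSeries (f : Module.End ℝ V) (n : ℕ) :
    PowerSeries.coeff n (expSeries f) = divPow f n := by
  rw [expSeries, PowerSeries.coeff_mk, divPow_natCast]

theorem expSeries_mul_expSeries_neg (f : Module.End ℝ V) : expSeries f * expSeries (-f) = 1 := by
  ext1 n
  rw [PowerSeries.coeff_mul]
  simp only [coeff_expSeries, divPow_natCast]
  -- Powers of f commute, so the cancellation of coefficients is that of the real series e^x e^{-x}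
  -- = 1.
  have h := congrArg (PowerSeries.coeff n) (PowerSeries.exp_mul_exp_neg_eq_one (A := ℝ))
  rw [PowerSeries.coeff_mul] at h
  simp only [PowerSeries.evalNegHom, PowerSeries.coeff_rescale, PowerSeries.coeff_exp] at h
  have h2 : ∀ p ∈ Finset.HasAntidiagonal.antidiagonal n, ((p.1.factorial : ℝ)⁻¹ • f ^ p.1) *
      ((p.2.factorial : ℝ)⁻¹ • (-f) ^ p.2) = ((algebraMap ℚ ℝ) (1 / p.1.factorial) *
        ((-1) ^ p.2 * (algebraMap ℚ ℝ) (1 / p.2.factorial))) • f ^ n := fun p hp => by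
    rw [← Finset.HasAntidiagonal.mem_antidiagonal.1 hp, pow_add, neg_pow f p.2, smul_mul_smul_comm]
    have h3 : ((-1 : Module.End ℝ V)) ^ p.2 = ((-1 : ℝ) ^ p.2) • (1 : Module.End ℝ V) := by
      rw [← one_pow (M := Module.End ℝ V) p.2, ← smul_pow, one_pow, neg_one_smul]
    rw [h3, smul_mul_assoc, one_mul, mul_smul_comm, smul_smul]
    congr 1
    simp
    ring
  rw [Finset.sum_congr rfl h2, ← Finset.sum_smul, h, PowerSeries.coeff_one, PowerSeries.coeff_one]
  split_ifs with hn
  · rw [hn, one_smul, pow_zero]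
  · rw [zero_smul]

/-- The formal conjugation of `d` by `e^{f ξ}`. -/
theorem expSeries_conj {f d D₁ D₂ : Module.End ℝ V} (h0 : f * d - d * f = -D₁)
    (h1 : f * D₁ - D₁ * f = -((2 : ℝ) • D₂)) (h2 : f * D₂ - D₂ * f = 0) :
    PowerSeries.C d - PowerSeries.C D₁ * PowerSeries.X + PowerSeries.C D₂ * PowerSeries.X ^ 2 =
      expSeries f * PowerSeries.C d * expSeries (-f) := by
  have key : expSeries f * PowerSeries.C d = (PowerSeries.C d - PowerSeries.C D₁ * PowerSeries.X +
      PowerSeries.C D₂ * PowerSeries.X ^ 2) * expSeries f := by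
    ext1 n
    have h1' : f * -D₁ - -D₁ * f = (2 : ℝ) • D₂ := by
      rw [mul_neg, neg_mul, ← neg_sub', h1, neg_neg]
    have h2' : f * ((2 : ℝ) • D₂) - ((2 : ℝ) • D₂) * f = 0 := by
      rw [mul_smul_comm, smul_mul_assoc, ← smul_sub, h2, smul_zero]
    have h := divPow_mul h0 h1' h2' (by simp : f * (0 : Module.End ℝ V) - 0 * f = 0) n
    rw [PowerSeries.coeff_mul_C, coeff_expSeries, h, add_mul, sub_mul, map_add, map_sub,
      PowerSeries.coeff_C_mul, mul_assoc, mul_assoc, PowerSeries.coeff_C_mul,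
      PowerSeries.coeff_C_mul, ← PowerSeries.commute_X, ← PowerSeries.commute_X_pow,
      PowerSeries.coeff_mul_X_pow', coeff_expSeries]
    -- For n = 0 the left side vanishes, in agreement with the divided power of index -1.
    have e1 : PowerSeries.coeff n (expSeries f * PowerSeries.X) = divPow f (n - 1) := by
      cases n with
      | zero => rw [divPow_of_neg f (by omega)]; simp
      | succ n => rw [PowerSeries.coeff_succ_mul_X, coeff_expSeries]; congr 1; push_cast; ring
    have e2 : (if 2 ≤ n then PowerSeries.coeff (n - 2) (expSeries f) else 0) = divPow f (n - 2) := by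
      split_ifs with h
      · rw [coeff_expSeries]; congr 1; omega
      · rw [divPow_of_neg f (by omega)]
    rw [e1, e2]
    simp only [zero_mul, smul_zero, add_zero, smul_mul_assoc, neg_mul]
    module
  rw [key, mul_assoc, expSeries_mul_expSeries_neg, mul_one]

end PowerSeries

/-! ### Assembling a commutative BV-infinity structure from derived brackets. -/

section Abstract
variable {K A : Type*} [Field K] [AddCommGroup A] [Module K A]

/-- The sums for n ≤ 4 are the hypotheses; for n ≥ 5 one of the two indices is at least 3 in every
term. -/
theorem sum_opSeq {d D₁ D₂ : Module.End K A} (h0 : d * d = 0) (h1 : d * D₁ + D₁ * d = 0)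
    (h2 : d * D₂ + D₁ * D₁ + D₂ * d = 0) (h3 : D₁ * D₂ + D₂ * D₁ = 0) (h4 : D₂ * D₂ = 0) (n : ℕ) :
    ∑ i ∈ Finset.range (n + 1), opSeq d D₁ D₂ i * opSeq d D₁ D₂ (n - i) = 0 := by
  match n with
  | 0 => simpa [opSeq] using h0
  | 1 => simpa [opSeq, Finset.sum_range_succ] using h1
  | 2 => simpa [opSeq, Finset.sum_range_succ] using h2
  | 3 => simpa [opSeq, Finset.sum_range_succ] using h3
  | 4 => simpa [opSeq, Finset.sum_range_succ] using h4
  | n + 5 =>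
    refine Finset.sum_eq_zero fun i hi => ?_
    have hz : ∀ k, 3 ≤ k → opSeq d D₁ D₂ k = 0 := fun k hk => by
      obtain ⟨l, rfl⟩ := Nat.exists_eq_add_of_le' hk
      rfl
    by_cases h : 3 ≤ i
    · rw [hz i h, zero_mul]
    · rw [hz (n + 5 - i) (by omega), mul_zero]

theorem IsGradedCommAlg.isCommBVInfinity {𝒜 : ℤ → Submodule K A} {mul : A →ₗ[K] A →ₗ[K] A} {one : A}
    (hA : IsGradedCommAlg 𝒜 mul one) (hint : DirectSum.IsInternal 𝒜) {d D₁ D₂ : Module.End K A}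
    (hl : ∀ (i : ℤ), ∀ a ∈ 𝒜 i, ∀ b, d (mul a b) = mul (d a) b + i.negOnePow • mul a (d b))
    (hd : HasDegree 𝒜 1 d) (ho1 : HasOrderLE 𝒜 mul 2 (-1) D₁) (ho2 : HasOrderLE 𝒜 mul 3 (-3) D₂)
    (h0 : d * d = 0) (h1 : d * D₁ + D₁ * d = 0)
    (h2 : d * D₂ + D₁ * D₁ + D₂ * d = 0) (h3 : D₁ * D₂ + D₂ * D₁ = 0) (h4 : D₂ * D₂ = 0) :
    IsCommBVInfinity 𝒜 mul one (opSeq d D₁ D₂) := by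
  refine ⟨hint, hA.one_mem, hA.mul_mem, hA.one_mul, hA.mul_one, hA.mul_assoc,
    hA.mul_comm, hl, fun k => ?_, sum_opSeq h0 h1 h2 h3 h4, fun n hn => ?_⟩
  · match k with
    | 0 => exact hd
    | 1 => exact ho1.hasDegree
    | 2 => exact ho2.hasDegree
    | k + 3 => exact HasDegree.zero
  · match n with
    | 1 => exact ho1
    | 2 => exact ho2
    | n + 3 => exact HasOrderLE.zero

theorem IsGradedCommAlg.isCommBVInfinity_of_derived {V : Type*} [AddCommGroup V] [Module ℝ V]
    {𝒜 : ℤ → Submodule ℝ V} {mul : V →ₗ[ℝ] V →ₗ[ℝ] V} {one : V}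
    (hA : IsGradedCommAlg 𝒜 mul one) (hint : DirectSum.IsInternal 𝒜) {Λ d D₁ D₂ : Module.End ℝ V}
    (hl : ∀ (i : ℤ), ∀ a ∈ 𝒜 i, ∀ b, d (mul a b) = mul (d a) b + i.negOnePow • mul a (d b))
    (hd : HasDegree 𝒜 1 d) (ho1 : HasOrderLE 𝒜 mul 2 (-1) D₁) (ho2 : HasOrderLE 𝒜 mul 3 (-3) D₂)
    (hdd : d * d = 0) (h0 : Λ * d - d * Λ = D₁) (h1 : Λ * D₁ - D₁ * Λ = (2 : ℝ) • D₂)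
    (h2 : Λ * D₂ - D₂ * Λ = 0) : IsCommBVInfinity 𝒜 mul one (opSeq d D₁ D₂) :=
  have hm := multicomplex_relations hdd h0 h1 h2
  hA.isCommBVInfinity hint hl hd ho1 ho2 hdd hm.1 hm.2.1 hm.2.2.1 hm.2.2.2

end Abstract

/-! ### The real operators as conjugates under the Weyl element. -/

section RealPart
variable {E : Type*} [NormedAddCommGroup E] [NormedSpace ℂ E] [FiniteDimensional ℂ E] {M : Type*}
  [TopologicalSpace M] [ChartedSpace E M] [IsManifold 𝓘(ℂ, E) ω M] (g : HermitianMetric E M)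

/-- The fundamental form. -/
def fundG : Forms E M := fundamentalForm g

theorem fundG_mem : fundG g ∈ formsGrade E M 2 := lof_mem_intGrade (V := Form E M) 2 _

theorem lefG_eq : lefG g = wedgeG E M (fundG g) := rfl

/-- The operator `dω ∧ -`. -/
def domG : Module.End ℝ (Forms E M) := wedgeG E M (dG E M (fundG g))

theorem d_fundG_mem : dG E M (fundG g) ∈ formsGrade E M 3 := hasDegree_dG 2 _ (fundG_mem g)

theorem hasDegree_domG : HasDegree (formsGrade E M) 3 (domG g) :=
  ((isGradedCommAlg_forms E M).hasOrderLE_mul (d_fundG_mem g)).1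

/-- The Leibniz rule, with no sign because ω has even degree. -/
theorem dG_lefG : dG E M * lefG g - lefG g * dG E M = domG g := by
  refine LinearMap.ext fun a => ?_
  rw [LinearMap.sub_apply, Module.End.mul_apply, Module.End.mul_apply, lefG_eq, dG_wedge,
    scal_of_mem _ (fundG_mem g), sg_even (by decide), one_smul, add_sub_cancel_right]
  rfl

theorem lefG_domG : lefG g * domG g - domG g * lefG g = 0 := by
  have h := ((isGradedCommAlg_forms E M).hasOrderLE_mul (d_fundG_mem g)).2 2 _ (fundG_mem g)
  rw [gradedComm, Int.negOnePow_even _ (by decide), one_smul] at h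
  exact h

/-- The torsion operator `[Λ, dω]`. -/
def torG : Module.End ℝ (Forms E M) := lamG g * domG g - domG g * lamG g

/-- The operator `[Λ, d]`. -/
def delta₁ : Module.End ℝ (Forms E M) := lamG g * dG E M - dG E M * lamG g

/-- The operator `[Λ, [Λ, d]] / 2`. -/
def delta₂ : Module.End ℝ (Forms E M) :=
  (1 / 2 : ℝ) • (lamG g * delta₁ g - delta₁ g * lamG g)

theorem lamG_delta₁ : lamG g * delta₁ g - delta₁ g * lamG g = (2 : ℝ) • delta₂ g := by
  rw [delta₂]; module

theorem weylG_differential : Carries (weylG g) (dG E M + torG g) (-delta₁ g) ∧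
    Carries (weylG g) (domG g) (delta₂ g) ∧ lamG g * delta₂ g - delta₂ g * lamG g = 0 := by
  have h1 := (hasDegree_dG (E := E) (M := M)).weightG_mul
  rw [Int.cast_one, one_smul] at h1
  have h2 := (hasDegree_domG g).weightG_mul
  have h := (isNilTripleG g).weyl_differential (dG_lefG g) (lefG_domG g) h1 (by exact_mod_cast h2)
    (T := torG g) rfl (D₁ := delta₁ g) rfl (lamG_delta₁ g)
  exact ⟨h.1, h.2.1, h.2.2.2⟩

theorem dG_one : dG E M (oneG E M) = 0 := by
  have h := dG_wedge (oneG E M) (oneG E M)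
  have hA := isGradedCommAlg_forms E M
  rw [scal_of_mem _ hA.one_mem, sg_zero, one_smul, hA.one_mul, hA.mul_one, hA.one_mul] at h
  simpa using h

/-- A function whose square is `1` is closed. -/
theorem dG_eq_zero_of_sq {f : Forms E M} (hf : f ∈ formsGrade E M 0)
    (h : wedgeG E M f f = oneG E M) : dG E M f = 0 := by
  have hA := isGradedCommAlg_forms E M
  have h1 := dG_wedge f f
  rw [h, dG_one, scal_of_mem _ hf, sg_zero, one_smul,
    hA.mul_comm 1 0 _ (hasDegree_dG 0 _ hf) f hf, mul_zero, Int.negOnePow_zero, one_smul,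
    ← two_smul ℝ] at h1
  have h2 := (smul_eq_zero.1 h1.symm).resolve_left two_ne_zero
  rw [← hA.one_mul (dG E M f), ← h, hA.mul_assoc, h2, map_zero]

theorem actG_inv_mul : (actG Complex.I⁻¹ * actG Complex.I : Module.End ℝ (Forms E M)) = 1 :=
  ((fibrewise_act _).mul (fibrewise_act _)).ext Fibrewise.one fun _ => actF_inv_mul

theorem actG_mul_inv : (actG Complex.I * actG Complex.I⁻¹ : Module.End ℝ (Forms E M)) = 1 :=
  ((fibrewise_act _).mul (fibrewise_act _)).ext Fibrewise.one fun _ => actF_mul_inv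

theorem actG_mul_actG_I : (actG Complex.I * actG Complex.I : Module.End ℝ (Forms E M)) = scal sg :=
  ((fibrewise_act _).mul (fibrewise_act _)).ext (fibrewise_scal _) fun _ => actF_mul_actF_I

theorem hasDegree_actG (z : ℂ) : HasDegree (formsGrade E M) 0 (actG z) :=
  (fibrewise_act z).hasDegree fun _ => hasDegree_actF z

theorem actG_carries_lef : Carries (actG Complex.I) (lefG g) (lefG g) :=
  ((fibrewise_act _).mul (fibrewise_lef g)).ext ((fibrewise_lef g).mul (fibrewise_act _)) fun x =>
    actF_carries_lefF (isHermInner_toBilin g x)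

theorem actG_carries_lam : Carries (actG Complex.I) (lamG g) (lamG g) :=
  ((fibrewise_act _).mul (fibrewise_lam g)).ext ((fibrewise_lam g).mul (fibrewise_act _)) fun x =>
    actF_carries_lamF (isHermInner_toBilin g x)

theorem actG_inv_carries_lam : Carries (actG Complex.I⁻¹) (lamG g) (lamG g) :=
  (actG_carries_lam g).symm actG_inv_mul actG_mul_inv

theorem fibrewise_triOp : Fibrewise (triOp (Form E M)) fun _ => triOp (AltForm E) :=
  fibrewise_scal triSg

/-- The Hodge star operator is, up to a locally constant sign, `W J (-1) ^ (k (k + 1) / 2)`. -/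
theorem hodgeG_eq : ∃ f ∈ formsGrade E M 0, wedgeG E M f f = oneG E M ∧
    hodgeG g = wedgeG E M f * (weylG g * actG Complex.I * triOp (Form E M)) := by
  have t := isNilTripleG g
  obtain ⟨R, hR⟩ : ∃ R, R = triOp (Form E M) * actG Complex.I⁻¹ * weylInvG g := ⟨_, rfl⟩
  have hRf : Fibrewise (hodgeG g * R) fun x => hodgeF (g.toBilin x) *
      (triOp (AltForm E) * actF Complex.I⁻¹ * weylInvF (g.toBilin x)) := by
    rw [hR]
    exact (fibrewise_hodge g).mul ((fibrewise_triOp.mul (fibrewise_act _)).mul (fibrewise_weylInv g))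
  choose f hf1 hf2 using fun x => hodgeF_eq (isHermInner_toBilin g x)
  have hev : ∀ x, evAt x ((hodgeG g * R) (oneG E M)) = f x • oneF E := fun x => by
    rw [hRf]
    beta_reduce
    rw [hf2, evAt_one]
    rfl
  -- At each point ⋆R is a scalar, so globally it is multiplication by its value on the constant
  -- function 1; this makes the sign f a smooth function.
  have hZ : hodgeG g * R = wedgeG E M ((hodgeG g * R) (oneG E M)) :=
    hRf.ext (fibrewise_wedge _) fun x => by
      rw [hf2, hev, map_smul]
      congr 1
      exact (LinearMap.ext one_wedgeF).symm
  refine ⟨(hodgeG g * R) (oneG E M), mem_of_evAt fun x => ?_, evAt_ext fun x => ?_, ?_⟩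
  · rw [hev]; exact Submodule.smul_mem _ _ oneF_mem
  · rw [evAt_wedge, hev, map_smul, wedgeF_one, smul_smul, hf1, evAt_one]
  · have h1 : R * (weylG g * actG Complex.I * triOp (Form E M)) = 1 := by
      calc R * (weylG g * actG Complex.I * triOp (Form E M))
          = triOp (Form E M) * (actG Complex.I⁻¹ * (weylInvG g * weylG g) * actG Complex.I) *
            triOp (Form E M) := by rw [hR]; simp only [mul_assoc]
        _ = 1 := by rw [t.weylInv_mul, mul_one, actG_inv_mul, mul_one, triOp_mul_self]
    rw [← hZ, mul_assoc, h1, mul_one]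

theorem Fibrewise.wedge_comm {P : Module.End ℝ (Forms E M)} {p : M → Module.End ℝ (FormAlg E)}
    (hP : Fibrewise P p) {f : Forms E M} (hf : f ∈ formsGrade E M 0) :
    wedgeG E M f * P = P * wedgeG E M f :=
  ((fibrewise_wedge f).mul hP).ext (hP.mul (fibrewise_wedge f)) fun x => by
    obtain ⟨α, hα⟩ : ∃ α, incF E 0 α = evAt x f := evAt_mem x hf
    have h1 : wedgeF E (oneF E) = 1 := LinearMap.ext one_wedgeF
    rw [← hα, incF_zero_eq, map_smul, h1, smul_mul_assoc, mul_smul_comm, one_mul, mul_one]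

/-- The operator `-⋆ J⁻¹ d J ⋆`. -/
def dcsG : Module.End ℝ (Forms E M) :=
  -(hodgeG g * (actG Complex.I⁻¹ * dG E M * actG Complex.I) * hodgeG g)

/-- In -⋆ J⁻¹ d J ⋆ each star is f W J S, where S = (-1)^{k(k+1)/2}. The function f is closed of
square 1 and cancels, the powers of J cancel against parity signs, and S d S = -d(-1)^k together
with W S = S W⁻¹ turns the second W into W⁻¹. -/
theorem weylG_carries_dG : Carries (weylG g) (dG E M) (dcsG g) := by
  have t := isNilTripleG g
  obtain ⟨f, hf, hff, hH⟩ := hodgeG_eq g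
  have hFF : wedgeG E M f * wedgeG E M f = 1 := LinearMap.ext fun a => by
    rw [Module.End.mul_apply, ← (isGradedCommAlg_forms E M).mul_assoc, hff,
      (isGradedCommAlg_forms E M).one_mul, Module.End.one_apply]
  have hFd : wedgeG E M f * dG E M = dG E M * wedgeG E M f := LinearMap.ext fun a => by
    rw [Module.End.mul_apply, Module.End.mul_apply, dG_wedge, dG_eq_zero_of_sq hf hff, map_zero,
      LinearMap.zero_apply, zero_add, scal_of_mem _ hf, sg_zero, one_smul]
  obtain ⟨U, hU⟩ : ∃ U, U = weylG g * actG Complex.I * triOp (Form E M) := ⟨_, rfl⟩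
  have hUf : wedgeG E M f * U = U * wedgeG E M f := by
    rw [hU]
    exact (((fibrewise_weyl g).mul (fibrewise_act _)).mul fibrewise_triOp).wedge_comm hf
  have hJf : wedgeG E M f * actG Complex.I = actG Complex.I * wedgeG E M f :=
    (fibrewise_act _).wedge_comm hf
  have hJf' : wedgeG E M f * actG Complex.I⁻¹ = actG Complex.I⁻¹ * wedgeG E M f :=
    (fibrewise_act _).wedge_comm hf
  have hSJ : triOp (Form E M) * actG Complex.I = actG Complex.I * triOp (Form E M) := by
    rw [triOp, (hasDegree_actG _).scal_mul]; simp
  have hSJ' : triOp (Form E M) * actG Complex.I⁻¹ = actG Complex.I⁻¹ * triOp (Form E M) := by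
    rw [triOp, (hasDegree_actG _).scal_mul]; simp
  have hSe : triOp (Form E M) * scal sg = scal sg * triOp (Form E M) := by
    rw [triOp, scal_mul_scal, scal_mul_scal]; exact scal_congr fun k => mul_comm _ _
  have hee : (scal sg * scal sg : Module.End ℝ (Forms E M)) = 1 := sg_scal_mul_self
  have hJW : actG Complex.I * weylG g = weylG g * actG Complex.I :=
    (t.carries_weyl (actG_carries_lef g) (actG_carries_lam g)).eq
  have hSW : weylG g * triOp (Form E M) = triOp (Form E M) * weylInvG g :=
    ((triOp_carries_weyl t (hasDegree_lefG g) (hasDegree_lamG g)).symm triOp_mul_self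
      triOp_mul_self).eq.symm
  have heW : scal sg * weylInvG g = weylInvG g * scal sg := by
    rw [← actG_mul_actG_I]
    have h := (t.carries_weylInv (actG_carries_lef g) (actG_carries_lam g))
    exact (h.trans h).eq
  have hSd : triOp (Form E M) * dG E M * triOp (Form E M) = -(dG E M * scal sg) := by
    rw [triOp_mul_of_odd hasDegree_dG, neg_mul, mul_assoc, triOp_mul_self, mul_one]
  have h1 : hodgeG g * (actG Complex.I⁻¹ * dG E M * actG Complex.I) * hodgeG g =
      U * (actG Complex.I⁻¹ * dG E M * actG Complex.I) * U := by
    have h2 : wedgeG E M f * (U * (actG Complex.I⁻¹ * dG E M * actG Complex.I)) =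
        U * (actG Complex.I⁻¹ * dG E M * actG Complex.I) * wedgeG E M f := by
      rw [← mul_assoc, hUf, mul_assoc, ← mul_assoc (wedgeG E M f), ← mul_assoc (wedgeG E M f), hJf',
        mul_assoc (actG _) (wedgeG E M f), hFd, ← mul_assoc (actG _), mul_assoc _ (wedgeG E M f), hJf]
      simp only [mul_assoc]
    rw [hH, ← hU, mul_assoc (wedgeG E M f) U, h2, mul_assoc _ (wedgeG E M f),
      ← mul_assoc (wedgeG E M f), hFF, one_mul]
  have h3 : U * (actG Complex.I⁻¹ * dG E M * actG Complex.I) * U =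
      -(weylG g * dG E M * weylInvG g) := by
    calc U * (actG Complex.I⁻¹ * dG E M * actG Complex.I) * U
        = weylG g * actG Complex.I * (triOp (Form E M) * actG Complex.I⁻¹) * dG E M *
          (actG Complex.I * weylG g) * actG Complex.I * triOp (Form E M) := by
          rw [hU]; simp only [mul_assoc]
      _ = weylG g * (actG Complex.I * actG Complex.I⁻¹) * triOp (Form E M) * dG E M *
          weylG g * (actG Complex.I * actG Complex.I) * triOp (Form E M) := by
          rw [hSJ', hJW]; simp only [mul_assoc]
      _ = weylG g * triOp (Form E M) * dG E M * (weylG g * triOp (Form E M)) * scal sg := by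
          rw [actG_mul_inv, mul_one, actG_mul_actG_I, mul_assoc _ (scal sg), ← hSe]
          simp only [mul_assoc]
      _ = weylG g * (triOp (Form E M) * dG E M * triOp (Form E M)) * (weylInvG g * scal sg) := by
          rw [hSW]; simp only [mul_assoc]
          rw [← mul_assoc (weylG g), hSW, mul_assoc]
      _ = -(weylG g * dG E M * (scal sg * scal sg) * weylInvG g) := by
          rw [hSd, ← heW]; simp only [mul_assoc, neg_mul, mul_neg]
      _ = -(weylG g * dG E M * weylInvG g) := by rw [hee, mul_one]
  rw [Carries, dcsG, h1, h3, neg_neg, mul_assoc, t.weylInv_mul, mul_one]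

/-- The adjoint of a twisted multiplication operator. -/
theorem isAdjG_twist_wedge (b : Forms E M) :
    IsAdjG g (actG Complex.I⁻¹ * wedgeG E M b * actG Complex.I)
      (weylG g * wedgeG E M (triOp (Form E M) b) * weylInvG g) :=
  isAdjG_of_fibrewise g (((fibrewise_act _).mul (fibrewise_wedge b)).mul (fibrewise_act _))
    (((fibrewise_weyl g).mul (fibrewise_wedge _)).mul (fibrewise_weylInv g)) fun x => by
      rw [fibrewise_triOp x b]
      exact isAdj_twist_wedgeF (isHermInner_toBilin g x) _

theorem isAdjG_lef : IsAdjG g (lefG g) (lamG g) :=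
  isAdjG_of_fibrewise g (fibrewise_lef g) (fibrewise_lam g) fun x =>
    isAdj_lefF (isHermInner_toBilin g x)

theorem pairG_symm (x : M) (a b : Forms E M) : pairG g x a b = pairG g x b a := by
  rw [pairG_eq, pairG_eq, pairF_symm (isHermInner_toBilin g x)]

theorem isAdjG_lam : IsAdjG g (lamG g) (lefG g) := fun x a b => by
  rw [pairG_symm, ← isAdjG_lef, pairG_symm]

variable {g} in
theorem IsAdjG.mul {P Q P' Q' : Module.End ℝ (Forms E M)} (h : IsAdjG g P Q)
    (h' : IsAdjG g P' Q') : IsAdjG g (P * P') (Q' * Q) := fun x a b => by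
  simp only [Module.End.mul_apply, h x _ b, h' x a _]

variable {g} in
theorem IsAdjG.sub {P Q P' Q' : Module.End ℝ (Forms E M)} (h : IsAdjG g P Q)
    (h' : IsAdjG g P' Q') : IsAdjG g (P - P') (Q - Q') := fun x a b => by
  simp only [LinearMap.sub_apply, map_sub, h x a b, h' x a b]

theorem triOp_three {b : Forms E M} (hb : b ∈ formsGrade E M 3) : triOp (Form E M) b = b := by
  rw [triOp, scal_of_mem _ hb, triSg, sg_even (by decide), one_smul]

/-- The conjugate of dω by W is the adjoint by the metric computation, the sign (-1)^{k(k+1)/2}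
being + in degree 3, and the second derived bracket by sl₂-theory. -/
theorem isAdjG_twist_dom :
    IsAdjG g (actG Complex.I⁻¹ * domG g * actG Complex.I) (delta₂ g) := by
  have h := isAdjG_twist_wedge g (dG E M (fundG g))
  have h1 : weylG g * domG g * weylInvG g = delta₂ g := by
    rw [(weylG_differential g).2.1.eq, mul_assoc, (isNilTripleG g).weyl_mul_inv, mul_one]
  rw [triOp_three (d_fundG_mem g)] at h
  rw [← h1]
  exact h

/-- The adjoint of the twisted torsion operator. -/
def torStar : Module.End ℝ (Forms E M) := delta₂ g * lefG g - lefG g * delta₂ g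

/-- J commutes with Λ, so twisting a bracket with Λ twists only the other factor. -/
theorem twist_torG : actG Complex.I⁻¹ * torG g * actG Complex.I =
    lamG g * (actG Complex.I⁻¹ * domG g * actG Complex.I) -
      (actG Complex.I⁻¹ * domG g * actG Complex.I) * lamG g := by
  rw [mul_assoc _ (actG Complex.I) (lamG g), (actG_carries_lam g).eq, ← mul_assoc, ← mul_assoc,
    ← (actG_inv_carries_lam g).eq, torG]
  simp only [mul_sub, sub_mul, mul_assoc]

theorem isAdjG_twist_tor :
    IsAdjG g (actG Complex.I⁻¹ * torG g * actG Complex.I) (torStar g) := by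
  have h := isAdjG_twist_dom g
  rw [twist_torG]
  exact ((isAdjG_lam g).mul h).sub (h.mul (isAdjG_lam g))

/-- T is the bracket of Λ with dω, and W carries these to -L and Δ₂. -/
theorem weylG_carries_tor : Carries (weylG g) (torG g) (torStar g) := by
  have h1 := (isNilTripleG g).weyl_carries_self.2.1
  have h2 := (weylG_differential g).2.1
  refine ((h1.mul h2).sub (h2.mul h1)).congr ?_
  rw [torStar, neg_mul, mul_neg]
  abel

/-- Both sides are the conjugate of d + T by W: the left one by the metric computations, the right
one by sl₂-theory. -/
theorem dcsG_add_torStar : dcsG g + torStar g = -delta₁ g := by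
  have h1 := ((weylG_carries_dG g).add (weylG_carries_tor g)).eq
  rw [(weylG_differential g).1.eq] at h1
  have h2 := congrArg (fun P => P * weylInvG g) h1
  simp only [mul_assoc, (isNilTripleG g).weyl_mul_inv, mul_one] at h2
  exact h2.symm

theorem order_delta₁ : HasOrderLE (formsGrade E M) (wedgeG E M) 2 (-1) (delta₁ g) := by
  have hA := isGradedCommAlg_forms E M
  have h1 := (fibrewise_lam g).order fun x => order_lamF (isHermInner_toBilin g x)
  have h2 : HasOrderLE (formsGrade E M) (wedgeG E M) 1 1 (dG E M) :=
    hA.order_of_derivation hasDegree_dG fun i a ha b => by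
      rw [dG_wedge, scal_of_mem _ ha, negOnePow_smul_eq, map_smul, LinearMap.smul_apply]
  have h3 := hA.gradedComm_order h1 h2 (n := 2) rfl
  rw [gradedComm, Int.negOnePow_even _ (by decide), one_smul] at h3
  exact h3.congr (by norm_num)

theorem order_delta₂ : HasOrderLE (formsGrade E M) (wedgeG E M) 3 (-3) (delta₂ g) := by
  have hA := isGradedCommAlg_forms E M
  have h1 := (fibrewise_lam g).order fun x => order_lamF (isHermInner_toBilin g x)
  have h3 := hA.gradedComm_order h1 (order_delta₁ g) (n := 3) rfl
  rw [gradedComm, Int.negOnePow_even _ (by decide), one_smul] at h3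
  exact (h3.congr (by norm_num)).smul _

theorem isCommBVInfinity_forms : IsCommBVInfinity (formsGrade E M) (wedgeG E M) (oneG E M)
    (opSeq (dG E M) (delta₁ g) (delta₂ g)) :=
  (isGradedCommAlg_forms E M).isCommBVInfinity_of_derived (isInternal_intGrade _)
    (fun i a ha b => by
      rw [dG_wedge, scal_of_mem _ ha, negOnePow_smul_eq, map_smul, LinearMap.smul_apply])
    hasDegree_dG (order_delta₁ g) (order_delta₂ g) dG_mul_dG (Λ := lamG g) rfl
    (lamG_delta₁ g) (weylG_differential g).2.2

end RealPart

/-! ### Complexified operators and their adjoints. -/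

section Complexify
variable {V : Type*} [AddCommGroup V] [Module ℝ V]

/-- The complex operator `A + i B` with real part `A` and imaginary part `B`. -/
def cplx (A B : Module.End ℝ V) : Module.End ℂ (ℂ ⊗[ℝ] V) :=
  A.baseChange ℂ + Complex.I • B.baseChange ℂ

theorem baseChange_eq_cplx (A : Module.End ℝ V) : A.baseChange ℂ = cplx A 0 := by
  rw [cplx, LinearMap.baseChange_zero, smul_zero, add_zero]

theorem cplx_add (A B A' B' : Module.End ℝ V) : cplx A B + cplx A' B' = cplx (A + A') (B + B') := by
  simp only [cplx, LinearMap.baseChange_add, smul_add]; abel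

theorem cplx_neg (A B : Module.End ℝ V) : -cplx A B = cplx (-A) (-B) := by
  simp only [cplx, LinearMap.baseChange_neg, smul_neg, neg_add]

theorem cplx_sub (A B A' B' : Module.End ℝ V) : cplx A B - cplx A' B' = cplx (A - A') (B - B') := by
  rw [sub_eq_add_neg, cplx_neg, cplx_add, sub_eq_add_neg, sub_eq_add_neg]

theorem smul_cplx (z : ℂ) (A B : Module.End ℝ V) :
    z • cplx A B = cplx (z.re • A - z.im • B) (z.re • B + z.im • A) := by
  have h : ∀ (r : ℝ) (P : Module.End ℂ (ℂ ⊗[ℝ] V)), r • P = (r : ℂ) • P := fun r P => rfl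
  simp only [cplx, LinearMap.baseChange_add, LinearMap.baseChange_sub, LinearMap.baseChange_smul, h]
  have hz : z = z.re + z.im * Complex.I := (Complex.re_add_im z).symm
  conv_lhs => rw [hz]
  match_scalars <;> ring_nf
  simp only [Complex.I_sq]
  ring

theorem I_smul_cplx (A B : Module.End ℝ V) : Complex.I • cplx A B = cplx (-B) A := by
  rw [smul_cplx]; simp

theorem cplx_mul_baseChange (A B P : Module.End ℝ V) :
    cplx A B * P.baseChange ℂ = cplx (A * P) (B * P) := by
  simp only [cplx, add_mul, smul_mul_assoc, LinearMap.baseChange_mul]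

theorem baseChange_mul_cplx (A B P : Module.End ℝ V) :
    P.baseChange ℂ * cplx A B = cplx (P * A) (P * B) := by
  simp only [cplx, mul_add, mul_smul_comm, LinearMap.baseChange_mul]

variable (V) in
/-- Complex conjugation on the complexification of a real vector space. -/
abbrev conjT : ℂ ⊗[ℝ] V →ₗ[ℝ] ℂ ⊗[ℝ] V := LinearMap.rTensor V Complex.conjAe.toLinearMap

theorem conjT_tmul (z : ℂ) (v : V) : conjT V (z ⊗ₜ v) = (starRingEnd ℂ z) ⊗ₜ v := rfl

theorem conjT_conjT (u : ℂ ⊗[ℝ] V) : conjT V (conjT V u) = u := by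
  induction u with
  | zero => simp
  | add a b ha hb => rw [map_add, map_add, ha, hb]
  | tmul z v => rw [conjT_tmul, conjT_tmul, Complex.conj_conj]

theorem conjT_smul (z : ℂ) (u : ℂ ⊗[ℝ] V) : conjT V (z • u) = starRingEnd ℂ z • conjT V u := by
  induction u with
  | zero => simp
  | add a b ha hb => rw [smul_add, map_add, map_add, ha, hb, smul_add]
  | tmul w v => simp only [TensorProduct.smul_tmul', conjT_tmul, smul_eq_mul, map_mul]

theorem conjT_baseChange (A : Module.End ℝ V) (u : ℂ ⊗[ℝ] V) :
    conjT V (A.baseChange ℂ u) = A.baseChange ℂ (conjT V u) := by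
  induction u with
  | zero => simp
  | add a b ha hb => rw [map_add, map_add, map_add, map_add, ha, hb]
  | tmul w v => simp only [LinearMap.baseChange_tmul, conjT_tmul]

theorem cplx_apply (A B : Module.End ℝ V) (u : ℂ ⊗[ℝ] V) :
    cplx A B u = A.baseChange ℂ u + Complex.I • B.baseChange ℂ u := rfl

theorem conjT_cplx (A B : Module.End ℝ V) (u : ℂ ⊗[ℝ] V) :
    conjT V (cplx A B u) = cplx A (-B) (conjT V u) := by
  rw [cplx_apply, cplx_apply, map_add, conjT_smul, conjT_baseChange, conjT_baseChange,
    Complex.conj_I, LinearMap.baseChange_neg, LinearMap.neg_apply, smul_neg, neg_smul]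

theorem cplx_add_conj (A B : Module.End ℝ V) (u : ℂ ⊗[ℝ] V) :
    (A + A).baseChange ℂ u = cplx A B u + conjT V (cplx A B (conjT V u)) := by
  rw [conjT_cplx, conjT_conjT, ← LinearMap.add_apply, cplx_add, add_neg_cancel, baseChange_eq_cplx]

theorem baseChange_adjoint {b : LinearMap.BilinForm ℝ V} {P Q : Module.End ℝ V}
    (h : ∀ a a', b (P a) a' = b a (Q a')) (u v : ℂ ⊗[ℝ] V) :
    b.baseChange ℂ (P.baseChange ℂ u) v = b.baseChange ℂ u (Q.baseChange ℂ v) := by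
  induction u with
  | zero => simp
  | add a a' ha ha' => rw [map_add, map_add, map_add, LinearMap.add_apply, LinearMap.add_apply, ha, ha']
  | tmul z a =>
    induction v with
    | zero => simp
    | add a a' ha ha' => rw [map_add, map_add, map_add, ha, ha']
    | tmul w a' =>
      rw [LinearMap.baseChange_tmul, LinearMap.baseChange_tmul, LinearMap.BilinForm.baseChange_tmul,
        LinearMap.BilinForm.baseChange_tmul, h]

/-- The pairing is antilinear in its second argument, so the imaginary part of the adjoint changes
sign. -/
theorem cplx_adjoint {b : LinearMap.BilinForm ℝ V} {P Q P' Q' : Module.End ℝ V}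
    (h : ∀ a a', b (P a) a' = b a (Q a')) (h' : ∀ a a', b (P' a) a' = b a (Q' a'))
    (u v : ℂ ⊗[ℝ] V) :
    b.baseChange ℂ (cplx P P' u) (conjT V v) = b.baseChange ℂ u (conjT V (cplx Q (-Q') v)) := by
  rw [conjT_cplx, neg_neg, cplx_apply, cplx_apply, map_add, map_add, map_smul, map_smul,
    LinearMap.add_apply, LinearMap.smul_apply, baseChange_adjoint h, baseChange_adjoint h']

theorem half_add_half (A : Module.End ℝ V) : (1 / 2 : ℝ) • A + (1 / 2 : ℝ) • A = A := by module

/-- The part of an operator of type `(1, 0)`. -/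
abbrev delPart (d dc : Module.End ℝ V) : Module.End ℂ (ℂ ⊗[ℝ] V) :=
  cplx ((1 / 2 : ℝ) • d) ((1 / 2 : ℝ) • dc)

/-- The part of an operator of type `(0, 1)`. -/
abbrev delbarPart (d dc : Module.End ℝ V) : Module.End ℂ (ℂ ⊗[ℝ] V) :=
  cplx ((1 / 2 : ℝ) • d) (-((1 / 2 : ℝ) • dc))

theorem delPart_add_delbarPart (d dc : Module.End ℝ V) :
    d.baseChange ℂ = delPart d dc + delbarPart d dc := by
  rw [cplx_add, half_add_half, add_neg_cancel, baseChange_eq_cplx]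

/-- The pair (d, d_c) is rotated by z like the real and imaginary parts of a complex number, so d +
i d_c is an eigenvector with eigenvalue z. This is what determines its bidegree. -/
theorem mul_delPart {P d dc : Module.End ℝ V} {z : ℂ} (h : P * d = (z.re • d - z.im • dc) * P)
    (h' : P * dc = (z.im • d + z.re • dc) * P) :
    P.baseChange ℂ * delPart d dc = (z • delPart d dc) * P.baseChange ℂ := by
  rw [baseChange_mul_cplx, smul_cplx, cplx_mul_baseChange, mul_smul_comm, mul_smul_comm, h, h',
    ← smul_mul_assoc, ← smul_mul_assoc]
  congr 2 <;> module

theorem mul_delbarPart {P d dc : Module.End ℝ V} {z : ℂ} (h : P * d = (z.re • d - z.im • dc) * P)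
    (h' : P * dc = (z.im • d + z.re • dc) * P) :
    P.baseChange ℂ * delbarPart d dc = (starRingEnd ℂ z • delbarPart d dc) * P.baseChange ℂ := by
  rw [baseChange_mul_cplx, smul_cplx, cplx_mul_baseChange, mul_neg, mul_smul_comm, mul_smul_comm,
    h, h', ← smul_mul_assoc, ← smul_mul_assoc, ← neg_mul, Complex.conj_re, Complex.conj_im]
  congr 2 <;> module

end Complexify

/-! ### The Dolbeault splitting and adjoints of real multiplications. -/

section Dolbeault
variable {E : Type*} [NormedAddCommGroup E] [NormedSpace ℂ E] [FiniteDimensional ℂ E] {M : Type*}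
  [TopologicalSpace M] [ChartedSpace E M] [IsManifold 𝓘(ℂ, E) ω M] (g : HermitianMetric E M)

variable (E M) in
/-- The operator `d_c = J⁻¹ d J`. -/
def dcG : Module.End ℝ (Forms E M) := actG Complex.I⁻¹ * dG E M * actG Complex.I

theorem actG_comm (z w : ℂ) : (actG z * actG w : Module.End ℝ (Forms E M)) = actG w * actG z :=
  ((fibrewise_act _).mul (fibrewise_act _)).ext ((fibrewise_act _).mul (fibrewise_act _)) fun _ => by
    rw [actF_mul, actF_mul, mul_comm]

/-- Twisting twice is conjugation by J² = (-1)^k, which changes the sign of the odd operator d. -/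
theorem twist_dcG : actG Complex.I⁻¹ * dcG E M * actG Complex.I = -dG E M := by
  have h1 : (actG Complex.I⁻¹ * actG Complex.I⁻¹ : Module.End ℝ (Forms E M)) = scal sg := by
    calc (actG Complex.I⁻¹ * actG Complex.I⁻¹ : Module.End ℝ (Forms E M))
        = actG Complex.I⁻¹ * actG Complex.I⁻¹ * (scal sg * scal sg) := by
          rw [sg_scal_mul_self, mul_one]
      _ = actG Complex.I⁻¹ * (actG Complex.I⁻¹ * actG Complex.I) * actG Complex.I * scal sg := by
          rw [← actG_mul_actG_I]; simp only [mul_assoc]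
      _ = scal sg := by rw [actG_inv_mul, mul_one, actG_inv_mul, one_mul]
  have h2 : (scal sg : Module.End ℝ (Forms E M)) * dG E M = -(dG E M * scal sg) := by
    rw [hasDegree_dG.scal_mul, ← mul_neg, ← scal_neg]
    congr 1
    exact scal_congr fun k => by rw [sg_add, sg_one, mul_neg_one]
  calc actG Complex.I⁻¹ * dcG E M * actG Complex.I
      = actG Complex.I⁻¹ * actG Complex.I⁻¹ * dG E M * (actG Complex.I * actG Complex.I) := by
        rw [dcG]; simp only [mul_assoc]
    _ = -dG E M := by
        rw [h1, actG_mul_actG_I, h2, neg_mul, mul_assoc, sg_scal_mul_self, mul_one]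

/-- Twist by J the commutation rule of d with z; J commutes with the action of z. -/
theorem actG_dcG (z : ℂ) : actG z * dcG E M = (z.im • dG E M + z.re • dcG E M) * actG z := by
  calc actG z * dcG E M = actG Complex.I⁻¹ * (actG z * dG E M) * actG Complex.I := by
        rw [dcG, ← mul_assoc, ← mul_assoc, actG_comm z]; simp only [mul_assoc]
    _ = actG Complex.I⁻¹ * (z.re • dG E M - z.im • dcG E M) * actG Complex.I * actG z := by
        rw [actG_dG, ← dcG]; simp only [mul_assoc, actG_comm z]
    _ = _ := by
        congr 1
        rw [mul_sub, sub_mul, mul_smul_comm, mul_smul_comm, smul_mul_assoc, smul_mul_assoc, ← dcG,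
          twist_dcG, smul_neg, sub_neg_eq_add, add_comm]

theorem delPart_mem {p q : ℕ} {u : ℂ ⊗[ℝ] Forms E M} (hu : u ∈ bidegreePart E M p q) :
    delPart (dG E M) (dcG E M) u ∈ bidegreePart E M (p + 1) q := fun z => by
  have h := LinearMap.congr_fun (mul_delPart (actG_dG (E := E) (M := M) z) (actG_dcG z)) u
  refine h.trans ?_
  have hz : (actG z).baseChange ℂ u = (z ^ p * (starRingEnd ℂ z) ^ q) • u := hu z
  rw [Module.End.mul_apply, hz, LinearMap.smul_apply, map_smul, smul_smul]
  congr 1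
  ring

theorem delbarPart_mem {p q : ℕ} {u : ℂ ⊗[ℝ] Forms E M} (hu : u ∈ bidegreePart E M p q) :
    delbarPart (dG E M) (dcG E M) u ∈ bidegreePart E M p (q + 1) := fun z => by
  have h := LinearMap.congr_fun (mul_delbarPart (actG_dG (E := E) (M := M) z) (actG_dcG z)) u
  refine h.trans ?_
  have hz : (actG z).baseChange ℂ u = (z ^ p * (starRingEnd ℂ z) ^ q) • u := hu z
  rw [Module.End.mul_apply, hz, LinearMap.smul_apply, map_smul, smul_smul]
  congr 1
  ring

theorem isDolbeaultSplitting_parts :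
    IsDolbeaultSplitting (E := E) (M := M) (delPart (dG E M) (dcG E M))
      (delbarPart (dG E M) (dcG E M)) :=
  ⟨delPart_add_delbarPart _ _, fun _ _ _ hu => ⟨delPart_mem hu, delbarPart_mem hu⟩⟩

theorem dcG_lefG : dcG E M * lefG g - lefG g * dcG E M =
    actG Complex.I⁻¹ * domG g * actG Complex.I := by
  have h := (actG_carries_lef g).eq
  have h' := ((actG_carries_lef g).symm actG_inv_mul actG_mul_inv).eq
  calc dcG E M * lefG g - lefG g * dcG E M
      = actG Complex.I⁻¹ * dG E M * (actG Complex.I * lefG g) -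
        (lefG g * actG Complex.I⁻¹) * dG E M * actG Complex.I := by
        rw [dcG]; simp only [mul_assoc]
    _ = actG Complex.I⁻¹ * (dG E M * lefG g - lefG g * dG E M) * actG Complex.I := by
        rw [h, ← h']; simp only [mul_assoc, mul_sub, sub_mul]
    _ = _ := by rw [dG_lefG]

theorem actG_wedge (z : ℂ) (a b : Forms E M) :
    actG z (wedgeG E M a b) = wedgeG E M (actG z a) (actG z b) := evAt_ext fun x => by
  rw [fibrewise_act z x, evAt_wedge, evAt_wedge, fibrewise_act z x, fibrewise_act z x]
  exact pullF_wedgeF _ _ _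

/-- The adjoint of a multiplication operator. -/
theorem isAdjG_wedge (b : Forms E M) : IsAdjG g (wedgeG E M b)
    (weylG g * wedgeG E M (triOp (Form E M) (actG Complex.I b)) * weylInvG g) := by
  have h := isAdjG_twist_wedge g (actG Complex.I b)
  have h1 : actG Complex.I⁻¹ * wedgeG E M (actG Complex.I b) * actG Complex.I = wedgeG E M b :=
    LinearMap.ext fun a => by
      rw [Module.End.mul_apply, Module.End.mul_apply, ← actG_wedge, ← Module.End.mul_apply,
        actG_inv_mul, Module.End.one_apply]
  rwa [h1] at h

/-- The adjoint of `dω ∧ -`. -/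
def domStar : Module.End ℝ (Forms E M) :=
  weylG g * wedgeG E M (triOp (Form E M) (actG Complex.I (dG E M (fundG g)))) * weylInvG g

theorem isAdjG_dom : IsAdjG g (domG g) (domStar g) := isAdjG_wedge g _

theorem isAdjG_tor : IsAdjG g (torG g) (domStar g * lefG g - lefG g * domStar g) :=
  ((isAdjG_lam g).mul (isAdjG_dom g)).sub ((isAdjG_dom g).mul (isAdjG_lam g))

end Dolbeault

/-! ### Commutators, adjoints and conjugates of the (1,0) and (0,1) parts. -/

section Complexify
variable {V : Type*} [AddCommGroup V] [Module ℝ V]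

theorem expSeries_conj_of_neg {f d D₁ D₂ : Module.End ℝ V} (h0 : f * d - d * f = -D₁)
    (h1 : f * -D₁ - -D₁ * f = D₂ + D₂) (h2 : f * D₂ - D₂ * f = 0) :
    PowerSeries.C d - PowerSeries.C D₁ * PowerSeries.X + PowerSeries.C D₂ * PowerSeries.X ^ 2 =
      expSeries f * PowerSeries.C d * expSeries (-f) := by
  refine expSeries_conj h0 ?_ h2
  rw [two_smul, ← h1, mul_neg, neg_mul]
  abel

theorem delPart_comm (P P' L : Module.End ℝ V) :
    gradedComm 1 2 (delPart P P') (L.baseChange ℂ) = delPart (P * L - L * P) (P' * L - L * P') := by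
  rw [gradedComm, Int.negOnePow_even _ (by decide), one_smul, cplx_mul_baseChange,
    baseChange_mul_cplx, cplx_sub, delPart]
  simp only [smul_mul_assoc, mul_smul_comm, smul_sub]

theorem comm_delPart (P P' L : Module.End ℝ V) :
    gradedComm (-2) 3 (L.baseChange ℂ) (delPart P P') =
      delPart (L * P - P * L) (L * P' - P' * L) := by
  rw [gradedComm, Int.negOnePow_even _ (by decide), one_smul, cplx_mul_baseChange,
    baseChange_mul_cplx, cplx_sub, delPart]
  simp only [smul_mul_assoc, mul_smul_comm, smul_sub]

theorem delPart_adjoint {b : LinearMap.BilinForm ℝ V} {P Q P' Q' : Module.End ℝ V}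
    (h : ∀ a a', b (P a) a' = b a (Q a')) (h' : ∀ a a', b (P' a) a' = b a (Q' a'))
    (u v : ℂ ⊗[ℝ] V) : b.baseChange ℂ (delPart P P' u) (conjT V v) =
      b.baseChange ℂ u (conjT V (delbarPart Q Q' v)) :=
  cplx_adjoint (fun a a' => by simp only [LinearMap.smul_apply, map_smul, h])
    (fun a a' => by simp only [LinearMap.smul_apply, map_smul, h']) u v

theorem conj_delbarPart (H P P' : Module.End ℝ V) :
    -(H.baseChange ℂ * delbarPart P P' * H.baseChange ℂ) =
      delbarPart (-(H * P * H)) (-(H * P' * H)) := by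
  rw [baseChange_mul_cplx, cplx_mul_baseChange, cplx_neg, delbarPart]
  simp only [smul_mul_assoc, mul_smul_comm, smul_neg, mul_neg, neg_mul]

theorem delbarPart_add (P P' Q Q' : Module.End ℝ V) :
    delbarPart P P' + delbarPart Q Q' = delbarPart (P + Q) (P' + Q') := by
  rw [cplx_add, delbarPart]; simp only [smul_add, neg_add]

theorem delbarPart_add_conj (P P' : Module.End ℝ V) (u : ℂ ⊗[ℝ] V) :
    P.baseChange ℂ u = delbarPart P P' u + conjT V (delbarPart P P' (conjT V u)) := by
  rw [← cplx_add_conj, half_add_half]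

theorem I_smul_delbarPart_add_conj (P P' : Module.End ℝ V) (u : ℂ ⊗[ℝ] V) :
    P'.baseChange ℂ u = (Complex.I • delbarPart P P') u +
      conjT V ((Complex.I • delbarPart P P') (conjT V u)) := by
  rw [I_smul_cplx, neg_neg, ← cplx_add_conj, half_add_half]

theorem neg_I_smul_delbarPart_add_conj (P P' : Module.End ℝ V) (u : ℂ ⊗[ℝ] V) :
    (-P').baseChange ℂ u = (-(Complex.I • delbarPart P P')) u +
      conjT V ((-(Complex.I • delbarPart P P')) (conjT V u)) := by
  rw [I_smul_cplx, neg_neg, cplx_neg, ← cplx_add_conj, ← neg_add, half_add_half]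

theorem neg_I_smul_star_add_conj (H d dc Q Q' : Module.End ℝ V) (u : ℂ ⊗[ℝ] V) :
    (-(-(H * dc * H) + Q')).baseChange ℂ u =
      (-(Complex.I • (-(H.baseChange ℂ * delbarPart d dc * H.baseChange ℂ) + delbarPart Q Q'))) u +
      conjT V ((-(Complex.I • (-(H.baseChange ℂ * delbarPart d dc * H.baseChange ℂ) +
        delbarPart Q Q'))) (conjT V u)) := by
  rw [conj_delbarPart, delbarPart_add, ← neg_I_smul_delbarPart_add_conj]

end Complexify

/-! ### The Dolbeault form of the structure, and the final assembly. -/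

section Dolbeault
variable {E : Type*} [NormedAddCommGroup E] [NormedSpace ℂ E] [FiniteDimensional ℂ E] {M : Type*}
  [TopologicalSpace M] [ChartedSpace E M] [IsManifold 𝓘(ℂ, E) ω M] (g : HermitianMetric E M)

variable (E M) in
/-- The operator `∂`. -/
def delC : Module.End ℂ (DeRhamC E M) := delPart (dR E M) (twist (dR E M))

variable (E M) in
/-- The operator `∂̄`. -/
def delbarC : Module.End ℂ (DeRhamC E M) := delbarPart (dR E M) (twist (dR E M))

theorem isDolbeaultSplitting_delC : IsDolbeaultSplitting (delC E M) (delbarC E M) :=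
  isDolbeaultSplitting_parts

theorem lamOp_delC :
    lamOp g (delC E M) = delPart (wedgeDOmega g) (twist (wedgeDOmega g)) := by
  have h1 : dR E M * lefschetz g - lefschetz g * dR E M = wedgeDOmega g := dG_lefG g
  have h2 : twist (dR E M) * lefschetz g - lefschetz g * twist (dR E M) = twist (wedgeDOmega g) :=
    dcG_lefG g
  rw [lamOp, delC, delPart_comm, h1, h2]

theorem torsion_eq (Λ : Module.End ℝ (DeRham E M)) :
    torsion g Λ = Λ * wedgeDOmega g - wedgeDOmega g * Λ := by
  rw [torsion, gradedComm, Int.negOnePow_even _ (by decide), one_smul]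

variable {g} in
theorem isHermitianAdjoint_delPart {P Q P' Q' : Module.End ℝ (DeRham E M)}
    (h : IsMetricAdjoint g P Q) (h' : IsMetricAdjoint g P' Q') :
    IsHermitianAdjoint g (delPart P P') (delbarPart Q Q') :=
  fun x => delPart_adjoint (h x) (h' x)

theorem isSumWithConj_delStar (Q Q' : Module.End ℝ (DeRham E M)) :
    IsSumWithConj (-(dcStar g + Q'))
      (-(Complex.I • (delStar g (delbarC E M) + delbarPart Q Q'))) :=
  neg_I_smul_star_add_conj (hodge g) (dR E M) (twist (dR E M)) Q Q'

/-- Here λ = ½(dω + i dω_c) and, since T_c = [Λ, dω_c], τ = ½(T + i T_c). Their adjoints combine the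
adjoints of the real and of the twisted operators, and multiplication by ±i selects the twisted part
when the complex conjugate is added. -/
theorem exists_dolbeault {Λ T T' D : Module.End ℝ (DeRham E M)}
    (hΛ : twist (torsion g Λ) = Λ * twist (wedgeDOmega g) - twist (wedgeDOmega g) * Λ)
    (hT : IsMetricAdjoint g (twist (torsion g Λ)) T) (hT' : IsMetricAdjoint g (torsion g Λ) T')
    (hD : IsMetricAdjoint g (twist (wedgeDOmega g)) D) :
    ∃ del delbar tauStar lamStar : Module.End ℂ (DeRhamC E M),
      IsDolbeaultSplitting del delbar ∧ IsHermitianAdjoint g (tauOp g Λ del) tauStar ∧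
      IsHermitianAdjoint g (lamOp g del) lamStar ∧ IsSumWithConj (dR E M) delbar ∧
      IsSumWithConj (-(dcStar g + T)) (-(Complex.I • (delStar g delbar + tauStar))) ∧
      IsSumWithConj D (Complex.I • lamStar) := by
  obtain ⟨D', hD'⟩ : ∃ D', IsMetricAdjoint g (wedgeDOmega g) D' := ⟨_, isAdjG_dom g⟩
  refine ⟨delC E M, delbarC E M, delbarPart T' T, delbarPart D' D, isDolbeaultSplitting_delC,
    ?_, ?_, delbarPart_add_conj _ _, isSumWithConj_delStar g _ _, I_smul_delbarPart_add_conj _ _⟩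
  · rw [tauOp, lamOp_delC, comm_delPart, ← torsion_eq, ← hΛ]
    exact isHermitianAdjoint_delPart hT' hT
  · rw [lamOp_delC]
    exact isHermitianAdjoint_delPart hD' hD

variable (E M) in
theorem degreePart_eq : degreePart E M = formsGrade E M := by
  funext i
  cases i <;> rfl

variable (E M) in
/-- The operator `J⁻¹ P J`. -/
def twistG (P : Module.End ℝ (Forms E M)) : Module.End ℝ (Forms E M) :=
  actG Complex.I⁻¹ * P * actG Complex.I

/-- The relation -(d_c^* + T_c^*) = [Λ, d] reduces every clause to a property of derived brackets.
The adjoint T' of the untwisted torsion is kept for the operator τ^*. -/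
theorem exists_operators : ∃ Λ T T' D : Module.End ℝ (Forms E M),
    IsAdjG g (lefG g) Λ ∧ IsAdjG g (twistG E M (Λ * domG g - domG g * Λ)) T ∧
    IsAdjG g (Λ * domG g - domG g * Λ) T' ∧ IsAdjG g (twistG E M (domG g)) D ∧
    IsCommBVInfinity (formsGrade E M) (wedgeG E M) (oneG E M) (opSeq (dG E M) (-(dcsG g + T)) D) ∧
    Λ * dG E M - dG E M * Λ = -(dcsG g + T) ∧
    Λ * -(dcsG g + T) - -(dcsG g + T) * Λ = D + D ∧ Λ * D - D * Λ = 0 ∧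
    twistG E M (Λ * domG g - domG g * Λ) = Λ * twistG E M (domG g) - twistG E M (domG g) * Λ := by
  have h : -(dcsG g + torStar g) = delta₁ g := by rw [dcsG_add_torStar, neg_neg]
  refine ⟨lamG g, torStar g, _, delta₂ g, isAdjG_lef g, isAdjG_twist_tor g, isAdjG_tor g,
    isAdjG_twist_dom g, ?_, ?_, ?_, (weylG_differential g).2.2, twist_torG g⟩
  · rw [h]
    exact isCommBVInfinity_forms g
  · rw [h, delta₁]
  · rw [h, lamG_delta₁, two_smul]

theorem exists_operators_deRham : ∃ Λ T T' D : Module.End ℝ (DeRham E M),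
    IsMetricAdjoint g (lefschetz g) Λ ∧ IsMetricAdjoint g (twist (torsion g Λ)) T ∧
    IsMetricAdjoint g (torsion g Λ) T' ∧ IsMetricAdjoint g (twist (wedgeDOmega g)) D ∧
    IsCommBVInfinity (degreePart E M) (wedge E M) (oneForm E M)
      (opSeq (dR E M) (-(dcStar g + T)) D) ∧
    Λ * dR E M - dR E M * Λ = -(dcStar g + T) ∧
    Λ * -(dcStar g + T) - -(dcStar g + T) * Λ = D + D ∧ Λ * D - D * Λ = 0 ∧
    twist (torsion g Λ) = Λ * twist (wedgeDOmega g) - twist (wedgeDOmega g) * Λ := by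
  simp only [torsion_eq]
  rw [degreePart_eq]
  obtain ⟨Λ, T, T', D, h1, h2, h3, h4, h5, h6, h7, h8, h9⟩ := exists_operators g
  refine ⟨Λ, T, T', D, ?_, ?_, ?_, ?_, ?_, ?_, ?_, ?_, ?_⟩
  · exact h1
  · exact h2
  · exact h3
  · exact h4
  · exact h5
  · exact h6
  · exact h7
  · exact h8
  · exact h9

end Dolbeault
end
end HermitianBV

theorem mainTheorem6 {E : Type*} [NormedAddCommGroup E] [NormedSpace ℂ E] [FiniteDimensional ℂ E]
    {M : Type*} [TopologicalSpace M] [ChartedSpace E M] [IsManifold 𝓘(ℂ, E) ω M]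
    (g : HermitianBV.HermitianMetric E M) :
    ∃ Λ TcStar dωcStar : Module.End ℝ (HermitianBV.DeRham E M),
      HermitianBV.IsMetricAdjoint g (HermitianBV.lefschetz g) Λ ∧
      HermitianBV.IsMetricAdjoint g (HermitianBV.twist (HermitianBV.torsion g Λ)) TcStar ∧
      HermitianBV.IsMetricAdjoint g (HermitianBV.twist (HermitianBV.wedgeDOmega g)) dωcStar ∧
      HermitianBV.IsCommBVInfinity (HermitianBV.degreePart E M) (HermitianBV.wedge E M)
        (HermitianBV.oneForm E M)
        (HermitianBV.opSeq (HermitianBV.dR E M) (-(HermitianBV.dcStar g + TcStar)) dωcStar) ∧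
      PowerSeries.C (HermitianBV.dR E M)
          - PowerSeries.C (HermitianBV.dcStar g + TcStar) * PowerSeries.X
          + PowerSeries.C dωcStar * PowerSeries.X ^ 2
        = HermitianBV.expSeries Λ * PowerSeries.C (HermitianBV.dR E M)
          * HermitianBV.expSeries (-Λ) ∧
      ∃ del delbar tauStar lamStar : Module.End ℂ (HermitianBV.DeRhamC E M),
        HermitianBV.IsDolbeaultSplitting del delbar ∧
        HermitianBV.IsHermitianAdjoint g (HermitianBV.tauOp g Λ del) tauStar ∧
        HermitianBV.IsHermitianAdjoint g (HermitianBV.lamOp g del) lamStar ∧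
        HermitianBV.IsSumWithConj (HermitianBV.dR E M) delbar ∧
        HermitianBV.IsSumWithConj (-(HermitianBV.dcStar g + TcStar))
          (-(Complex.I • (HermitianBV.delStar g delbar + tauStar))) ∧
        HermitianBV.IsSumWithConj dωcStar (Complex.I • lamStar) :=
  let ⟨Λ, T, _, D, h1, h2, h3, h4, h5, h6, h7, h8, h9⟩ := HermitianBV.exists_operators_deRham g
  ⟨Λ, T, D, h1, h2, h4, h5, HermitianBV.expSeries_conj_of_neg h6 h7 h8,
    HermitianBV.exists_dolbeault g h9 h2 h3 h4⟩
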